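/- **Setting.** Let $M=M(N)$ and $L=L(N)$, $N\ge 1$, be integers with $M\to\infty$ and $c_N:=ML/N\to c\in(0,\infty)$ as $N\to\infty$. Let $(\mathcal S_m)_{m\ge1}$ be integrable functions on $[0,1]$ and $r_m(k)=\int_0^1\mathcal S_m(\nu)e^{2i\pi\nu k}\,d\nu$, $k\in\mathbb Z$, such that $$\sup_{m,\nu}\mathcal S_m(\nu)<\infty,\qquad \inf_{m,\nu}\mathcal S_m(\nu)>0,\qquad \sup_{K\ge1}\sum_{n\in\mathbb Z}\Big(\frac1K\sum_{m=1}^K|r_m(n)|^2\Big)^{1/2}<\infty .$$ On one probability space let, for each $N$, $(w_{m,N}(n))_{1\le m\le M,\,1\le n\le N+L-1}$ be jointly Gaussian, circularly symmetric, centred complex random variables with $\mathbb E[w_{m,N}(k)\overline{w_{m',N}(k')}]=\delta_{m,m'}\,r_m(k-k')/N$ (and $\mathbb E[w_{m,N}(k)w_{m',N}(k')]=0$); nothing is assumed on the joint law for different $N$. Let $\mathbf W_N$ be the $ML\times N$ matrix obtained by stacking the $M$ Hankel blocks $\mathbf W_{m,N}=(w_{m,N}(i+j-1))_{1\le i\le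 L,\,1\le j\le N}$, let $\mathbf Q_N(z)=(\mathbf W_N\mathbf W_N^H-z\mathbf I)^{-1}$ for $z\in\mathbb C\setminus\mathbb R^+$, $\mathbb R^+=[0,\infty)$, and let $q_N(z)=\frac1{ML}\sum_k(\hat\lambda_{k,N}-z)^{-1}$, where $(\hat\lambda_{k,N})_k$ are the eigenvalues of $\mathbf W_N\mathbf W_N^H$. **Canonical equation.** Let $\mathcal S_K(\mathbb R^+)$ be the set of functions $z\mapsto\int_{\mathbb R^+}\frac{d\boldsymbol\mu(\lambda)}{\lambda-z}$ on $\mathbb C\setminus\mathbb R^+$, where $\boldsymbol\mu$ is a positive $K\times K$ matrix-valued measure carried by $\mathbb R^+$ with $\boldsymbol\mu(\mathbb R^+)=\mathbf I_K$. For an $R\times R$ matrix $\mathbf A$ and $|l|<R$ put $\tau(\mathbf A)(l)=\frac1R\mathrm{tr}(\mathbf A\mathbf J_R^l)$, where $\mathbf J_R^{l}$ is the matrix with entries $(\mathbf J_R^{l})_{i,j}=\mathbf 1_{j-i=l}$, and let $\Psi^{(m)}_K(\mathbf A)$ be the $K\times K$ matrix with entries $\sum_{l=-R+1}^{R-1}r_m(i-j-l)\,\tau(\mathbf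 A)(l)$. For an $N\times N$ matrix $\mathbf A$ let $\Psi(\mathbf A)$ be the block-diagonal $ML\times ML$ matrix with $m$-th diagonal block $\Psi_L^{(m)}(\mathbf A)$; for an $ML\times ML$ matrix $\mathbf A$ with $L\times L$ diagonal blocks $\mathbf A^{m,m}$ let $\overline\Psi(\mathbf A)=\frac1M\sum_{m=1}^M\Psi_N^{(m)}(\mathbf A^{m,m})$. **Theorem.** For each $N$ (with $M,L\ge1$) there is a unique pair $(\mathbf T_N,\widetilde{\mathbf T}_N)\in\mathcal S_{ML}(\mathbb R^+)\times\mathcal S_N(\mathbb R^+)$ such that, for every $z\in\mathbb C\setminus\mathbb R^+$, $$\mathbf T_N(z)=-\frac1z\Big(\mathbf I_{ML}+\Psi\big(\widetilde{\mathbf T}_N(z)^T\big)\Big)^{-1},\qquad \widetilde{\mathbf T}_N(z)=-\frac1z\Big(\mathbf I_N+c_N\,\overline\Psi\big(\mathbf T_N(z)\big)^T\Big)^{-1},$$ the matrices to be inverted being invertible. Moreover $\mathbf Q_N(z)$ has integrable entries, and for every sequence $(\mathbf A_N)$ of deterministic $ML\times ML$ matrices with $\sup_N\|\mathbf A_N\|<\infty$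 (spectral norm) and every $z\in\mathbb C\setminus\mathbb R^+$, as $N\to\infty$, $$\frac1{ML}\mathrm{tr}\big(\mathbf A_N(\mathbf Q_N(z)-\mathbb E\mathbf Q_N(z))\big)\to0\ \text{ almost surely},\qquad \frac1{ML}\mathrm{tr}\big(\mathbf A_N(\mathbb E\mathbf Q_N(z)-\mathbf T_N(z))\big)\to0,$$ and hence $$\frac1{ML}\mathrm{tr}\big(\mathbf A_N(\mathbf Q_N(z)-\mathbf T_N(z))\big)\to0\ \text{ almost surely}.$$ In particular, with $t_N(z)=\frac1{ML}\mathrm{tr}\,\mathbf T_N(z)$, for every $z\in\mathbb C\setminus\mathbb R^+$ one has $q_N(z)-t_N(z)\to0$ almost surely. -/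

import Mathlib

open MeasureTheory ProbabilityTheory Filter Topology Matrix
open scoped ComplexOrder

noncomputable section

namespace BlockHankel

/-- The cut plane `ℂ ∖ ℝ⁺`, where `ℝ⁺ = [0, ∞)`. -/
def cutPlane : Set ℂ := ((fun x : ℝ => (x : ℂ)) '' Set.Ici 0)ᶜ

/-! ### Stieltjes transforms of positive matrix-valued measures -/

/-- `μ`, given by its entries (complex measures on `ℝ`), is a positive matrix-valued measure
carried by `ℝ⁺` with total mass `μ(ℝ⁺) = I`. -/
structure IsNormalizedPosMatrixMeasure {ι : Type*} [Fintype ι] [DecidableEq ι]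
    (μ : ι → ι → ComplexMeasure ℝ) : Prop where
  posSemidef : ∀ s : Set ℝ, MeasurableSet s → (Matrix.of fun i j => μ i j s).PosSemidef
  carried : ∀ s : Set ℝ, MeasurableSet s → s ⊆ Set.Iio 0 → ∀ i j, μ i j s = 0
  mass : ∀ i j, μ i j (Set.Ici 0) = (1 : Matrix ι ι ℂ) i j

/-- The class `𝒮_K(ℝ⁺)` (with `K = |ι|`): `S(z) = ∫ dμ(λ) / (λ - z)` for every `z ∈ ℂ ∖ ℝ⁺`, where
`μ` is a positive matrix-valued measure carried by `ℝ⁺` with `μ(ℝ⁺) = I`. The integral is taken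
entrywise, against the complex measures `μ i j`. Values of `S` on `ℝ⁺` are irrelevant. -/
def IsStieltjes {ι : Type*} [Fintype ι] [DecidableEq ι] (S : ℂ → Matrix ι ι ℂ) : Prop :=
  ∃ μ : ι → ι → ComplexMeasure ℝ, IsNormalizedPosMatrixMeasure μ ∧
    ∀ z ∈ cutPlane, ∀ i j, S z i j =
      (μ i j).integral (fun x : ℝ => ((x : ℂ) - z)⁻¹) (ContinuousLinearMap.mul ℝ ℂ)

/-! ### Toeplitzification operators -/

/-- `J_R ^ l` for `l ∈ ℤ`: `J_R` has ones on the first upper diagonal and zeros elsewhere, and a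
negative power is, by convention, a power of the transpose. So `J_R ^ l` has ones exactly on the
`l`-th diagonal. -/
def shiftPow (R : ℕ) (l : ℤ) : Matrix (Fin R) (Fin R) ℂ :=
  Matrix.of fun i j => if (j : ℤ) - (i : ℤ) = l then 1 else 0

/-- `τ(A)(l) = (1/R) tr (A J_R ^ l)`. -/
def tau {R : ℕ} (A : Matrix (Fin R) (Fin R) ℂ) (l : ℤ) : ℂ :=
  (1 / (R : ℂ)) * (A * shiftPow R l).trace

/-- `Ψ_K(A)` for an `R × R` matrix `A`, associated with the correlation sequence `r`: the `K × K`
Toeplitz matrix with entries `∑_{l=-R+1}^{R-1} r(i - j - l) τ(A)(l)`. -/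
def toeplitzOp (r : ℤ → ℂ) {R : ℕ} (K : ℕ) (A : Matrix (Fin R) (Fin R) ℂ) :
    Matrix (Fin K) (Fin K) ℂ :=
  Matrix.of fun i j =>
    ∑ l ∈ Finset.Ioo (-(R : ℤ)) (R : ℤ), r ((i : ℤ) - (j : ℤ) - l) * tau A l

/-- `Ψ(A)` for an `N × N` matrix `A`: the block diagonal `ML × ML` matrix whose `m`-th diagonal
block is `Ψ_L^{(m)}(A)`. An index `(m, i)` stands for row `i` of block `m`. -/
def Psi (r : ℕ → ℤ → ℂ) (M L : ℕ) {N : ℕ} (A : Matrix (Fin N) (Fin N) ℂ) :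
    Matrix (Fin M × Fin L) (Fin M × Fin L) ℂ :=
  Matrix.of fun p q => if p.1 = q.1 then toeplitzOp (r p.1) L A p.2 q.2 else 0

/-- `Ψ̄(A) = (1/M) ∑_m Ψ_N^{(m)}(A^{m,m})` for an `ML × ML` matrix `A`, where `A^{m,m}` is the `m`-th
`L × L` diagonal block of `A`. -/
def PsiBar (r : ℕ → ℤ → ℂ) {M L : ℕ} (N : ℕ) (A : Matrix (Fin M × Fin L) (Fin M × Fin L) ℂ) :
    Matrix (Fin N) (Fin N) ℂ :=
  (1 / (M : ℂ)) • ∑ m : Fin M, toeplitzOp (r m) N (Matrix.of fun i j => A (m, i) (m, j))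

/-! ### The canonical equation -/

/-- `(T, T')` belongs to `𝒮_{ML}(ℝ⁺) × 𝒮_N(ℝ⁺)` and solves, on `ℂ ∖ ℝ⁺`, the canonical equation
`T(z) = -(1/z) (I + Ψ(T'(z)ᵀ))⁻¹`, `T'(z) = -(1/z) (I + c_N Ψ̄(T(z))ᵀ)⁻¹`, with `c_N = ML/N`. The two
matrices to be inverted are required to be invertible. -/
structure IsCanonicalSolution (r : ℕ → ℤ → ℂ) (M L N : ℕ)
    (T : ℂ → Matrix (Fin M × Fin L) (Fin M × Fin L) ℂ)
    (T' : ℂ → Matrix (Fin N) (Fin N) ℂ) : Prop where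
  stieltjes : IsStieltjes T
  stieltjes' : IsStieltjes T'
  isUnit : ∀ z ∈ cutPlane, IsUnit (1 + Psi r M L (T' z)ᵀ)
  isUnit' : ∀ z ∈ cutPlane, IsUnit (1 + ((M * L : ℂ) / N) • (PsiBar r N (T z))ᵀ)
  eq : ∀ z ∈ cutPlane, T z = (-1 / z) • (1 + Psi r M L (T' z)ᵀ)⁻¹
  eq' : ∀ z ∈ cutPlane, T' z = (-1 / z) • (1 + ((M * L : ℂ) / N) • (PsiBar r N (T z))ᵀ)⁻¹

/-! ### The random matrix model -/

/-- The correlation sequence `r(k) = ∫_0^1 S(ν) exp(2iπνk) dν` of the spectral density `S`. -/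
def corr (S : ℝ → ℝ) (k : ℤ) : ℂ :=
  ∫ ν in (0 : ℝ)..1, (S ν : ℂ) * Complex.exp (2 * Complex.I * Real.pi * ν * k)

/-- The family `(w m n)`, `m < M`, `n < N + L - 1`, is centred, circularly symmetric and jointly
complex Gaussian, with `𝔼[w m k conj(w m' k')] = δ_{m,m'} r_m(k - k') / N`. In particular the
`M` families `(w m n)_n` are mutually independent. -/
structure IsGaussianModel {Ω : Type*} [MeasurableSpace Ω] (P : Measure Ω) (r : ℕ → ℤ → ℂ)
    (M L N : ℕ) (w : Fin M → Fin (N + L - 1) → Ω → ℂ) : Prop where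
  gaussian : HasGaussianLaw (fun ω => fun p : Fin M × Fin (N + L - 1) => w p.1 p.2 ω) P
  mean : ∀ m n, ∫ ω, w m n ω ∂P = 0
  cov : ∀ m m' k k', ∫ ω, w m k ω * (starRingEnd ℂ) (w m' k' ω) ∂P =
    if m = m' then r m ((k : ℤ) - (k' : ℤ)) / N else 0
  circular : ∀ m m' k k', ∫ ω, w m k ω * w m' k' ω ∂P = 0

/-- The `ML × N` block-Hankel matrix with entry `w m (i + j)` in row `i` of block `m` and
column `j` (all indices start at `0`). -/
def hankel {Ω : Type*} {M L N : ℕ} (w : Fin M → Fin (N + L - 1) → Ω → ℂ) (ω : Ω) :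
    Matrix (Fin M × Fin L) (Fin N) ℂ :=
  Matrix.of fun p j => w p.1 ⟨(p.2 : ℕ) + (j : ℕ), by omega⟩ ω

/-- The resolvent `Q(z) = (W Wᴴ - z I)⁻¹`. -/
def resolvent {Ω : Type*} {M L N : ℕ} (w : Fin M → Fin (N + L - 1) → Ω → ℂ) (z : ℂ) (ω : Ω) :
    Matrix (Fin M × Fin L) (Fin M × Fin L) ℂ :=
  (hankel w ω * (hankel w ω)ᴴ - z • 1)⁻¹

/-- The (entrywise) expectation `𝔼[Q(z)]` of the resolvent. -/
def meanResolvent {Ω : Type*} [MeasurableSpace Ω] (P : Measure Ω) {M L N : ℕ}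
    (w : Fin M → Fin (N + L - 1) → Ω → ℂ) (z : ℂ) :
    Matrix (Fin M × Fin L) (Fin M × Fin L) ℂ :=
  Matrix.of fun p q => ∫ ω, resolvent w z ω p q ∂P

/-- The normalized trace `(1/(ML)) tr A`. -/
def ntr {M L : ℕ} (A : Matrix (Fin M × Fin L) (Fin M × Fin L) ℂ) : ℂ :=
  (1 / (M * L : ℂ)) * A.trace

/-- The Stieltjes transform `q_N(z) = (1/(ML)) ∑_k 1/(λ_k - z)` of the empirical distribution of
the eigenvalues `λ_k` of `W Wᴴ`. -/
def empStieltjes {Ω : Type*} {M L N : ℕ} (w : Fin M → Fin (N + L - 1) → Ω → ℂ) (z : ℂ) (ω : Ω) :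
    ℂ :=
  (1 / (M * L : ℂ)) *
    ∑ k, 1 / (((Matrix.isHermitian_mul_conjTranspose_self (hankel w ω)).eigenvalues k : ℂ) - z)

end BlockHankel

end

open MeasureTheory ProbabilityTheory Filter Topology Matrix
open scoped ComplexOrder

noncomputable section

namespace BlockHankel

set_option linter.unusedSectionVars false

section

/-! ### The cut plane -/

/-! Let `W` be the block-Hankel matrix, `Q = (W Wᴴ - z)⁻¹`, `Q' = (Wᴴ W - z)⁻¹`, `η(B) = 𝔼[W B Wᴴ]`
and `η*(D) = 𝔼[Wᴴ D W]`. Then `η(B) = Ψ(Bᵀ)` and `η*(D) = c_N Ψ̄(D)ᵀ`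
(`IsGaussianModel.kraus_eq_Psi`, `IsGaussianModel.kraus_conjTranspose_eq_PsiBar`), so the canonical
equation reads `T (1 + η(T')) = -1/z`, `T' (1 + η*(T)) = -1/z`. A factorization of the covariance
writes `η` as `B ↦ ∑ A_a B A_aᴴ`. Existence, uniqueness, concentration and the approximate equation
are proved for such maps and for general circular Gaussian matrices; the Hankel structure enters
only through norms of the covariance.

Existence: iterate the equation from `-1/z`. By a Schur complement (`IsCorner.next`) every iterate
is a corner `Vᴴ (G Gᴴ - z)⁻¹ V` of a resolvent, hence the Stieltjes transform of a matrix measure of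
mass `I` with first moment bounded uniformly along the iteration. This is tightness, and
`exists_isStieltjes_of_hasSpectralForm` gives limits along an ultrafilter. On a disc far to the left
the canonical map contracts the Frobenius norm, so consecutive iterates merge and the limit solves
the equation there; analytic continuation covers the cut plane. Uniqueness uses the same contraction
and the same continuation.

Fluctuations: for independent centred Gaussian copies `x, y`, the law of the pair is invariant under
rotation. Joining `x` to `y` by a quarter circle gives an `L⁴` Poincaré inequality
(`HasCircularDeriv.integral_norm_sub_integral_pow_four_le`), whence `𝔼|tr A(Q - 𝔼Q)|⁴ ≤ K v²
‖A‖_F⁴`, where `v` bounds the covariance as an operator. A sample occurs at most `L` times in a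
Hankel block, so `v = bL/N` works. The fourth moments of the normalized traces are then `O(N⁻²)`,
which is summable.

Mean: differentiating the same rotation invariance gives integration by parts, and with it `𝔼Q (1 +
η(𝔼Q')) = -1/z + Δ`, where `Δ = -𝔼[Q η(Q' - 𝔼Q')]`. The entries of `η(Q' - 𝔼Q')` are centred traces,
so `‖Δ‖_F²` is at most a constant times `v` times the squared Hilbert-Schmidt norm of the
covariance, that is `O((L/N)² ML)`. Since `η` has Frobenius norm at most `b √c_N`
(`frob_kraus_le_sqrt`), the contraction is uniform in `N` on a fixed disc, and there the normalized
trace of `A(𝔼Q - T)` is `O(L/N)`. This tends to `0` because `L/N = c_N/M`. A Vitali argument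
(`tendsto_zero_of_isPreconnected`) carries the limit to the whole cut plane. -/

lemma cutPlane_eq : cutPlane = {z : ℂ | -z ∈ Complex.slitPlane} := by
  ext z
  simp only [cutPlane, Set.mem_compl_iff, Set.mem_image, Set.mem_Ici, Set.mem_ofPred_eq,
    Complex.mem_slitPlane_iff, Complex.neg_re, Complex.neg_im, neg_ne_zero]
  constructor
  · intro h
    by_contra! h'
    exact h ⟨z.re, by linarith [h'.1], Complex.ext (by simp) (by simp [h'.2])⟩
  · rintro h ⟨x, hx, rfl⟩
    simp at h
    linarith

lemma isOpen_cutPlane : IsOpen cutPlane := by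
  rw [cutPlane_eq]
  exact Complex.isOpen_slitPlane.preimage continuous_neg

lemma isPreconnected_cutPlane : IsPreconnected cutPlane := by
  have h : cutPlane = (fun z : ℂ => -z) '' Complex.slitPlane := by
    rw [cutPlane_eq]
    ext z
    simp only [Set.mem_ofPred_eq, Set.mem_image]
    exact ⟨fun h => ⟨-z, h, neg_neg z⟩, by rintro ⟨y, hy, rfl⟩; simpa using hy⟩
  rw [h]
  exact (Complex.starConvex_one_slitPlane.isPathConnected
    Complex.one_mem_slitPlane).isConnected.isPreconnected.image _ continuous_neg.continuousOn

lemma neg_mem_cutPlane {t : ℝ} (ht : 0 < t) : (-t : ℂ) ∈ cutPlane := by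
  rw [cutPlane_eq]
  simp [Complex.mem_slitPlane_iff, ht]

lemma zero_notMem_cutPlane : (0 : ℂ) ∉ cutPlane := by
  rw [cutPlane_eq]
  simp [Complex.mem_slitPlane_iff]

lemma ne_zero_of_mem_cutPlane {z : ℂ} (hz : z ∈ cutPlane) : z ≠ 0 := by
  rintro rfl
  exact zero_notMem_cutPlane hz

/-- The distance from `z` to the half line `ℝ⁺`. -/
def rayDist (z : ℂ) : ℝ := Metric.infDist z ((fun x : ℝ => (x : ℂ)) '' Set.Ici 0)

lemma continuous_rayDist : Continuous rayDist := Metric.continuous_infDist_pt _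

lemma rayDist_pos {z : ℂ} (hz : z ∈ cutPlane) : 0 < rayDist z := by
  have hc : IsClosed ((fun x : ℝ => (x : ℂ)) '' Set.Ici 0) := by
    rw [← isOpen_compl_iff]
    exact isOpen_cutPlane
  exact (hc.notMem_iff_infDist_pos ⟨0, 0, by simp⟩).1 hz

lemma rayDist_le (z : ℂ) {x : ℝ} (hx : 0 ≤ x) : rayDist z ≤ ‖(x : ℂ) - z‖ := by
  rw [norm_sub_rev, ← dist_eq_norm]
  exact Metric.infDist_le_dist_of_mem ⟨x, hx, rfl⟩

lemma sub_ne_zero_of_mem_cutPlane {z : ℂ} (hz : z ∈ cutPlane) {x : ℝ} (hx : 0 ≤ x) :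
    (x : ℂ) - z ≠ 0 :=
  norm_pos_iff.1 ((rayDist_pos hz).trans_le (rayDist_le z hx))

lemma norm_inv_sub_le {z : ℂ} (hz : z ∈ cutPlane) {x : ℝ} (hx : 0 ≤ x) :
    ‖((x : ℂ) - z)⁻¹‖ ≤ (rayDist z)⁻¹ := by
  rw [norm_inv]
  exact inv_anti₀ (rayDist_pos hz) (rayDist_le z hx)

/-- Comparing real parts suffices. Far to the left `(rayDist z)⁻¹` is therefore small, and every
contraction argument takes place on such a disc. -/
lemma rayDist_neg_ge {t : ℝ} {z : ℂ} (hz : z ∈ Metric.ball (-t : ℂ) 1) : t - 1 ≤ rayDist z := by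
  refine (Metric.le_infDist (Set.Nonempty.image _ Set.nonempty_Ici)).2 ?_
  rintro _ ⟨x, hx, rfl⟩
  rw [Metric.mem_ball, dist_eq_norm] at hz
  have h1 : |(z + t).re| ≤ ‖z + t‖ := Complex.abs_re_le_norm _
  have h2 : |(z - x).re| ≤ ‖z - x‖ := Complex.abs_re_le_norm _
  rw [sub_neg_eq_add] at hz
  simp only [Complex.add_re, Complex.sub_re, Complex.ofReal_re] at h1 h2
  rw [dist_eq_norm]
  have := abs_le.1 h1
  have := abs_le.1 h2
  have : (0 : ℝ) ≤ x := hx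
  linarith

lemma ball_neg_subset_cutPlane {t : ℝ} (ht : 1 < t) : Metric.ball (-t : ℂ) 1 ⊆ cutPlane := by
  rintro z hz ⟨x, hx, rfl⟩
  have h := rayDist_neg_ge hz
  have : rayDist (x : ℂ) ≤ 0 := by simpa using rayDist_le (x : ℂ) hx
  linarith

/-! ### A convergence theorem of Vitali type -/

/-- A bounded sequence of holomorphic functions on a disc which tends to `0` on a smaller
concentric disc tends to `0`. -/
lemma tendsto_zero_on_ball {f : ℕ → ℂ → ℂ} {z₀ : ℂ} {r R C : ℝ} (hr : 0 < r) 
    (hf : ∀ n, DifferentiableOn ℂ (f n) (Metric.ball z₀ R))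
    (hC : ∀ n, ∀ z ∈ Metric.ball z₀ R, ‖f n z‖ ≤ C)
    (h0 : ∀ z ∈ Metric.ball z₀ r, Tendsto (fun n => f n z) atTop (𝓝 0)) :
    ∀ z ∈ Metric.ball z₀ R, Tendsto (fun n => f n z) atTop (𝓝 0) := by
  intro z hz
  obtain ⟨R', hzR', hR'⟩ := exists_between (Metric.mem_ball.1 hz)
  have hR'0 : 0 < R' := dist_nonneg.trans_lt hzR'
  have hsub : ∀ {s : ℝ}, s ≤ R' → Metric.closedBall z₀ s ⊆ Metric.ball z₀ R := fun hs =>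
    (Metric.closedBall_subset_closedBall hs).trans (Metric.closedBall_subset_ball hR')
  have hcl : ∀ {s : ℝ}, 0 < s → s ≤ R' → ∀ n, DiffContOnCl ℂ (f n) (Metric.ball z₀ s) := by
    intro s hs0 hs n
    refine DifferentiableOn.diffContOnCl ((hf n).mono ?_)
    rw [closure_ball _ hs0.ne']
    exact hsub hs
  -- the Taylor coefficients tend to `0`
  have hcoef : ∀ k, Tendsto (fun n => iteratedDeriv k (f n) z₀) atTop (𝓝 0) := by
    intro k
    -- The circle must lie both where convergence is known and inside the disc of radius `R'`, where
    -- `f n` is holomorphic and bounded.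
    set s := min (r / 2) R' with hs
    have hs0 : 0 < s := by positivity
    have hsr : s < r := (min_le_left _ _).trans_lt (by linarith)
    have hint : Tendsto (fun n => ∮ w in C(z₀, s), (1 / (w - z₀) ^ (k + 1)) • f n w) atTop
        (𝓝 (∮ w in C(z₀, s), (0 : ℂ))) := by
      refine intervalIntegral.tendsto_integral_filter_of_dominated_convergence
        (fun _ => s * ((1 / s ^ (k + 1)) * C)) ?_ ?_ (by simp) ?_
      · refine Eventually.of_forall fun n => Continuous.aestronglyMeasurable ?_
        have h1 : Continuous fun θ => f n (circleMap z₀ s θ) := by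
          refine ((hf n).mono (hsub (min_le_right _ _))).continuousOn.comp_continuous
            (continuous_circleMap _ _) fun θ => circleMap_mem_closedBall _ hs0.le _
        have h2 : Continuous fun θ => (1 : ℂ) / (circleMap z₀ s θ - z₀) ^ (k + 1) := by
          refine continuous_const.div (((continuous_circleMap _ _).sub continuous_const).pow _) ?_
          intro θ
          exact pow_ne_zero _ (sub_ne_zero.2 (circleMap_ne_center hs0.ne'))
        simp only [deriv_circleMap]
        exact ((continuous_circleMap _ _).mul continuous_const).smul (h2.smul h1)
      · refine Eventually.of_forall fun n => Eventually.of_forall fun θ _ => ?_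
        rw [norm_smul, norm_smul]
        have h1 := hC n _ (hsub (min_le_right _ _) (circleMap_mem_closedBall z₀ hs0.le θ))
        simp only [deriv_circleMap, norm_mul, norm_circleMap_zero, abs_of_pos hs0, Complex.norm_I,
          mul_one, norm_div, norm_one, norm_pow, circleMap_sub_center]
        gcongr
      · refine Eventually.of_forall fun θ _ => ?_
        have h1 := h0 (circleMap z₀ s θ) (by
          have := circleMap_mem_closedBall z₀ hs0.le θ
          exact (Metric.closedBall_subset_ball hsr) this)
        simpa using (h1.const_smul ((1 : ℂ) / (circleMap z₀ s θ - z₀) ^ (k + 1))).const_smul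
          (deriv (circleMap z₀ s) θ)
    have heq : ∀ n, iteratedDeriv k (f n) z₀ = (2 * Real.pi * Complex.I / k.factorial)⁻¹ *
        ∮ w in C(z₀, s), (1 / (w - z₀) ^ (k + 1)) • f n w := by
      intro n
      have hne : (2 * Real.pi * Complex.I / k.factorial : ℂ) ≠ 0 := by
        simp [Nat.factorial_ne_zero, Real.pi_ne_zero]
      rw [(hcl hs0 (min_le_right _ _) n).circleIntegral_one_div_sub_center_pow_smul hs0 k,
        smul_eq_mul, inv_mul_cancel_left₀ hne]
    simp_rw [heq]
    have h0' : (∮ w in C(z₀, s), (0 : ℂ)) = 0 := by simp [circleIntegral]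
    rw [h0'] at hint
    simpa using hint.const_mul (2 * Real.pi * Complex.I / k.factorial : ℂ)⁻¹
  have hsum : ∀ n, f n z = ∑' k : ℕ, (k.factorial : ℂ)⁻¹ • (z - z₀) ^ k • iteratedDeriv k (f n) z₀ :=
    fun n => (Complex.hasSum_taylorSeries_on_ball (hf n) hz).tsum_eq.symm
  simp_rw [hsum]
  have hC0 : 0 ≤ C := (norm_nonneg _).trans (hC 0 z hz)
  have hlim : Tendsto (fun n => ∑' k : ℕ, (k.factorial : ℂ)⁻¹ • (z - z₀) ^ k •
      iteratedDeriv k (f n) z₀) atTop (𝓝 (∑' _ : ℕ, (0 : ℂ))) := by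
    -- Cauchy's estimates on the sphere of radius `R'` give a geometric majorant of the Taylor
    -- series, uniform in `n`.
    refine tendsto_tsum_of_dominated_convergence
      (bound := fun k : ℕ => C * (dist z z₀ / R') ^ k) ?_ ?_ ?_
    · exact (summable_geometric_of_lt_one (by positivity) ((div_lt_one hR'0).2 hzR')).mul_left _
    · intro k
      simpa using ((hcoef k).const_smul ((z - z₀) ^ k)).const_smul (k.factorial : ℂ)⁻¹
    · refine Eventually.of_forall fun n k => ?_
      have h1 := Complex.norm_iteratedDeriv_le_of_forall_mem_sphere_norm_le k hR'0
        (hcl hR'0 le_rfl n)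
        (fun w hw => hC n w (hsub le_rfl (Metric.sphere_subset_closedBall hw)))
      rw [norm_smul, norm_smul, norm_inv, norm_pow, ← dist_eq_norm, Complex.norm_natCast]
      calc ((k.factorial : ℝ))⁻¹ * (dist z z₀ ^ k * ‖iteratedDeriv k (f n) z₀‖)
          ≤ ((k.factorial : ℝ))⁻¹ * (dist z z₀ ^ k * (k.factorial * C / R' ^ k)) := by gcongr
        _ = C * (dist z z₀ / R') ^ k := by
          have : (k.factorial : ℝ) ≠ 0 := by positivity
          rw [div_pow]
          field_simp
  simpa using hlim

/-- A locally bounded sequence of holomorphic functions on a domain which tends to `0` near a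
point tends to `0` everywhere. -/
theorem tendsto_zero_of_isPreconnected {U : Set ℂ} (hUo : IsOpen U) (hU : IsPreconnected U)
    {f : ℕ → ℂ → ℂ} {B : ℂ → ℝ} (hf : ∀ n, DifferentiableOn ℂ (f n) U)
    (hB : ContinuousOn B U) (hfB : ∀ n, ∀ z ∈ U, ‖f n z‖ ≤ B z) {z₀ : ℂ} (hz₀ : z₀ ∈ U)
    (h0 : ∀ᶠ z in 𝓝 z₀, Tendsto (fun n => f n z) atTop (𝓝 0)) :
    ∀ z ∈ U, Tendsto (fun n => f n z) atTop (𝓝 0) := by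
  set V : Set ℂ := {w | ∀ᶠ z in 𝓝 w, Tendsto (fun n => f n z) atTop (𝓝 0)} with hV
  have hVo : IsOpen V := isOpen_setOfPred_eventually_nhds
  have key : U ⊆ V := by
    -- It remains to see that `V` is relatively closed in `U`. Around a closure point `w` the bound
    -- is uniform on a disc of radius `ρ`; a point `w₁ ∈ V` closer than `ρ / 2` has a disc of radius
    -- `ρ / 2` which still contains `w`, and convergence spreads over it.
    refine hU.subset_of_closure_inter_subset hVo ⟨z₀, hz₀, h0⟩ ?_
    rintro w ⟨hwV, hwU⟩
    have h1 : ∀ᶠ z in 𝓝 w, z ∈ U ∧ B z < B w + 1 :=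
      Filter.Eventually.and (hUo.mem_nhds hwU) (((hB.continuousAt (hUo.mem_nhds hwU)).eventually
        (gt_mem_nhds (lt_add_one _))))
    obtain ⟨ρ, hρ, hρU⟩ := Metric.eventually_nhds_iff_ball.1 h1
    obtain ⟨w₁, hw₁, hd⟩ := Metric.mem_closure_iff.1 hwV (ρ / 2) (by positivity)
    obtain ⟨r, hr, hrV⟩ := Metric.eventually_nhds_iff_ball.1 hw₁
    have hsub : Metric.ball w₁ (ρ / 2) ⊆ Metric.ball w ρ := by
      refine Metric.ball_subset_ball' ?_
      rw [dist_comm]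
      linarith
    refine Filter.eventually_of_mem (Metric.isOpen_ball.mem_nhds (Metric.mem_ball.2 hd)) ?_
    exact tendsto_zero_on_ball hr (fun n => (hf n).mono fun z hz => (hρU z (hsub hz)).1)
      (fun n z hz => (hfB n z (hρU z (hsub hz)).1).trans (hρU z (hsub hz)).2.le) hrV
  intro z hz
  exact (key hz).self_of_nhds

end

section


open scoped Matrix.Norms.L2Operator

variable {I J K : Type*} [Fintype I] [Fintype J] [Fintype K]
  [DecidableEq I] [DecidableEq J] [DecidableEq K]

/-! ### The Frobenius norm -/

/-- The Frobenius norm of a matrix. -/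
def frob {I J : Type*} [Fintype I] [Fintype J] (A : Matrix I J ℂ) : ℝ :=
  ‖(WithLp.toLp 2 (fun p : I × J => A p.1 p.2) : EuclideanSpace ℂ (I × J))‖

lemma frob_sq (A : Matrix I J ℂ) : frob A ^ 2 = ∑ i, ∑ j, ‖A i j‖ ^ 2 := by
  rw [frob, EuclideanSpace.norm_sq_eq, Fintype.sum_prod_type]

lemma frob_nonneg (A : Matrix I J ℂ) : 0 ≤ frob A := norm_nonneg _

lemma frob_add_le (A B : Matrix I J ℂ) : frob (A + B) ≤ frob A + frob B :=
  norm_add_le (WithLp.toLp 2 (fun p : I × J => A p.1 p.2) : EuclideanSpace ℂ (I × J))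
    (WithLp.toLp 2 (fun p : I × J => B p.1 p.2))

lemma frob_sub_le (A B : Matrix I J ℂ) : frob (A - B) ≤ frob A + frob B :=
  norm_sub_le (WithLp.toLp 2 (fun p : I × J => A p.1 p.2) : EuclideanSpace ℂ (I × J))
    (WithLp.toLp 2 (fun p : I × J => B p.1 p.2))

lemma frob_smul (c : ℂ) (A : Matrix I J ℂ) : frob (c • A) = ‖c‖ * frob A :=
  norm_smul c (WithLp.toLp 2 (fun p : I × J => A p.1 p.2) : EuclideanSpace ℂ (I × J))

lemma eq_zero_of_frob_eq_zero {A : Matrix I J ℂ} (h : frob A = 0) : A = 0 := by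
  have h1 := norm_eq_zero.1 h
  ext i j
  exact congrFun (congrArg WithLp.ofLp h1) (i, j)

lemma norm_entry_le_frob (A : Matrix I J ℂ) (i : I) (j : J) : ‖A i j‖ ≤ frob A :=
  PiLp.norm_apply_le (WithLp.toLp 2 (fun p : I × J => A p.1 p.2) : EuclideanSpace ℂ (I × J)) (i, j)

lemma frob_conjTranspose (A : Matrix I J ℂ) : frob Aᴴ = frob A := by
  rw [← sq_eq_sq₀ (frob_nonneg _) (frob_nonneg _), frob_sq, frob_sq, Finset.sum_comm]
  simp

/-- Cauchy–Schwarz for the Hilbert–Schmidt inner product of `Aᴴ` and `B`. -/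
lemma norm_trace_mul_le (A : Matrix I J ℂ) (B : Matrix J I ℂ) :
    ‖(A * B).trace‖ ≤ frob A * frob B := by
  have h : (A * B).trace = inner ℂ
      (WithLp.toLp 2 (fun p : I × J => Aᴴ p.2 p.1) : EuclideanSpace ℂ (I × J))
      (WithLp.toLp 2 (fun p : I × J => B p.2 p.1)) := by
    simp only [Matrix.trace, Matrix.diag, Matrix.mul_apply, PiLp.inner_apply,
      Fintype.sum_prod_type, RCLike.inner_apply, conjTranspose_apply]
    refine Finset.sum_congr rfl fun i _ => Finset.sum_congr rfl fun j _ => ?_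
    simp [mul_comm]
  rw [h]
  refine (norm_inner_le_norm _ _).trans (le_of_eq ?_)
  have h1 : ∀ C : Matrix J I ℂ, ‖(WithLp.toLp 2 (fun p : I × J => C p.2 p.1) :
      EuclideanSpace ℂ (I × J))‖ = frob C := by
    intro C
    rw [← sq_eq_sq₀ (norm_nonneg _) (frob_nonneg _), frob_sq, EuclideanSpace.norm_sq_eq,
      Fintype.sum_prod_type, Finset.sum_comm]
  rw [h1, h1, frob_conjTranspose]

lemma sum_norm_sq_mulVec_le (A : Matrix I J ℂ) (v : J → ℂ) :
    ∑ i, ‖(A *ᵥ v) i‖ ^ 2 ≤ ‖A‖ ^ 2 * ∑ j, ‖v j‖ ^ 2 := by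
  have h := A.l2_opNorm_mulVec (WithLp.toLp 2 v)
  have h2 := pow_le_pow_left₀ (norm_nonneg _) h 2
  rw [mul_pow, EuclideanSpace.norm_sq_eq, EuclideanSpace.norm_sq_eq] at h2
  exact h2

lemma norm_le_of_sum_norm_sq_mulVec_le {A : Matrix I J ℂ} {C : ℝ} (hC : 0 ≤ C)
    (h : ∀ v : J → ℂ, ∑ i, ‖(A *ᵥ v) i‖ ^ 2 ≤ C ^ 2 * ∑ j, ‖v j‖ ^ 2) : ‖A‖ ≤ C := by
  rw [Matrix.l2_opNorm_def]
  refine ContinuousLinearMap.opNorm_le_bound _ hC fun v => ?_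
  rw [← sq_le_sq₀ (norm_nonneg _) (by positivity), mul_pow, EuclideanSpace.norm_sq_eq,
    EuclideanSpace.norm_sq_eq]
  exact h v.ofLp

lemma frob_mul_le (A : Matrix I J ℂ) (B : Matrix J K ℂ) : frob (A * B) ≤ ‖A‖ * frob B := by
  rw [← sq_le_sq₀ (frob_nonneg _) (mul_nonneg (norm_nonneg _) (frob_nonneg _)), mul_pow, frob_sq,
    frob_sq, Finset.sum_comm, Finset.sum_comm (s := Finset.univ (α := J)), Finset.mul_sum]
  exact Finset.sum_le_sum fun k _ => sum_norm_sq_mulVec_le A (fun j => B j k)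

lemma frob_mul_le' (A : Matrix I J ℂ) (B : Matrix J K ℂ) : frob (A * B) ≤ frob A * ‖B‖ := by
  rw [← frob_conjTranspose, conjTranspose_mul, mul_comm]
  refine (frob_mul_le _ _).trans (le_of_eq ?_)
  rw [Matrix.l2_opNorm_conjTranspose, frob_conjTranspose]

lemma frob_one_sq : frob (1 : Matrix I I ℂ) ^ 2 = Fintype.card I := by
  rw [frob_sq]
  simp [Matrix.one_apply, apply_ite]

lemma frob_sq_le (A : Matrix I I ℂ) : frob A ^ 2 ≤ Fintype.card I * ‖A‖ ^ 2 := by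
  have h := frob_mul_le A (1 : Matrix I I ℂ)
  rw [mul_one] at h
  calc frob A ^ 2 ≤ (‖A‖ * frob (1 : Matrix I I ℂ)) ^ 2 :=
        pow_le_pow_left₀ (frob_nonneg _) h 2
    _ = _ := by rw [mul_pow, frob_one_sq, mul_comm]

lemma norm_entry_le (A : Matrix I J ℂ) (i : I) (j : J) : ‖A i j‖ ≤ ‖A‖ := by
  have h := sum_norm_sq_mulVec_le A (Pi.single j 1)
  have h1 : ∑ k, ‖(Pi.single j 1 : J → ℂ) k‖ ^ 2 = 1 := by
    rw [Finset.sum_eq_single j] <;> simp +contextual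
  rw [h1, mul_one] at h
  have h2 : ‖A i j‖ ^ 2 ≤ ∑ i, ‖(A *ᵥ Pi.single j 1) i‖ ^ 2 := by
    simp only [Matrix.mulVec_single_one, Matrix.col_apply]
    exact Finset.single_le_sum (f := fun i => ‖A i j‖ ^ 2) (fun _ _ => by positivity)
      (Finset.mem_univ i)
  exact (sq_le_sq₀ (norm_nonneg _) (norm_nonneg _)).1 (h2.trans h)

lemma norm_le_frob (A : Matrix I J ℂ) : ‖A‖ ≤ frob A := by
  refine norm_le_of_sum_norm_sq_mulVec_le (frob_nonneg _) fun v => ?_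
  rw [frob_sq, Finset.sum_mul]
  refine Finset.sum_le_sum fun i _ => ?_
  have h := norm_inner_le_norm (𝕜 := ℂ) (WithLp.toLp 2 (fun j => star (A i j)) : EuclideanSpace ℂ J)
    (WithLp.toLp 2 v)
  have h2 := pow_le_pow_left₀ (norm_nonneg _) h 2
  rw [mul_pow, EuclideanSpace.norm_sq_eq, EuclideanSpace.norm_sq_eq] at h2
  simpa [PiLp.inner_apply, Matrix.mulVec, dotProduct, mul_comm] using h2

/-! ### Resolvents -/

/-- The resolvent `(G Gᴴ - z)⁻¹`. -/
def res {I J : Type*} [Fintype I] [Fintype J] [DecidableEq I] (G : Matrix I J ℂ) (z : ℂ) :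
    Matrix I I ℂ := (G * Gᴴ - z • 1)⁻¹

lemma sub_smul_one_eq {H : Matrix I I ℂ} (hH : H.IsHermitian) (z : ℂ) :
    H - z • 1 = (hH.eigenvectorUnitary : Matrix I I ℂ) *
      diagonal (fun i => (hH.eigenvalues i : ℂ) - z) * (hH.eigenvectorUnitary : Matrix I I ℂ)ᴴ := by
  have h1 : (hH.eigenvectorUnitary : Matrix I I ℂ) * (hH.eigenvectorUnitary : Matrix I I ℂ)ᴴ = 1 :=
    Unitary.mul_star_self_of_mem hH.eigenvectorUnitary.2
  have h2 : diagonal (fun i => (hH.eigenvalues i : ℂ) - z) =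
      diagonal (fun i => (hH.eigenvalues i : ℂ)) - z • (1 : Matrix I I ℂ) := by
    ext i j
    by_cases h : i = j <;> simp [h]
  rw [h2, mul_sub, sub_mul]
  congr 1
  · exact hH.spectral_theorem
  · rw [mul_smul_comm, mul_one, smul_mul_assoc, h1]

lemma inv_sub_smul_one_eq {H : Matrix I I ℂ} (hH : H.PosSemidef) {z : ℂ} (hz : z ∈ cutPlane) :
    IsUnit (H - z • 1) ∧ (H - z • 1)⁻¹ = (hH.1.eigenvectorUnitary : Matrix I I ℂ) *
      diagonal (fun i => ((hH.1.eigenvalues i : ℂ) - z)⁻¹) *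
        (hH.1.eigenvectorUnitary : Matrix I I ℂ)ᴴ := by
  set U := (hH.1.eigenvectorUnitary : Matrix I I ℂ)
  have h1 : U * Uᴴ = 1 := Unitary.mul_star_self_of_mem hH.1.eigenvectorUnitary.2
  have h2 : Uᴴ * U = 1 := Unitary.star_mul_self_of_mem hH.1.eigenvectorUnitary.2
  have key : (H - z • 1) * (U * diagonal (fun i => ((hH.1.eigenvalues i : ℂ) - z)⁻¹) * Uᴴ) = 1 := by
    rw [sub_smul_one_eq hH.1 z]
    have h3 : diagonal (fun i => (hH.1.eigenvalues i : ℂ) - z) *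
        diagonal (fun i => ((hH.1.eigenvalues i : ℂ) - z)⁻¹) = 1 := by
      rw [diagonal_mul_diagonal, ← diagonal_one]
      congr 1
      ext i
      exact mul_inv_cancel₀ (sub_ne_zero_of_mem_cutPlane hz (hH.eigenvalues_nonneg i))
    calc U * diagonal (fun i => (hH.1.eigenvalues i : ℂ) - z) * Uᴴ *
          (U * diagonal (fun i => ((hH.1.eigenvalues i : ℂ) - z)⁻¹) * Uᴴ)
        = U * diagonal (fun i => (hH.1.eigenvalues i : ℂ) - z) * (Uᴴ * U) *
          diagonal (fun i => ((hH.1.eigenvalues i : ℂ) - z)⁻¹) * Uᴴ := by noncomm_ring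
      _ = U * (diagonal (fun i => (hH.1.eigenvalues i : ℂ) - z) *
          diagonal (fun i => ((hH.1.eigenvalues i : ℂ) - z)⁻¹)) * Uᴴ := by
        rw [h2]; noncomm_ring
      _ = 1 := by rw [h3, mul_one, h1]
  refine ⟨?_, Matrix.inv_eq_right_inv key⟩
  rw [Matrix.isUnit_iff_isUnit_det]
  exact Matrix.isUnit_det_of_right_inverse key

lemma norm_one_matrix_le : ‖(1 : Matrix I I ℂ)‖ ≤ 1 := by
  rw [← diagonal_one, Matrix.l2_opNorm_diagonal]
  exact (pi_norm_le_iff_of_nonneg zero_le_one).2 fun i => by simp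

lemma norm_eigenvectorUnitary_le {H : Matrix I I ℂ} (hH : H.IsHermitian) :
    ‖(hH.eigenvectorUnitary : Matrix I I ℂ)‖ ≤ 1 := by
  have h := Matrix.l2_opNorm_conjTranspose_mul_self (hH.eigenvectorUnitary : Matrix I I ℂ)
  rw [show (hH.eigenvectorUnitary : Matrix I I ℂ)ᴴ * (hH.eigenvectorUnitary : Matrix I I ℂ) = 1
    from Unitary.star_mul_self_of_mem hH.eigenvectorUnitary.2] at h
  nlinarith [norm_one_matrix_le (I := I), norm_nonneg (hH.eigenvectorUnitary : Matrix I I ℂ)]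

lemma norm_inv_sub_smul_one_le {H : Matrix I I ℂ} (hH : H.PosSemidef) {z : ℂ} (hz : z ∈ cutPlane) :
    ‖(H - z • 1)⁻¹‖ ≤ (rayDist z)⁻¹ := by
  rw [(inv_sub_smul_one_eq hH hz).2]
  have hU := norm_eigenvectorUnitary_le hH.1
  have hd : ‖diagonal (fun i => ((hH.1.eigenvalues i : ℂ) - z)⁻¹)‖ ≤ (rayDist z)⁻¹ := by
    rw [Matrix.l2_opNorm_diagonal]
    exact (pi_norm_le_iff_of_nonneg (inv_nonneg.2 (rayDist_pos hz).le)).2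
      fun i => norm_inv_sub_le hz (hH.eigenvalues_nonneg i)
  have h0 : 0 ≤ (rayDist z)⁻¹ := inv_nonneg.2 (rayDist_pos hz).le
  refine (Matrix.l2_opNorm_mul _ _).trans ?_
  rw [Matrix.l2_opNorm_conjTranspose]
  calc _ ≤ ‖(hH.1.eigenvectorUnitary : Matrix I I ℂ)‖ * (rayDist z)⁻¹ *
        ‖(hH.1.eigenvectorUnitary : Matrix I I ℂ)‖ := by
        gcongr
        exact (Matrix.l2_opNorm_mul _ _).trans (by gcongr)
    _ ≤ 1 * (rayDist z)⁻¹ * 1 := by gcongr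
    _ = _ := by ring

lemma isUnit_mul_conjTranspose_sub (G : Matrix I J ℂ) {z : ℂ} (hz : z ∈ cutPlane) :
    IsUnit (G * Gᴴ - z • 1) :=
  (inv_sub_smul_one_eq (Matrix.posSemidef_self_mul_conjTranspose G) hz).1

lemma norm_res_le (G : Matrix I J ℂ) {z : ℂ} (hz : z ∈ cutPlane) : ‖res G z‖ ≤ (rayDist z)⁻¹ :=
  norm_inv_sub_smul_one_le (Matrix.posSemidef_self_mul_conjTranspose G) hz

lemma res_mul_self (G : Matrix I J ℂ) {z : ℂ} (hz : z ∈ cutPlane) :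
    res G z * (G * Gᴴ) = 1 + z • res G z := by
  have h := Matrix.nonsing_inv_mul _ ((Matrix.isUnit_iff_isUnit_det _).1
    (isUnit_mul_conjTranspose_sub G hz))
  rw [mul_sub, mul_smul_comm, mul_one, sub_eq_iff_eq_add] at h
  exact h

lemma self_mul_res (G : Matrix I J ℂ) {z : ℂ} (hz : z ∈ cutPlane) :
    (G * Gᴴ) * res G z = 1 + z • res G z := by
  have h := Matrix.mul_nonsing_inv _ ((Matrix.isUnit_iff_isUnit_det _).1
    (isUnit_mul_conjTranspose_sub G hz))
  rw [sub_mul, smul_mul_assoc, one_mul, sub_eq_iff_eq_add] at h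
  exact h

/-- Both sides agree after multiplication by `Gᴴ G - z`. This is how the companion resolvent `res Gᴴ
z` enters the integration by parts. -/
lemma conjTranspose_mul_res_mul (G : Matrix I J ℂ) {z : ℂ} (hz : z ∈ cutPlane) :
    Gᴴ * res G z * G = 1 + z • res Gᴴ z := by
  have hu := isUnit_mul_conjTranspose_sub Gᴴ hz
  have h1 := self_mul_res Gᴴ hz
  rw [conjTranspose_conjTranspose] at h1 hu
  have h2 := res_mul_self G hz
  refine (hu.mul_right_inj).1 ?_
  calc (Gᴴ * G - z • 1) * (Gᴴ * res G z * G)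
      = Gᴴ * ((G * Gᴴ) * res G z - z • res G z) * G := by
        simp only [Matrix.sub_mul, Matrix.mul_sub, Matrix.smul_mul, Matrix.mul_smul, one_mul,
          Matrix.mul_assoc]
    _ = Gᴴ * G := by
        rw [self_mul_res G hz, add_sub_cancel_right, Matrix.mul_one]
    _ = (Gᴴ * G - z • 1) * (1 + z • res Gᴴ z) := by
        rw [mul_add, mul_one, mul_smul_comm, sub_mul, smul_mul_assoc, one_mul, h1]
        module

lemma norm_one_add_smul_res_le (G : Matrix I J ℂ) {z : ℂ} (hz : z ∈ cutPlane) :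
    ‖(1 : Matrix I I ℂ) + z • res G z‖ ≤ 1 + ‖z‖ * (rayDist z)⁻¹ := by
  refine (norm_add_le _ _).trans (add_le_add norm_one_matrix_le ?_)
  · rw [norm_smul]
    gcongr
    exact norm_res_le G hz

/-- Although `G` is unbounded, `(Q G)(Q G)ᴴ = Q (G Gᴴ) Qᴴ = (1 + z Q) Qᴴ` is bounded in terms of `z`
alone. -/
lemma norm_res_mul_sq_le (G : Matrix I J ℂ) {z : ℂ} (hz : z ∈ cutPlane) :
    ‖res G z * G‖ ^ 2 ≤ (1 + ‖z‖ * (rayDist z)⁻¹) * (rayDist z)⁻¹ := by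
  have h0 : 0 ≤ (rayDist z)⁻¹ := inv_nonneg.2 (rayDist_pos hz).le
  have h := Matrix.l2_opNorm_conjTranspose_mul_self (res G z * G)ᴴ
  rw [Matrix.l2_opNorm_conjTranspose, conjTranspose_conjTranspose, conjTranspose_mul,
    Matrix.mul_assoc, ← Matrix.mul_assoc G, ← Matrix.mul_assoc, res_mul_self G hz] at h
  rw [sq, ← h]
  refine (Matrix.l2_opNorm_mul _ _).trans ?_
  rw [Matrix.l2_opNorm_conjTranspose]
  exact mul_le_mul (norm_one_add_smul_res_le G hz) (norm_res_le G hz) (norm_nonneg _)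
    (by positivity)

lemma norm_conjTranspose_mul_res_sq_le (G : Matrix I J ℂ) {z : ℂ} (hz : z ∈ cutPlane) :
    ‖Gᴴ * res G z‖ ^ 2 ≤ (1 + ‖z‖ * (rayDist z)⁻¹) * (rayDist z)⁻¹ := by
  have h0 : 0 ≤ (rayDist z)⁻¹ := inv_nonneg.2 (rayDist_pos hz).le
  have h := Matrix.l2_opNorm_conjTranspose_mul_self (Gᴴ * res G z)
  rw [conjTranspose_mul, conjTranspose_conjTranspose, Matrix.mul_assoc, ← Matrix.mul_assoc G,
    self_mul_res G hz] at h
  rw [sq, ← h, mul_comm]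
  refine (Matrix.l2_opNorm_mul _ _).trans ?_
  rw [Matrix.l2_opNorm_conjTranspose]
  exact mul_le_mul (norm_res_le G hz) (norm_one_add_smul_res_le G hz) (norm_nonneg _) h0

end

section


/-! ### Complex measures -/

/-- The total variations of the real and imaginary parts dominate. Finiteness is what allows bounded
convergence for integrals against a complex measure. -/
lemma isFiniteMeasure_variation (μ : ComplexMeasure ℝ) : IsFiniteMeasure μ.variation := by
  refine isFiniteMeasure_of_le
    ((ComplexMeasure.re μ).totalVariation + (ComplexMeasure.im μ).totalVariation) ?_
  refine VectorMeasure.variation_le_of_forall_enorm_le fun s _ => ?_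
  have h1 := SignedMeasure.norm_le_totalVariation (ComplexMeasure.re μ) s
  have h2 := SignedMeasure.norm_le_totalVariation (ComplexMeasure.im μ) s
  rw [Measure.add_apply, ← ofReal_norm, ← ofReal_measureReal, ← ofReal_measureReal,
    ← ENNReal.ofReal_add (by positivity) (by positivity)]
  refine ENNReal.ofReal_le_ofReal ((Complex.norm_le_abs_re_add_abs_im _).trans ?_)
  exact add_le_add h1 h2

/-- The integral against a complex measure which is a combination of finite measures. -/
lemma complexMeasure_integral_eq_sum {α : Type*} [Fintype α] (μ : ComplexMeasure ℝ) (c : α → ℂ)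
    (ρ : α → Measure ℝ) [∀ a, IsFiniteMeasure (ρ a)]
    (h : ∀ s, MeasurableSet s → μ s = ∑ a, c a * ((ρ a).real s : ℂ))
    {f : ℝ → ℂ} (hf : StronglyMeasurable f) {C : ℝ} (hC : ∀ x, ‖f x‖ ≤ C) :
    μ.integral f (ContinuousLinearMap.mul ℝ ℂ) = ∑ a, c a * ∫ x, f x ∂(ρ a) := by
  have := isFiniteMeasure_variation μ
  have hC0 : 0 ≤ C := (norm_nonneg _).trans (hC 0)
  -- On simple functions both sides are finite sums of values of the measures; bounded simple
  -- approximations of `f` then pass to the limit on both sides.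
  have hsimple : ∀ g : SimpleFunc ℝ ℂ, μ.integral g (ContinuousLinearMap.mul ℝ ℂ) =
      ∑ a, c a * ∫ x, g x ∂(ρ a) := by
    intro g
    have hg : ∀ ν : Measure ℝ, [IsFiniteMeasure ν] → Integrable g ν := fun ν _ =>
      SimpleFunc.integrable_of_isFiniteMeasure g
    rw [VectorMeasure.integral_eq_setToFun, setToFun_simpleFunc _ g (hg _)]
    simp_rw [SimpleFunc.integral_eq_sum g (hg _), Finset.mul_sum]
    rw [Finset.sum_comm]
    refine Finset.sum_congr rfl fun x _ => ?_
    change x * μ (g ⁻¹' {x}) = _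
    rw [h _ (g.measurableSet_fiber x), Finset.mul_sum]
    refine Finset.sum_congr rfl fun a _ => ?_
    rw [Complex.real_smul]
    ring
  have h1 : Tendsto (fun n => μ.integral (hf.approxBounded C n) (ContinuousLinearMap.mul ℝ ℂ)) atTop
      (𝓝 (μ.integral f (ContinuousLinearMap.mul ℝ ℂ))) := by
    refine VectorMeasure.tendsto_integral_filter_of_norm_le_const ?_ ⟨C, ?_⟩ ?_
    · exact Eventually.of_forall fun n => (SimpleFunc.stronglyMeasurable _).aestronglyMeasurable
    · exact Eventually.of_forall fun n => Eventually.of_forall fun x =>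
        hf.norm_approxBounded_le hC0 n x
    · exact Eventually.of_forall fun x => hf.tendsto_approxBounded_of_norm_le (hC x)
  have h2 : Tendsto (fun n => ∑ a, c a * ∫ x, hf.approxBounded C n x ∂(ρ a)) atTop
      (𝓝 (∑ a, c a * ∫ x, f x ∂(ρ a))) := by
    refine tendsto_finsetSum _ fun a _ => Tendsto.const_mul _ ?_
    refine tendsto_integral_of_dominated_convergence (fun _ => C) ?_ (integrable_const _) ?_ ?_
    · exact fun n => (SimpleFunc.stronglyMeasurable _).aestronglyMeasurable
    · exact fun n => Eventually.of_forall fun x => hf.norm_approxBounded_le hC0 n x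
    · exact Eventually.of_forall fun x => hf.tendsto_approxBounded_of_norm_le (hC x)
  simp_rw [hsimple] at h1
  exact tendsto_nhds_unique h1 h2

/-- Every complex measure is a combination of four finite measures. -/
lemma exists_complexMeasure_eq_sum (μ : ComplexMeasure ℝ) :
    ∃ ρ : Fin 4 → Measure ℝ, (∀ a, IsFiniteMeasure (ρ a)) ∧ ∃ c : Fin 4 → ℂ,
      ∀ s, MeasurableSet s → μ s = ∑ a, c a * ((ρ a).real s : ℂ) := by
  set r := (ComplexMeasure.re μ).toJordanDecomposition with hr
  set i := (ComplexMeasure.im μ).toJordanDecomposition with hi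
  refine ⟨![r.posPart, r.negPart, i.posPart, i.negPart], fun a => ?_,
    ![1, -1, Complex.I, -Complex.I], fun s hs => ?_⟩
  · fin_cases a
    exacts [r.posPart_finite, r.negPart_finite, i.posPart_finite, i.negPart_finite]
  have h1 := (ComplexMeasure.re μ).apply_eq_posPart_real_sub_negPart_real hs
  have h2 := (ComplexMeasure.im μ).apply_eq_posPart_real_sub_negPart_real hs
  have h3 : (μ s).re = ComplexMeasure.re μ s := rfl
  have h4 : (μ s).im = ComplexMeasure.im μ s := rfl
  rw [← Complex.re_add_im (μ s), h3, h4, h1, h2, ← hr, ← hi]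
  simp only [Fin.sum_univ_four, Matrix.cons_val]
  push_cast
  ring

/-- The Cauchy kernel `(λ - z)⁻¹`, frozen for `λ ≤ 0`. -/
def cauchyKernel (z : ℂ) (x : ℝ) : ℂ := (((max x 0 : ℝ) : ℂ) - z)⁻¹

lemma continuous_cauchyKernel {z : ℂ} (hz : z ∈ cutPlane) : Continuous (cauchyKernel z) := by
  refine Continuous.inv₀ (by fun_prop) fun x => ?_
  exact sub_ne_zero_of_mem_cutPlane hz (le_max_right _ _)

lemma norm_cauchyKernel_le {z : ℂ} (hz : z ∈ cutPlane) (x : ℝ) :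
    ‖cauchyKernel z x‖ ≤ (rayDist z)⁻¹ := norm_inv_sub_le hz (le_max_right _ _)

lemma differentiableOn_inv_sub {x : ℝ} (hx : 0 ≤ x) :
    DifferentiableOn ℂ (fun z : ℂ => ((x : ℂ) - z)⁻¹) cutPlane := fun _ hz =>
  ((differentiableAt_const _).sub differentiableAt_id).inv
    (sub_ne_zero_of_mem_cutPlane hz hx) |>.differentiableWithinAt

/-- Holomorphy of integrals depending on a parameter. -/
lemma differentiableOn_integral {Ω : Type*} [MeasurableSpace Ω] {P : Measure Ω} [IsFiniteMeasure P]
    {U : Set ℂ} (hU : IsOpen U) {F : ℂ → Ω → ℂ} {B : ℂ → ℝ}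
    (hF : ∀ z ∈ U, AEStronglyMeasurable (F z) P)
    (hd : ∀ ω, DifferentiableOn ℂ (fun z => F z ω) U) (hB : ContinuousOn B U)
    (hFB : ∀ z ∈ U, ∀ ω, ‖F z ω‖ ≤ B z) :
    DifferentiableOn ℂ (fun z => ∫ ω, F z ω ∂P) U := by
  intro z hz
  have h1 : ∀ᶠ w in 𝓝 z, w ∈ U ∧ B w < B z + 1 :=
    Filter.Eventually.and (hU.mem_nhds hz) (((hB.continuousAt (hU.mem_nhds hz)).eventually
      (gt_mem_nhds (lt_add_one _))))
  obtain ⟨r, hr, hrU⟩ := Metric.eventually_nhds_iff_ball.1 h1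
  have hsub : ∀ w ∈ Metric.ball z (r / 2), Metric.closedBall w (r / 4) ⊆ Metric.ball z r := by
    intro w hw
    refine (Metric.closedBall_subset_ball (by linarith : r / 4 < r / 2)).trans
      (Metric.ball_subset_ball' ?_)
    linarith [Metric.mem_ball.1 hw]
  have hdw : ∀ w ∈ Metric.ball z r, ∀ ω, HasDerivAt (fun z => F z ω)
      (deriv (fun z => F z ω) w) w := fun w hw ω =>
    ((hd ω).differentiableAt (hU.mem_nhds (hrU w hw).1)).hasDerivAt
  refine ((hasDerivAt_integral_of_dominated_loc_of_deriv_le (F := F)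
    (F' := fun w ω => deriv (fun z => F z ω) w) (bound := fun _ => (B z + 1) / (r / 4))
    (Metric.ball_mem_nhds z (by positivity : 0 < r / 2)) ?_ ?_ ?_ ?_ (integrable_const _)
    ?_).2.differentiableAt).differentiableWithinAt
  · exact h1.mono fun w hw => hF w hw.1
  · exact Integrable.of_bound (hF z hz) (B z) (Eventually.of_forall (hFB z hz))
  -- The derivative is measurable in `ω` as a limit of difference quotients; the steps `(r / 2) / (n
  -- + 1)` stay inside the disc.
  · have hlim : ∀ ω, Tendsto (fun n : ℕ => (((r / 2) / (n + 1) : ℝ) : ℂ)⁻¹ •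
        (F (z + ((r / 2) / (n + 1) : ℝ)) ω - F z ω)) atTop (𝓝 (deriv (fun z => F z ω) z)) := by
      intro ω
      have h2 := hasDerivAt_iff_tendsto_slope_zero.1 (hdw z (Metric.mem_ball_self hr) ω)
      refine h2.comp ?_
      refine tendsto_nhdsWithin_iff.2 ⟨?_, Eventually.of_forall fun n => ?_⟩
      · have h3 : Tendsto (fun n : ℕ => (r / 2) * (1 / ((n : ℝ) + 1))) atTop (𝓝 ((r / 2) * 0)) :=
          tendsto_one_div_add_atTop_nhds_zero_nat.const_mul _
        rw [mul_zero] at h3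
        have h4 := (Complex.continuous_ofReal.tendsto 0).comp h3
        simpa [Function.comp_def, div_eq_mul_inv] using h4
      · have h5 : (r / 2) / ((n : ℝ) + 1) ≠ 0 := by positivity
        exact Complex.ofReal_ne_zero.2 h5
    refine aestronglyMeasurable_of_tendsto_ae atTop (fun n => ?_) (Eventually.of_forall hlim)
    refine AEStronglyMeasurable.const_smul (f := F (z + ((r / 2) / (n + 1) : ℝ)) - F z)
      ((hF _ (hrU _ ?_).1).sub (hF z hz)) (((r / 2) / (n + 1) : ℝ) : ℂ)⁻¹
    rw [Metric.mem_ball, dist_eq_norm, add_sub_cancel_left, Complex.norm_real, Real.norm_eq_abs,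
      abs_of_pos (by positivity)]
    have h5 : (r / 2) / ((n : ℝ) + 1) ≤ (r / 2) / 1 := by
      gcongr
      linarith [Nat.cast_nonneg (α := ℝ) n]
    linarith
  -- Cauchy's estimate on the circle of radius `r / 4` about `w`, where `‖F‖ ≤ B z + 1`, dominates
  -- the derivative.
  · refine Eventually.of_forall fun ω w hw => ?_
    refine Complex.norm_deriv_le_of_forall_mem_sphere_norm_le (by positivity) ?_ ?_
    · refine DifferentiableOn.diffContOnCl ((hd ω).mono ?_)
      rw [closure_ball _ (by positivity)]
      exact fun y hy => (hrU y (hsub w hw hy)).1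
    · intro y hy
      have h6 := hrU y (hsub w hw (Metric.sphere_subset_closedBall hy))
      exact (hFB y h6.1 ω).trans h6.2.le
  · exact Eventually.of_forall fun ω w hw => hdw w (Metric.ball_subset_ball (by linarith) hw) ω

lemma continuousOn_inv_rayDist : ContinuousOn (fun z => (rayDist z)⁻¹) cutPlane :=
  continuous_rayDist.continuousOn.inv₀ fun _ hz => (rayDist_pos hz).ne'

lemma differentiableOn_integral_cauchyKernel (ρ : Measure ℝ) [IsFiniteMeasure ρ] :
    DifferentiableOn ℂ (fun z => ∫ x, cauchyKernel z x ∂ρ) cutPlane :=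
  differentiableOn_integral isOpen_cutPlane
    (fun _ hz => (continuous_cauchyKernel hz).aestronglyMeasurable)
    (fun _ => differentiableOn_inv_sub (le_max_right _ _)) continuousOn_inv_rayDist
    (fun _ hz x => norm_cauchyKernel_le hz x)

/-! ### Holomorphy and growth of matrix Stieltjes transforms. -/

section Stieltjes

variable {ι : Type*} [Fintype ι] [DecidableEq ι] {S : ℂ → Matrix ι ι ℂ}

/-- The variation does not charge the negative half line, so freezing the kernel there changes
nothing; the frozen kernel is bounded and continuous on all of `ℝ`. -/
lemma IsNormalizedPosMatrixMeasure.integral_inv_sub_eq {μ : ι → ι → ComplexMeasure ℝ}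
    (hμ : IsNormalizedPosMatrixMeasure μ) (z : ℂ) (i j : ι) :
    (μ i j).integral (fun x : ℝ => ((x : ℂ) - z)⁻¹) (ContinuousLinearMap.mul ℝ ℂ) =
      (μ i j).integral (cauchyKernel z) (ContinuousLinearMap.mul ℝ ℂ) := by
  refine VectorMeasure.integral_congr_ae ?_
  have h0 : (μ i j).variation (Set.Iio 0) = 0 :=
    ((μ i j).variation_apply_eq_zero measurableSet_Iio).2 fun t ht htm => hμ.carried t htm ht i j
  have h1 : ∀ᵐ x ∂(μ i j).variation, x ∉ Set.Iio (0 : ℝ) := measure_eq_zero_iff_ae_notMem.1 h0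
  filter_upwards [h1] with x hx
  rw [cauchyKernel, max_eq_left (not_lt.1 hx)]

lemma IsStieltjes.exists_entry_eq (hS : IsStieltjes S) (i j : ι) :
    ∃ ρ : Fin 4 → Measure ℝ, (∀ a, IsFiniteMeasure (ρ a)) ∧ ∃ c : Fin 4 → ℂ, ∀ z ∈ cutPlane,
      S z i j = ∑ a, c a * ∫ x, cauchyKernel z x ∂(ρ a) := by
  obtain ⟨μ, hμ, hSμ⟩ := hS
  obtain ⟨ρ, hρ, c, h⟩ := exists_complexMeasure_eq_sum (μ i j)
  refine ⟨ρ, hρ, c, fun z hz => ?_⟩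
  rw [hSμ z hz, hμ.integral_inv_sub_eq]
  exact complexMeasure_integral_eq_sum _ c ρ h
    (continuous_cauchyKernel hz).stronglyMeasurable (norm_cauchyKernel_le hz)

lemma IsStieltjes.differentiableOn (hS : IsStieltjes S) (i j : ι) :
    DifferentiableOn ℂ (fun z => S z i j) cutPlane := by
  obtain ⟨ρ, hρ, c, h⟩ := hS.exists_entry_eq i j
  refine DifferentiableOn.congr (DifferentiableOn.fun_sum fun a _ =>
    (differentiableOn_integral_cauchyKernel (ρ a)).const_mul (c a)) h

lemma IsStieltjes.exists_norm_entry_le (hS : IsStieltjes S) :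
    ∃ C : ℝ, 0 ≤ C ∧ ∀ z ∈ cutPlane, ∀ i j, ‖S z i j‖ ≤ C * (rayDist z)⁻¹ := by
  choose ρ hρ c h using hS.exists_entry_eq
  refine ⟨∑ i, ∑ j, ∑ a, ‖c i j a‖ * (ρ i j a).real Set.univ, by positivity,
    fun z hz i j => ?_⟩
  have h1 : ‖S z i j‖ ≤ (∑ a, ‖c i j a‖ * (ρ i j a).real Set.univ) * (rayDist z)⁻¹ := by
    rw [h i j z hz, Finset.sum_mul]
    refine (norm_sum_le _ _).trans (Finset.sum_le_sum fun a _ => ?_)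
    rw [norm_mul, mul_assoc]
    gcongr
    rw [mul_comm]
    exact norm_integral_le_of_norm_le_const (Eventually.of_forall (norm_cauchyKernel_le hz))
  refine h1.trans (mul_le_mul_of_nonneg_right ?_ (inv_nonneg.2 (rayDist_pos hz).le))
  refine le_trans ?_ (Finset.single_le_sum (f := fun i => ∑ j, ∑ a, ‖c i j a‖ *
    (ρ i j a).real Set.univ) (fun _ _ => by positivity) (Finset.mem_univ i))
  exact Finset.single_le_sum (f := fun j => ∑ a, ‖c i j a‖ *
    (ρ i j a).real Set.univ) (fun _ _ => by positivity) (Finset.mem_univ j)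

end Stieltjes

end

/-! ### Polarization and compactness of the class of matrix Stieltjes transforms. -/

section


open scoped BoundedContinuousFunction

/-- Splitting the coefficients into positive and negative parts turns the relation into an equality
of two finite measures, which bounded continuous functions detect. -/
lemma sum_measure_eq_zero {α : Type*} [Fintype α] (c : α → ℝ) (ρ : α → Measure ℝ)
    [∀ a, IsFiniteMeasure (ρ a)] (h : ∀ f : ℝ →ᵇ ℝ, ∑ a, c a * ∫ x, f x ∂(ρ a) = 0) (s : Set ℝ) :
    ∑ a, c a * (ρ a).real s = 0 := by
  set m : (α → ℝ) → Measure ℝ := fun c => ∑ a, ENNReal.ofReal (c a) • ρ a with hm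
  have hfin : ∀ c, IsFiniteMeasure (m c) := by
    intro c
    have : ∀ a, IsFiniteMeasure (ENNReal.ofReal (c a) • ρ a) := fun a =>
      Measure.smul_finite _ ENNReal.ofReal_ne_top
    simp only [hm]
    infer_instance
  have hint : ∀ (c : α → ℝ), (∀ a, 0 ≤ c a) → ∀ f : ℝ →ᵇ ℝ,
      ∫ x, f x ∂(m c) = ∑ a, c a * ∫ x, f x ∂(ρ a) := by
    intro c hc f
    simp only [hm]
    rw [integral_finsetSum_measure]
    · refine Finset.sum_congr rfl fun a _ => ?_
      rw [integral_smul_measure, ENNReal.toReal_ofReal (hc a), smul_eq_mul]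
    · intro a _
      exact (f.integrable _).smul_measure ENNReal.ofReal_ne_top
  have hreal : ∀ (c : α → ℝ), (∀ a, 0 ≤ c a) → (m c).real s = ∑ a, c a * (ρ a).real s := by
    intro c hc
    have : ∀ a, IsFiniteMeasure (ENNReal.ofReal (c a) • ρ a) := fun a =>
      Measure.smul_finite _ ENNReal.ofReal_ne_top
    simp only [hm, measureReal_def, Measure.finsetSum_apply, Measure.smul_apply, smul_eq_mul]
    rw [ENNReal.toReal_sum (fun a _ => ENNReal.mul_ne_top ENNReal.ofReal_ne_top (measure_ne_top _ _))]
    refine Finset.sum_congr rfl fun a _ => ?_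
    rw [ENNReal.toReal_mul, ENNReal.toReal_ofReal (hc a)]
  have hdec : ∀ t : ℝ, t = max t 0 - max (-t) 0 := fun t => by
    rcases le_total t 0 with h | h
    · rw [max_eq_right h, max_eq_left (by linarith)]; ring
    · rw [max_eq_left h, max_eq_right (by linarith)]; ring
  have key : ∀ g : α → ℝ, ∑ a, c a * g a = ∑ a, max (c a) 0 * g a - ∑ a, max (-c a) 0 * g a := by
    intro g
    rw [← Finset.sum_sub_distrib]
    refine Finset.sum_congr rfl fun a _ => ?_
    rw [← sub_mul, ← hdec]
  have heq : m (fun a => max (c a) 0) = m (fun a => max (-c a) 0) := by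
    have := hfin (fun a => max (c a) 0)
    have := hfin (fun a => max (-c a) 0)
    refine ext_of_forall_integral_eq_of_IsFiniteMeasure fun f => ?_
    rw [hint _ (fun a => le_max_right _ _), hint _ (fun a => le_max_right _ _)]
    have := h f
    rw [key] at this
    linarith
  rw [key, ← hreal _ (fun a => le_max_right _ _), ← hreal _ (fun a => le_max_right _ _), heq,
    sub_self]

/-- A linear relation between finite measures may be tested on bounded continuous functions. -/
lemma sum_measure_eq_zero_complex {α : Type*} [Fintype α] (c : α → ℂ) (ρ : α → Measure ℝ)
    [∀ a, IsFiniteMeasure (ρ a)] (h : ∀ f : ℝ →ᵇ ℝ, ∑ a, c a * ((∫ x, f x ∂(ρ a) : ℝ) : ℂ) = 0)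
    (s : Set ℝ) : ∑ a, c a * ((ρ a).real s : ℂ) = 0 := by
  apply Complex.ext
  · have := sum_measure_eq_zero (fun a => (c a).re) ρ (fun f => by
      simpa using congrArg Complex.re (h f)) s
    simpa using this
  · have := sum_measure_eq_zero (fun a => (c a).im) ρ (fun f => by
      simpa using congrArg Complex.im (h f)) s
    simpa using this

variable {ι : Type*} [Fintype ι] [DecidableEq ι]

/-- The quadratic form `x ↦ xᴴ F x`. -/
def quad {ι : Type*} [Fintype ι] (F : Matrix ι ι ℂ) (x : ι → ℂ) : ℂ := star x ⬝ᵥ (F *ᵥ x)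

lemma quad_eq_sum (F : Matrix ι ι ℂ) (x : ι → ℂ) :
    quad F x = ∑ i, ∑ j, star (x i) * x j * F i j := by
  simp only [quad, dotProduct, Matrix.mulVec, Finset.mul_sum, Pi.star_apply]
  exact Finset.sum_congr rfl fun i _ => Finset.sum_congr rfl fun j _ => by ring

/-- The vectors `e_i + I ^ k e_j` of the polarization identity. -/
def polarVec {ι : Type*} [DecidableEq ι] (i j : ι) (k : Fin 4) : ι → ℂ :=
  Pi.single i 1 + (Complex.I ^ (k : ℕ)) • Pi.single j 1

/-- The polarization of a function on vectors. -/
def polarization {ι : Type*} [DecidableEq ι] (q : (ι → ℂ) → ℂ) : Matrix ι ι ℂ :=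
  Matrix.of fun i j => ∑ k : Fin 4, (1 / 4) * star (Complex.I ^ (k : ℕ)) * q (polarVec i j k)

/-- The polarization identity: it rebuilds a matrix from scalar data indexed by vectors, so that
limits need only be taken for positive scalar measures. -/
lemma polarization_quad (F : Matrix ι ι ℂ) : polarization (quad F) = F := by
  ext i j
  have h : ∀ k : Fin 4, quad F (polarVec i j k) = F i i + F j j * (star (Complex.I ^ (k : ℕ)) *
      (Complex.I ^ (k : ℕ))) + (Complex.I ^ (k : ℕ)) * F i j + star (Complex.I ^ (k : ℕ)) * F j i := by
    intro k
    simp only [quad, polarVec, Matrix.mulVec_add, Matrix.mulVec_smul, star_add, star_smul,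
      add_dotProduct, dotProduct_add, smul_dotProduct, dotProduct_smul, Matrix.mulVec_single_one,
      ← Pi.single_star, star_one, single_one_dotProduct, Matrix.col_apply, smul_eq_mul]
    ring
  simp only [polarization, Matrix.of_apply, h, Fin.sum_univ_four]
  simp [pow_succ]
  ring_nf
  simp
  ring

lemma quad_polarization_eq_sum (q : (ι → ℂ) → ℂ) (x : ι → ℂ) :
    quad (polarization q) x = ∑ p : ι × ι × Fin 4, star (x p.1) * x p.2.1 *
      ((1 / 4) * star (Complex.I ^ (p.2.2 : ℕ))) * q (polarVec p.1 p.2.1 p.2.2) := by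
  simp only [quad_eq_sum, polarization, Matrix.of_apply, Finset.mul_sum, Fintype.sum_prod_type,
    mul_assoc]

lemma tendsto_polarization {κ : Type*} {l : Filter κ} {q : κ → (ι → ℂ) → ℂ} {q' : (ι → ℂ) → ℂ}
    (h : ∀ x, Tendsto (fun k => q k x) l (𝓝 (q' x))) (i j : ι) :
    Tendsto (fun k => polarization (q k) i j) l (𝓝 (polarization q' i j)) := by
  simp only [polarization, Matrix.of_apply]
  exact tendsto_finsetSum _ fun k _ => (h _).const_mul _

/-- A limit of quadratic forms is a quadratic form. -/
lemma eq_quad_polarization_of_tendsto {κ : Type*} {l : Filter κ} [l.NeBot]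
    {F : κ → Matrix ι ι ℂ} {q' : (ι → ℂ) → ℂ}
    (h : ∀ x, Tendsto (fun k => quad (F k) x) l (𝓝 (q' x))) (x : ι → ℂ) :
    q' x = quad (polarization q') x := by
  refine tendsto_nhds_unique (h x) ?_
  simp only [quad_eq_sum]
  refine tendsto_finsetSum _ fun i _ => tendsto_finsetSum _ fun j _ => Tendsto.const_mul _ ?_
  have := tendsto_polarization h i j
  simpa only [polarization_quad] using this

lemma posSemidef_of_quad {F : Matrix ι ι ℂ} (h : ∀ x, 0 ≤ quad F x) : F.PosSemidef := by
  rw [← Matrix.isPositive_toEuclideanLin_iff, LinearMap.isPositive_iff_complex]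
  intro x
  have h1 : inner ℂ (F.toEuclideanLin x) x = star (quad F x.ofLp) := by
    rw [EuclideanSpace.inner_eq_star_dotProduct, quad, ← Matrix.star_dotProduct, dotProduct_comm]
    rfl
  have h2 := h x.ofLp
  have h3 := Complex.le_def.1 h2
  rw [h1]
  constructor
  · apply Complex.ext
    · simp
    · simpa using h3.2.symm
  · simpa using h3.1

/-- `S` is the Stieltjes transform of a matrix measure, given through its quadratic forms, with
tails controlled by the first moment `b`. -/
def HasSpectralForm (S : ℂ → Matrix ι ι ℂ) (b : NNReal) : Prop :=
  ∃ ρ : (ι → ℂ) → FiniteMeasure ℝ,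
    (∀ f : ℝ → ℂ, Continuous f → ∃ F : Matrix ι ι ℂ, ∀ x, ∫ t, f t ∂(ρ x : Measure ℝ) = quad F x) ∧
    (∀ x, (ρ x).mass = ∑ i, ‖x i‖₊ ^ 2) ∧
    (∀ x (n : ℕ), ρ x (Set.Icc 0 ((n : ℝ) + 1))ᶜ ≤ b * (∑ i, ‖x i‖₊ ^ 2) * (1 / ((n : NNReal) + 1))) ∧
    ∀ z ∈ cutPlane, ∀ x, ∫ t, cauchyKernel z t ∂(ρ x : Measure ℝ) = quad (S z) x

/-- Compactness of the class of Stieltjes transforms. -/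
theorem exists_isStieltjes_of_hasSpectralForm {κ : Type*} (𝒰 : Ultrafilter κ)
    {S : κ → ℂ → Matrix ι ι ℂ} {b : NNReal} (hS : ∀ k, HasSpectralForm (S k) b) :
    ∃ T : ℂ → Matrix ι ι ℂ, IsStieltjes T ∧
      ∀ z ∈ cutPlane, ∀ i j, Tendsto (fun k => S k z i j) 𝒰 (𝓝 (T z i j)) := by
  choose ρ hquad hmass htail hcauchy using hS
  have htend : ∀ a : NNReal, Tendsto (fun n : ℕ => a * (1 / ((n : NNReal) + 1))) atTop (𝓝 0) := by
    intro a
    have h := (tendsto_one_div_add_atTop_nhds_zero_nat (𝕜 := NNReal)).const_mul a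
    rwa [mul_zero] at h
  -- the limits of the scalar measures
  have hlim : ∀ x, ∃ ν : FiniteMeasure ℝ, (ν.mass = ∑ i, ‖x i‖₊ ^ 2 ∧
      ∀ n : ℕ, ν (Set.Icc 0 ((n : ℝ) + 1))ᶜ ≤ b * (∑ i, ‖x i‖₊ ^ 2) * (1 / ((n : NNReal) + 1))) ∧
      Tendsto (fun k => ρ k x) 𝒰 (𝓝 ν) := by
    intro x
    have hK := isCompact_setOfPred_finiteMeasure_mass_eq_compl_isCompact_le (E := ℝ)
      (u := fun n : ℕ => b * (∑ i, ‖x i‖₊ ^ 2) * (1 / ((n : NNReal) + 1)))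
      (K := fun n : ℕ => Set.Icc 0 ((n : ℝ) + 1)) (∑ i, ‖x i‖₊ ^ 2)
      (htend _)
      (fun n => isCompact_Icc) (Or.inl inferInstance)
    obtain ⟨ν, hν, hle⟩ := hK.ultrafilter_le_nhds (𝒰.map fun k => ρ k x) (by
      rw [Ultrafilter.coe_map, Filter.le_principal_iff, Filter.mem_map]
      exact Filter.univ_mem' fun k => ⟨hmass k x, htail k x⟩)
    exact ⟨ν, hν, hle⟩
  choose ν hν hνlim using hlim
  have hint : ∀ (f : ℝ →ᵇ ℂ) x, Tendsto (fun k => ∫ t, f t ∂(ρ k x : Measure ℝ)) 𝒰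
      (𝓝 (∫ t, f t ∂(ν x : Measure ℝ))) := fun f x =>
    (FiniteMeasure.tendsto_iff_forall_integral_rclike_tendsto ℂ).1 (hνlim x) f
  have hνquad : ∀ (f : ℝ →ᵇ ℂ) x, ∫ t, f t ∂(ν x : Measure ℝ) =
      quad (polarization fun y => ∫ t, f t ∂(ν y : Measure ℝ)) x := by
    intro f x
    choose F hF using fun k => hquad k f f.continuous
    refine eq_quad_polarization_of_tendsto (l := (𝒰 : Filter κ)) (F := F)
      (q' := fun y => ∫ t, f t ∂(ν y : Measure ℝ)) (fun y => ?_) x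
    simpa only [hF] using hint f y
  -- Being a quadratic form in `x` is a finite linear relation between the measures `ν x` and `ν
  -- (polarVec i j k)`, so it passes from bounded continuous functions to sets. In the index type
  -- `none` stands for `ν x`, with coefficient `-1`.
  have hset : ∀ (s : Set ℝ) x, ((ν x : Measure ℝ).real s : ℂ) =
      quad (polarization fun y => ((ν y : Measure ℝ).real s : ℂ)) x := by
    intro s x
    have h := sum_measure_eq_zero_complex (α := Option (ι × ι × Fin 4))
      (fun a => a.elim (-1) fun p => star (x p.1) * x p.2.1 * ((1 / 4) *
        star (Complex.I ^ (p.2.2 : ℕ))))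
      (fun a => (ν (a.elim x fun p => polarVec p.1 p.2.1 p.2.2) : Measure ℝ)) (fun f => ?_) s
    · rw [Fintype.sum_option] at h
      simp only [Option.elim] at h
      rw [quad_polarization_eq_sum, eq_comm, ← sub_eq_zero, ← h]
      ring
    · have h := hνquad (BoundedContinuousFunction.ofNormedAddCommGroup (fun t => (f t : ℂ))
        (by fun_prop) ‖f‖ (fun t => by simpa using f.norm_coe_le_norm t)) x
      simp only [BoundedContinuousFunction.coe_ofNormedAddCommGroup] at h
      simp_rw [integral_complex_ofReal] at h
      rw [Fintype.sum_option]
      simp only [Option.elim]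
      rw [quad_polarization_eq_sum] at h
      rw [h]
      ring
  -- The negative half line lies outside every `[0, n + 1]`, so the tail bound forces its mass to be
  -- `0`.
  have hneg : ∀ x, (ν x : Measure ℝ).real (Set.Iio 0) = 0 := by
    intro x
    have h1 : ν x (Set.Iio 0) ≤ 0 := by
      refine ge_of_tendsto' (f := fun n : ℕ => b * (∑ i, ‖x i‖₊ ^ 2) * (1 / ((n : NNReal) + 1)))
        (htend _) fun n => ?_
      refine le_trans ((ν x).apply_mono ?_) ((hν x).2 n)
      intro t ht ht'
      exact absurd ht'.1 (not_le.2 ht)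
    have h2 : ((ν x : Measure ℝ) (Set.Iio 0)).toNNReal = 0 := le_antisymm h1 bot_le
    rw [measureReal_def, ENNReal.toReal, h2]
    rfl
  set c : Fin 4 → ℂ := fun k => (1 / 4) * star (Complex.I ^ (k : ℕ)) with hc
  set μ : ι → ι → ComplexMeasure ℝ := fun i j => ∑ k, c k •
    (ν (polarVec i j k) : Measure ℝ).toSignedMeasure.toComplexMeasure 0 with hμdef
  have hμ : ∀ i j s, MeasurableSet s →
      μ i j s = ∑ k, c k * ((ν (polarVec i j k) : Measure ℝ).real s : ℂ) := by
    intro i j s hs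
    simp only [hμdef, FunLike.coe_sum, Finset.sum_apply]
    refine Finset.sum_congr rfl fun k _ => ?_
    rw [FunLike.coe_smul, Pi.smul_apply, smul_eq_mul, SignedMeasure.toComplexMeasure_apply,
      Measure.toSignedMeasure_apply_measurable hs]
    rfl
  have hμ' : ∀ s, MeasurableSet s → (Matrix.of fun i j => μ i j s) =
      polarization fun y => ((ν y : Measure ℝ).real s : ℂ) := by
    intro s hs
    ext i j
    rw [Matrix.of_apply, hμ i j s hs]
    rfl
  have hnorm : IsNormalizedPosMatrixMeasure μ := by
    refine ⟨fun s hs => ?_, fun s hs hsub i j => ?_, fun i j => ?_⟩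
    · rw [hμ' s hs]
      refine posSemidef_of_quad fun x => ?_
      rw [← hset s x]
      exact_mod_cast measureReal_nonneg
    · rw [hμ i j s hs]
      refine Finset.sum_eq_zero fun k _ => ?_
      have : (ν (polarVec i j k) : Measure ℝ).real s = 0 :=
        le_antisymm ((measureReal_mono hsub).trans (hneg _).le) measureReal_nonneg
      rw [this, Complex.ofReal_zero, mul_zero]
    · have h1 : ∀ y, ((ν y : Measure ℝ).real (Set.Ici 0) : ℂ) = quad 1 y := by
        intro y
        have h2 := measureReal_add_measureReal_compl (μ := (ν y : Measure ℝ))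
          (measurableSet_Iio (a := (0 : ℝ)))
        rw [hneg, zero_add, Set.compl_Iio] at h2
        have h3 : (ν y : Measure ℝ).real Set.univ = ∑ i, ‖y i‖ ^ 2 := by
          have := congrArg NNReal.toReal (hν y).1
          push_cast at this
          exact this
        rw [h2, h3, quad, Matrix.one_mulVec]
        push_cast
        simp only [dotProduct, Pi.star_apply, RCLike.star_def, Complex.conj_mul']
      have h2 := congrFun (congrFun (hμ' (Set.Ici (0:ℝ)) measurableSet_Ici) i) j
      rw [Matrix.of_apply] at h2
      rw [h2]
      simp_rw [h1]
      rw [polarization_quad]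
  refine ⟨fun z => polarization fun y => ∫ t, cauchyKernel z t ∂(ν y : Measure ℝ),
    ⟨μ, hnorm, fun z hz i j => ?_⟩, fun z hz i j => ?_⟩
  · rw [hnorm.integral_inv_sub_eq, complexMeasure_integral_eq_sum (μ i j) c
      (fun k => (ν (polarVec i j k) : Measure ℝ)) (hμ i j)
      (continuous_cauchyKernel hz).stronglyMeasurable (norm_cauchyKernel_le hz)]
    rfl
  · have h1 : ∀ y, Tendsto (fun k => quad (S k z) y) 𝒰
        (𝓝 (∫ t, cauchyKernel z t ∂(ν y : Measure ℝ))) := by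
      intro y
      have := hint (BoundedContinuousFunction.ofNormedAddCommGroup (cauchyKernel z)
        (continuous_cauchyKernel hz) (rayDist z)⁻¹ (norm_cauchyKernel_le hz)) y
      simp only [BoundedContinuousFunction.coe_ofNormedAddCommGroup] at this
      simpa only [hcauchy _ z hz] using this
    simpa only [polarization_quad] using tendsto_polarization h1 i j

end

section


open scoped Matrix.Norms.L2Operator Kronecker

/-! ### Completely positive maps -/

section Kraus

variable {I J κ : Type*} [Fintype I] [Fintype J] [Fintype κ] [DecidableEq I] [DecidableEq J]

/-- The completely positive map `B ↦ ∑ a, A_a B A_aᴴ`. -/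
def kraus {I J κ : Type*} [Fintype J] [Fintype κ] (A : κ → Matrix I J ℂ) (B : Matrix J J ℂ) :
    Matrix I I ℂ := ∑ a, A a * B * (A a)ᴴ

lemma kraus_sub (A : κ → Matrix I J ℂ) (B C : Matrix J J ℂ) :
    kraus A (B - C) = kraus A B - kraus A C := by
  simp only [kraus, Matrix.mul_sub, Matrix.sub_mul, Finset.sum_sub_distrib]

lemma kraus_apply (A : κ → Matrix I J ℂ) (B : Matrix J J ℂ) (p q : I) :
    kraus A B p q = ∑ j, ∑ k, (∑ a, A a p j * star (A a q k)) * B j k := by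
  simp only [kraus, Matrix.sum_apply, Matrix.mul_apply, conjTranspose_apply, Finset.sum_mul]
  rw [Finset.sum_comm]
  conv_rhs => rw [Finset.sum_comm]
  refine Finset.sum_congr rfl fun k _ => ?_
  rw [Finset.sum_comm]
  exact Finset.sum_congr rfl fun j _ => Finset.sum_congr rfl fun a _ => by ring

lemma frob_sum_le {α : Type*} (s : Finset α) (A : α → Matrix I J ℂ) :
    frob (∑ a ∈ s, A a) ≤ ∑ a ∈ s, frob (A a) := by
  refine Finset.le_sum_of_subadditive frob ?_ frob_add_le s A
  simp [frob, ← Pi.zero_def]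

lemma frob_kraus_le (A : κ → Matrix I J ℂ) (B : Matrix J J ℂ) :
    frob (kraus A B) ≤ (∑ a, ‖A a‖ ^ 2) * frob B := by
  rw [Finset.sum_mul]
  refine (frob_sum_le _ _).trans (Finset.sum_le_sum fun a _ => ?_)
  refine (frob_mul_le' _ _).trans ?_
  rw [Matrix.l2_opNorm_conjTranspose]
  calc _ ≤ (‖A a‖ * frob B) * ‖A a‖ := by gcongr; exact frob_mul_le _ _
    _ = _ := by ring

/-- A crude constant common to the map and its adjoint, sufficient for existence and uniqueness at
fixed dimensions; `frob_kraus_le_sqrt` is the dimension-free version. -/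
lemma exists_frob_kraus_le (A : κ → Matrix I J ℂ) :
    ∃ g, 0 ≤ g ∧ (∀ B, frob (kraus A B) ≤ g * frob B) ∧
      ∀ D, frob (kraus (fun a => (A a)ᴴ) D) ≤ g * frob D := by
  refine ⟨∑ a, ‖A a‖ ^ 2, by positivity, frob_kraus_le A, fun D => ?_⟩
  simpa only [Matrix.l2_opNorm_conjTranspose] using frob_kraus_le (fun a => (A a)ᴴ) D

end Kraus

/-! ### Corners of resolvents -/

section Corner

variable {I J κ : Type} [Fintype I] [Fintype J] [Fintype κ] [DecidableEq I] [DecidableEq J]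
  [DecidableEq κ]

/-- `S` is a corner of the resolvent of a finite positive semidefinite matrix. -/
def IsCorner {I : Type} [Fintype I] [DecidableEq I] (S : ℂ → Matrix I I ℂ) (b : ℝ) : Prop :=
  ∃ (n p : Type) (_ : Fintype n) (_ : Fintype p) (_ : DecidableEq n) (_ : DecidableEq p)
    (G : Matrix n p ℂ) (V : Matrix n I ℂ), Vᴴ * V = 1 ∧ ‖Gᴴ * V‖ ^ 2 ≤ b ∧
      ∀ z ∈ cutPlane, S z = Vᴴ * res G z * V

lemma norm_le_one_of_conjTranspose_mul_self {n : Type*} [Fintype n] [DecidableEq n]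
    {V : Matrix n I ℂ} (hV : Vᴴ * V = 1) : ‖V‖ ≤ 1 := by
  have h := Matrix.l2_opNorm_conjTranspose_mul_self V
  rw [hV] at h
  nlinarith [norm_one_matrix_le (I := I), norm_nonneg V]

lemma IsCorner.norm_le {S : ℂ → Matrix I I ℂ} {b : ℝ} (hS : IsCorner S b) {z : ℂ}
    (hz : z ∈ cutPlane) : ‖S z‖ ≤ (rayDist z)⁻¹ := by
  obtain ⟨n, p, _, _, _, _, G, V, hV, -, hS⟩ := hS
  rw [hS z hz]
  have h1 := norm_le_one_of_conjTranspose_mul_self hV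
  have h2 := norm_res_le G hz
  refine (Matrix.l2_opNorm_mul _ _).trans ?_
  calc ‖Vᴴ * res G z‖ * ‖V‖ ≤ (‖Vᴴ‖ * ‖res G z‖) * ‖V‖ := by
        gcongr; exact Matrix.l2_opNorm_mul _ _
    _ ≤ 1 * (rayDist z)⁻¹ * 1 := by
        rw [Matrix.l2_opNorm_conjTranspose]
        have := norm_nonneg V
        have := inv_nonneg.2 (rayDist_pos hz).le
        gcongr
    _ = _ := by ring

/-- The starting point of the iteration is the resolvent of the zero matrix: take `G` with no
columns and `V = 1`. -/
lemma isCorner_neg_inv {b : ℝ} (hb : 0 ≤ b) :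
    IsCorner (fun z => (-1 / z) • (1 : Matrix I I ℂ)) b := by
  refine ⟨I, Empty, inferInstance, inferInstance, inferInstance, inferInstance, 0, 1, by simp,
    by simpa using hb, fun z hz => ?_⟩
  have hz0 := ne_zero_of_mem_cutPlane hz
  have h : (-(z • (1 : Matrix I I ℂ)))⁻¹ = (-1 / z) • 1 := by
    refine Matrix.inv_eq_right_inv ?_
    rw [Matrix.neg_mul, Matrix.smul_mul, Matrix.mul_smul, one_mul, smul_smul, ← neg_smul]
    rw [show -(z * (-1 / z)) = 1 by field_simp, one_smul]
  simp [res, h]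

/-- Corners of resolvents are stable under the maps of the canonical equation. -/
lemma IsCorner.next (A : κ → Matrix I J ℂ) {S : ℂ → Matrix J J ℂ} {b : ℝ} (hS : IsCorner S b)
    {T : ℂ → Matrix I I ℂ} (hT : ∀ z ∈ cutPlane, T z = (-1 / z) • (1 + kraus A (S z))⁻¹) :
    IsCorner T ‖kraus A 1‖ ∧ ∀ z ∈ cutPlane, T z * (1 + kraus A (S z)) = (-1 / z) • 1 := by
  obtain ⟨n, p, _, _, _, _, G, V, hV, -, hS⟩ := hS
  -- `B` puts the matrices `A_a Vᴴ` side by side, so that `B (R ⊗ 1) Bᴴ = ∑ A_a (Vᴴ R V) A_aᴴ`. With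
  -- `Y` the stack of `B` over `G'ᴴ`, the Schur complement of the second block of `Y Yᴴ - z` is `-z
  -- (1 + B R' Bᴴ)`, where `R' = (G' G'ᴴ - z)⁻¹`.
  set B : Matrix I (n × κ) ℂ := Matrix.of fun i x => (A x.2 * Vᴴ) i x.1 with hB
  set G' : Matrix (n × κ) (p × κ) ℂ := G ⊗ₖ (1 : Matrix κ κ ℂ) with hG'
  set Y : Matrix (I ⊕ (p × κ)) (n × κ) ℂ := Matrix.fromRows B G'ᴴ with hY
  set W : Matrix (I ⊕ (p × κ)) I ℂ := Matrix.fromRows 1 0 with hW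
  have hBR : ∀ R : Matrix n n ℂ, B * (R ⊗ₖ (1 : Matrix κ κ ℂ)) * Bᴴ = kraus A (Vᴴ * R * V) := by
    intro R
    ext i j
    have h1 : ∀ a, A a * (Vᴴ * R * V) * (A a)ᴴ = (A a * Vᴴ) * R * (A a * Vᴴ)ᴴ := by
      intro a
      simp only [conjTranspose_mul, conjTranspose_conjTranspose, Matrix.mul_assoc]
    simp only [kraus, h1, Matrix.sum_apply]
    have hBa : ∀ i x, B i x = (A x.2 * Vᴴ) i x.1 := fun _ _ => rfl
    have h2 : ∀ x, (B * (R ⊗ₖ (1 : Matrix κ κ ℂ))) i x = (A x.2 * Vᴴ * R) i x.1 := by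
      intro x
      rw [Matrix.mul_apply, Matrix.mul_apply, Fintype.sum_prod_type]
      simp [hBa, kroneckerMap_apply, Matrix.one_apply]
    rw [Matrix.mul_apply, Fintype.sum_prod_type, Finset.sum_comm]
    refine Finset.sum_congr rfl fun a _ => ?_
    rw [Matrix.mul_apply]
    refine Finset.sum_congr rfl fun x _ => ?_
    rw [h2, conjTranspose_apply, conjTranspose_apply, hBa]
  have hWW : Wᴴ * W = 1 := by
    rw [hW, conjTranspose_fromRows_eq_fromCols_conjTranspose, fromCols_mul_fromRows]
    simp
  have hBB : B * Bᴴ = kraus A 1 := by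
    have := hBR 1
    rwa [one_kronecker_one, Matrix.mul_one, Matrix.mul_one, hV] at this
  -- the Schur complement identity
  have key : ∀ z ∈ cutPlane, (Wᴴ * res Y z * W) * (1 + kraus A (S z)) = (-1 / z) • 1 := by
    intro z hz
    have hz0 := ne_zero_of_mem_cutPlane hz
    set R' : Matrix (n × κ) (n × κ) ℂ := res G z ⊗ₖ (1 : Matrix κ κ ℂ) with hR'
    have hGR : G' * G'ᴴ * R' = 1 + z • R' := by
      rw [hG', hR', conjTranspose_kronecker, conjTranspose_one, ← mul_kronecker_mul,
        ← mul_kronecker_mul, self_mul_res G hz, Matrix.one_mul, Matrix.one_mul, add_kronecker,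
        one_kronecker_one, smul_kronecker]
    have hkr : kraus A (S z) = B * R' * Bᴴ := by rw [hBR, hS z hz]
    -- Block elimination without inverting blocks: `X` has top block `1`, and `(Y Yᴴ - z) X`
    -- vanishes on the second block, so it equals `W` times the Schur complement.
    set X : Matrix (I ⊕ (p × κ)) I ℂ := Matrix.fromRows 1 (-(G'ᴴ * R' * Bᴴ)) with hX
    have hX1 : (Y * Yᴴ - z • 1) * X = W * ((-z) • (1 + kraus A (S z))) := by
      have h1 : Yᴴ * X = Bᴴ - G' * G'ᴴ * R' * Bᴴ := by
        rw [hY, hX, conjTranspose_fromRows_eq_fromCols_conjTranspose, fromCols_mul_fromRows]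
        simp [Matrix.mul_assoc, sub_eq_add_neg]
      have h2 : Yᴴ * X = -z • (R' * Bᴴ) := by
        rw [h1, hGR, Matrix.add_mul, Matrix.one_mul, Matrix.smul_mul]
        module
      rw [Matrix.sub_mul, Matrix.mul_assoc, h2, hY, hX, hW, fromRows_mul, hkr, Matrix.smul_mul,
        Matrix.one_mul]
      have h3 : B * -z • (R' * Bᴴ) - z • (1 : Matrix I I ℂ) = -z • (1 + B * R' * Bᴴ) := by
        rw [Matrix.mul_smul, ← Matrix.mul_assoc]
        module
      ext (i | i) j
      · have := congrFun (congrFun h3 i) j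
        simpa [mul_add] using this
      · simp [Matrix.mul_assoc]
    have hu := isUnit_mul_conjTranspose_sub Y hz
    have h3 : X = res Y z * (W * ((-z) • (1 + kraus A (S z)))) := by
      rw [← hX1, res, Matrix.nonsing_inv_mul_cancel_left _ _ ((Matrix.isUnit_iff_isUnit_det _).1 hu)]
    have h4 : Wᴴ * X = 1 := by
      rw [hW, hX, conjTranspose_fromRows_eq_fromCols_conjTranspose, fromCols_mul_fromRows]
      simp
    rw [h3] at h4
    have h5 : (-z) • ((Wᴴ * res Y z * W) * (1 + kraus A (S z))) = 1 := by
      refine Eq.trans ?_ h4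
      rw [Matrix.mul_smul, Matrix.mul_smul, Matrix.mul_smul, Matrix.mul_assoc, Matrix.mul_assoc]
    have h6 := congrArg (fun X => (-1 / z) • X) h5
    simp only [smul_smul] at h6
    rw [← h6, show -1 / z * -z = 1 by field_simp, one_smul]
  have hTS : ∀ z ∈ cutPlane, T z = Wᴴ * res Y z * W := by
    intro z hz
    have hz0 := ne_zero_of_mem_cutPlane hz
    have h1 : ((-z) • (Wᴴ * res Y z * W)) * (1 + kraus A (S z)) = 1 := by
      rw [Matrix.smul_mul, key z hz, smul_smul, show -z * (-1 / z) = 1 by field_simp, one_smul]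
    rw [hT z hz, Matrix.inv_eq_left_inv h1, smul_smul, show -1 / z * -z = 1 by field_simp, one_smul]
  refine ⟨⟨I ⊕ (p × κ), n × κ, inferInstance, inferInstance, inferInstance, inferInstance, Y, W,
    hWW, ?_, hTS⟩, fun z hz => by rw [hTS z hz, key z hz]⟩
  -- The new moment is `‖B Bᴴ‖ = ‖kraus A 1‖`, whatever `b` was; hence one bound serves all
  -- iterates.
  have h1 : Yᴴ * W = Bᴴ := by
    rw [hY, hW, conjTranspose_fromRows_eq_fromCols_conjTranspose, fromCols_mul_fromRows]
    simp
  rw [h1, sq, ← Matrix.l2_opNorm_conjTranspose_mul_self, conjTranspose_conjTranspose, hBB]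

end Corner

end

section



/-! ### Existence and uniqueness for the canonical equation -/

lemma tendsto_mul_one_add_kraus {I J κ α : Type*} [Fintype I] [Fintype J] [Fintype κ]
    [DecidableEq I] [DecidableEq J] (A : κ → Matrix I J ℂ) {l : Filter α} {S : α → Matrix I I ℂ}
    {S' : α → Matrix J J ℂ} {T : Matrix I I ℂ} {T' : Matrix J J ℂ}
    (hS : ∀ i j, Tendsto (fun k => S k i j) l (𝓝 (T i j)))
    (hS' : ∀ i j, Tendsto (fun k => S' k i j) l (𝓝 (T' i j))) (i j : I) :
    Tendsto (fun k => (S k * (1 + kraus A (S' k))) i j) l (𝓝 ((T * (1 + kraus A T')) i j)) := by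
  simp only [Matrix.mul_apply, Matrix.add_apply, kraus_apply]
  exact tendsto_finsetSum _ fun k _ => (hS i k).mul (tendsto_const_nhds.add
    (tendsto_finsetSum _ fun a _ => tendsto_finsetSum _ fun b _ => (hS' a b).const_mul _))

lemma differentiableOn_mul_one_add_kraus {I J κ : Type*} [Fintype I] [Fintype J] [Fintype κ]
    [DecidableEq I] [DecidableEq J] (A : κ → Matrix I J ℂ) {U : Set ℂ} {T : ℂ → Matrix I I ℂ}
    {T' : ℂ → Matrix J J ℂ} (hT : ∀ i j, DifferentiableOn ℂ (fun z => T z i j) U)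
    (hT' : ∀ i j, DifferentiableOn ℂ (fun z => T' z i j) U) (i j : I) :
    DifferentiableOn ℂ (fun z => (T z * (1 + kraus A (T' z))) i j) U := by
  simp only [Matrix.mul_apply, Matrix.add_apply, kraus_apply]
  exact DifferentiableOn.fun_sum fun k _ => (hT i k).mul ((differentiableOn_const _).add
    (DifferentiableOn.fun_sum fun a _ => DifferentiableOn.fun_sum fun b _ =>
      (hT' a b).const_mul _))

lemma eqOn_cutPlane {f g : ℂ → ℂ} (hf : DifferentiableOn ℂ f cutPlane)
    (hg : DifferentiableOn ℂ g cutPlane) {t : ℝ} (ht : 1 < t)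
    (h : ∀ z ∈ Metric.ball (-t : ℂ) 1, f z = g z) : Set.EqOn f g cutPlane :=
  (hf.analyticOnNhd isOpen_cutPlane).eqOn_of_preconnected_of_eventuallyEq
    (hg.analyticOnNhd isOpen_cutPlane) isPreconnected_cutPlane (neg_mem_cutPlane (by linarith))
    (Filter.eventually_of_mem (Metric.ball_mem_nhds _ one_pos) h)

/-- The left side is the Lipschitz constant of the canonical map for inputs bounded by `(rayDist
z)⁻¹` and a coupling of norm `K`. On the disc `‖z‖ ≤ 4K + 6` and `rayDist z ≥ 4K + 4`, which brings
it below `1/2`. -/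
lemma norm_mul_inv_rayDist_sq_le {K : ℝ} (hK : 0 ≤ K) {z : ℂ}
    (hz : z ∈ Metric.ball (-((4 * K + 5 : ℝ)) : ℂ) 1) :
    ‖z‖ * ((rayDist z)⁻¹) ^ 2 * K ≤ 1 / 2 := by
  have h1 := rayDist_neg_ge hz
  have h2 : ‖z‖ ≤ 4 * K + 6 := by
    rw [Metric.mem_ball, dist_eq_norm] at hz
    have h3 : ‖(-((4 * K + 5 : ℝ)) : ℂ)‖ = 4 * K + 5 := by
      rw [norm_neg, Complex.norm_real, Real.norm_of_nonneg (by positivity)]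
    have := norm_le_norm_add_norm_sub' z (-((4 * K + 5 : ℝ)) : ℂ)
    linarith
  have h3 : (rayDist z)⁻¹ ≤ (4 * K + 4)⁻¹ := inv_anti₀ (by positivity) (by linarith)
  have h4 : 0 ≤ (rayDist z)⁻¹ := inv_nonneg.2 (by linarith)
  calc ‖z‖ * ((rayDist z)⁻¹) ^ 2 * K ≤ (4 * K + 6) * ((4 * K + 4)⁻¹) ^ 2 * K := by gcongr
    _ ≤ 1 / 2 := by
        rw [inv_pow, ← div_eq_mul_inv, div_mul_eq_mul_div, div_le_iff₀ (by positivity)]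
        nlinarith

open scoped Matrix.Norms.L2Operator

section Corner

variable {I J κ : Type} [Fintype I] [Fintype J] [Fintype κ] [DecidableEq I] [DecidableEq J]
  [DecidableEq κ]

lemma quad_conjTranspose_mul_diagonal_mul {n : Type*} [Fintype n] [DecidableEq n]
    (K : Matrix n I ℂ) (d : n → ℂ) (x : I → ℂ) :
    quad (Kᴴ * diagonal d * K) x = ∑ k, (‖(K *ᵥ x) k‖ ^ 2 : ℝ) * d k := by
  rw [quad, ← Matrix.mulVec_mulVec, ← Matrix.mulVec_mulVec, Matrix.dotProduct_mulVec,
    ← Matrix.star_mulVec, dotProduct]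
  refine Finset.sum_congr rfl fun k _ => ?_
  rw [Matrix.mulVec_diagonal, Pi.star_apply, RCLike.star_def, mul_left_comm, Complex.conj_mul',
    mul_comm]
  push_cast
  rfl

lemma quad_conjTranspose_mul_self {n : Type*} [Fintype n] [DecidableEq n]
    (K : Matrix n I ℂ) (x : I → ℂ) :
    quad (Kᴴ * K) x = ((∑ k, ‖(K *ᵥ x) k‖ ^ 2 : ℝ) : ℂ) := by
  have := quad_conjTranspose_mul_diagonal_mul K (fun _ => 1) x
  rw [diagonal_one, Matrix.mul_one] at this
  rw [this]
  push_cast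
  simp

/-- Diagonalize `G Gᴴ`: the measure at `x` is `∑ ‖(K x)_k‖² δ_{λ_k}` with `K = Uᴴ V`. Its first
moment is `‖Gᴴ V x‖² ≤ b ‖x‖²`, and Markov's inequality gives the tail bound. -/
lemma IsCorner.hasSpectralForm {S : ℂ → Matrix I I ℂ} {b : NNReal} (hS : IsCorner S b) :
    HasSpectralForm S b := by
  obtain ⟨n, p, _, _, _, _, G, V, hV, hG, hS⟩ := hS
  have hH := Matrix.posSemidef_self_mul_conjTranspose G
  set U := (hH.1.eigenvectorUnitary : Matrix n n ℂ) with hU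
  set lam := hH.1.eigenvalues with hlam
  have hl : ∀ k, 0 ≤ lam k := hH.eigenvalues_nonneg
  have hUU : U * Uᴴ = 1 := Unitary.mul_star_self_of_mem hH.1.eigenvectorUnitary.2
  set K : Matrix n I ℂ := Uᴴ * V with hK
  have hKK : Kᴴ * K = 1 := by
    rw [hK, conjTranspose_mul, conjTranspose_conjTranspose, Matrix.mul_assoc,
      ← Matrix.mul_assoc U, hUU, Matrix.one_mul, hV]
  have hGK : (Gᴴ * V)ᴴ * (Gᴴ * V) = Kᴴ * diagonal (fun k => (lam k : ℂ)) * K := by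
    have h := sub_smul_one_eq hH.1 0
    simp only [zero_smul, sub_zero] at h
    rw [hK, conjTranspose_mul, conjTranspose_mul, conjTranspose_conjTranspose,
      conjTranspose_conjTranspose, Matrix.mul_assoc, ← Matrix.mul_assoc G, h]
    simp only [Matrix.mul_assoc]
    rfl
  have hsum : ∀ x, ∑ k, ‖(K *ᵥ x) k‖ ^ 2 = ∑ i, ‖x i‖ ^ 2 := by
    intro x
    have h := quad_conjTranspose_mul_self K x
    rw [hKK, ← Matrix.one_mul (1 : Matrix I I ℂ)] at h
    nth_rw 1 [← conjTranspose_one] at h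
    rw [quad_conjTranspose_mul_self, Matrix.one_mulVec] at h
    exact (Complex.ofReal_injective h).symm
  have hmom : ∀ x, ∑ k, ‖(K *ᵥ x) k‖ ^ 2 * lam k ≤ b * ∑ i, ‖x i‖ ^ 2 := by
    intro x
    have h := quad_conjTranspose_mul_self (Gᴴ * V) x
    rw [hGK, quad_conjTranspose_mul_diagonal_mul] at h
    have h' : ∑ k, ‖(K *ᵥ x) k‖ ^ 2 * lam k = ∑ k, ‖((Gᴴ * V) *ᵥ x) k‖ ^ 2 := by
      exact_mod_cast h
    rw [h']
    refine (sum_norm_sq_mulVec_le _ _).trans ?_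
    gcongr
  set ρ : (I → ℂ) → Measure ℝ := fun x =>
    ∑ k, (‖(K *ᵥ x) k‖₊ ^ 2 : NNReal) • Measure.dirac (lam k) with hρ
  have hint : ∀ (f : ℝ → ℂ) x, ∫ t, f t ∂(ρ x) = ∑ k, (‖(K *ᵥ x) k‖ ^ 2 : ℝ) * f (lam k) := by
    intro f x
    rw [hρ, integral_finsetSum_measure fun k _ => (integrable_dirac (by simp)).smul_measure_nnreal]
    refine Finset.sum_congr rfl fun k _ => ?_
    rw [integral_smul_nnreal_measure, integral_dirac, NNReal.smul_def, Complex.real_smul]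
    simp
  have happ : ∀ x s, MeasurableSet s → (ρ x).real s =
      ∑ k, ‖(K *ᵥ x) k‖ ^ 2 * s.indicator 1 (lam k) := by
    intro x s hs
    rw [hρ, measureReal_def, Measure.finsetSum_apply, ENNReal.toReal_sum fun k _ => measure_ne_top _ _]
    refine Finset.sum_congr rfl fun k _ => ?_
    rw [Measure.smul_apply, Measure.dirac_apply' _ hs, ENNReal.toReal_smul]
    by_cases h : lam k ∈ s <;> simp [h, NNReal.smul_def]
  refine ⟨fun x => ⟨ρ x, inferInstance⟩, fun f _ => ⟨Kᴴ * diagonal (fun k => f (lam k)) * K,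
    fun x => ?_⟩, fun x => ?_, fun x m => ?_, fun z hz x => ?_⟩
  · rw [quad_conjTranspose_mul_diagonal_mul]
    exact hint f x
  · rw [← NNReal.coe_inj]
    have h := happ x Set.univ MeasurableSet.univ
    simp only [Set.indicator_univ, Pi.one_apply, mul_one, hsum] at h
    push_cast
    exact h
  · rw [← NNReal.coe_le_coe]
    have h := happ x (Set.Icc 0 ((m : ℝ) + 1))ᶜ measurableSet_Icc.compl
    refine (show _ = _ from h).trans_le ?_
    push_cast
    have h2 : ∀ k, (Set.Icc 0 ((m : ℝ) + 1))ᶜ.indicator (1 : ℝ → ℝ) (lam k) ≤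
        lam k * (1 / ((m : ℝ) + 1)) := by
      intro k
      by_cases hk : lam k ∈ (Set.Icc 0 ((m : ℝ) + 1))ᶜ
      · rw [Set.indicator_of_mem hk, mul_one_div, Pi.one_apply, le_div_iff₀ (by positivity)]
        by_contra! h3
        exact hk ⟨hl k, by linarith⟩
      · rw [Set.indicator_of_notMem hk]
        have := hl k
        positivity
    calc _ ≤ ∑ k, ‖(K *ᵥ x) k‖ ^ 2 * (lam k * (1 / ((m : ℝ) + 1))) := by
          gcongr with k _; exact h2 k
      _ = (∑ k, ‖(K *ᵥ x) k‖ ^ 2 * lam k) * (1 / ((m : ℝ) + 1)) := by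
          rw [Finset.sum_mul]; exact Finset.sum_congr rfl fun k _ => by ring
      _ ≤ _ := by gcongr; simpa using hmom x
  · have h1 : S z = Kᴴ * diagonal (fun k => ((lam k : ℂ) - z)⁻¹) * K := by
      rw [hS z hz, res, (inv_sub_smul_one_eq hH hz).2, hK, conjTranspose_mul,
        conjTranspose_conjTranspose]
      simp only [Matrix.mul_assoc]
      rfl
    rw [h1, quad_conjTranspose_mul_diagonal_mul]
    refine (hint _ x).trans (Finset.sum_congr rfl fun k _ => ?_)
    rw [cauchyKernel, max_eq_left (hl k)]

lemma IsCorner.mono {S : ℂ → Matrix I I ℂ} {b b' : ℝ} (hS : IsCorner S b) (h : b ≤ b') :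
    IsCorner S b' := by
  obtain ⟨n, p, i1, i2, i3, i4, G, V, hV, hG, hS⟩ := hS
  exact ⟨n, p, i1, i2, i3, i4, G, V, hV, hG.trans h, hS⟩

/-! The two coupled equations, in product form. -/

/-- The product form is polynomial in the entries, hence stable under entrywise limits and analytic
continuation, and it contains the invertibility. -/
lemma eq_smul_inv_iff {X Y : Matrix I I ℂ} {z : ℂ} (hz : z ≠ 0) :
    X * Y = (-1 / z) • 1 ↔ IsUnit Y ∧ X = (-1 / z) • Y⁻¹ := by
  constructor
  · intro h
    have h1 : ((-z) • X) * Y = 1 := by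
      rw [Matrix.smul_mul, h, smul_smul, show -z * (-1 / z) = 1 by field_simp, one_smul]
    refine ⟨(Matrix.isUnit_iff_isUnit_det _).2 (Matrix.isUnit_det_of_left_inverse h1), ?_⟩
    rw [Matrix.inv_eq_left_inv h1, smul_smul, show -1 / z * -z = 1 by field_simp, one_smul]
  · rintro ⟨hY, rfl⟩
    rw [Matrix.smul_mul, Matrix.nonsing_inv_mul _ ((Matrix.isUnit_iff_isUnit_det _).1 hY)]

/-- Comparison of an exact and an approximate solution of one of the two equations. -/
lemma sub_eq_of_mul_one_add {D T E F Δ : Matrix I I ℂ} {z : ℂ} (hz : z ≠ 0)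
    (hD : D * (1 + E) = (-1 / z) • 1 + Δ) (hT : T * (1 + F) = (-1 / z) • 1) :
    D - T = z • (D * (E - F) * T) - z • (Δ * T) := by
  have hT' : (1 + F) * T = (-1 / z) • 1 := by
    obtain ⟨hF, h⟩ := (eq_smul_inv_iff hz).1 hT
    rw [h, Matrix.mul_smul, Matrix.mul_nonsing_inv _ ((Matrix.isUnit_iff_isUnit_det _).1 hF)]
  have h1 : D * (E - F) * T = (D * (1 + E)) * T - D * ((1 + F) * T) := by noncomm_ring
  rw [h1, hD, hT', Matrix.add_mul, Matrix.smul_mul, Matrix.mul_smul, Matrix.one_mul,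
    Matrix.mul_one, smul_sub, smul_add, smul_smul, smul_smul,
    show z * (-1 / z) = -1 by field_simp]
  module

lemma frob_sub_le_of_mul_one_add {D T E F Δ : Matrix I I ℂ} {z : ℂ} (hz : z ≠ 0)
    (hD : D * (1 + E) = (-1 / z) • 1 + Δ) (hT : T * (1 + F) = (-1 / z) • 1) :
    frob (D - T) ≤ ‖z‖ * (‖D‖ * ‖T‖) * frob (E - F) + ‖z‖ * ‖T‖ * frob Δ := by
  rw [sub_eq_of_mul_one_add hz hD hT]
  refine (frob_sub_le _ _).trans (add_le_add ?_ ?_)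
  · rw [frob_smul, mul_assoc ‖z‖]
    gcongr
    refine (frob_mul_le' (D * (E - F)) T).trans ?_
    calc _ ≤ (‖D‖ * frob (E - F)) * ‖T‖ := by gcongr; exact frob_mul_le _ _
      _ = _ := by ring
  · rw [frob_smul, mul_assoc ‖z‖, mul_comm ‖T‖]
    gcongr
    exact frob_mul_le' _ _

/-- `(T, T')` solves, at the point `z`, the equations `T (1 + η(T')) = -1/z` and
`T' (1 + η*(T)) = -1/z`, where `η(B) = ∑ A_a B A_aᴴ` and `η*(D) = ∑ A_aᴴ D A_a`. -/
def IsSolutionAt {I J κ : Type} [Fintype I] [Fintype J] [Fintype κ] [DecidableEq I] [DecidableEq J]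
    (A : κ → Matrix I J ℂ) (z : ℂ) (T : Matrix I I ℂ) (T' : Matrix J J ℂ) : Prop :=
  T * (1 + kraus A T') = (-1 / z) • 1 ∧ T' * (1 + kraus (fun a => (A a)ᴴ) T) = (-1 / z) • 1

/-- Stability of the coupled equations. With `E = D'` and `E' = D` half of the left side can be
absorbed, so an approximate solution is close to the exact one; with `Δ = Δ' = 0` this is
uniqueness. -/
lemma IsSolutionAt.frob_le {A : κ → Matrix I J ℂ} {z : ℂ} (hz : z ≠ 0) {T : Matrix I I ℂ}
    {T' : Matrix J J ℂ} (hT : IsSolutionAt A z T T') {D Δ : Matrix I I ℂ} {D' Δ' : Matrix J J ℂ}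
    {E : Matrix J J ℂ} {E' : Matrix I I ℂ}
    (hD : D * (1 + kraus A E) = (-1 / z) • 1 + Δ)
    (hD' : D' * (1 + kraus (fun a => (A a)ᴴ) E') = (-1 / z) • 1 + Δ')
    {g r s : ℝ} (hg : ∀ B, frob (kraus A B) ≤ g * frob B)
    (hg' : ∀ D, frob (kraus (fun a => (A a)ᴴ) D) ≤ g * frob D)
    (hDr : ‖D‖ ≤ s) (hDr' : ‖D'‖ ≤ s) (hTr : ‖T‖ ≤ r) (hTr' : ‖T'‖ ≤ r)
    (hsmall : ‖z‖ * (s * r) * g ≤ 1 / 2) :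
    frob (D - T) + frob (D' - T') ≤ 1 / 2 * (frob (E - T') + frob (E' - T)) +
      ‖z‖ * r * (frob Δ + frob Δ') := by
  have hr : 0 ≤ r := (norm_nonneg _).trans hTr
  have hs : 0 ≤ s := (norm_nonneg _).trans hDr
  have key : ∀ {a b c x e : ℝ}, 0 ≤ a → 0 ≤ b → a ≤ s → b ≤ r → 0 ≤ c → 0 ≤ x → e ≤ g * x →
      0 ≤ e → ‖z‖ * (a * b) * e + ‖z‖ * b * c ≤ 1 / 2 * x + ‖z‖ * r * c := by
    intro a b c x e ha hb has hbr hc hx he he0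
    calc ‖z‖ * (a * b) * e + ‖z‖ * b * c ≤ ‖z‖ * (s * r) * (g * x) + ‖z‖ * r * c := by gcongr
      _ = ‖z‖ * (s * r) * g * x + ‖z‖ * r * c := by ring
      _ ≤ _ := by gcongr
  have h1 := frob_sub_le_of_mul_one_add hz hD hT.1
  have h2 := frob_sub_le_of_mul_one_add hz hD' hT.2
  rw [← kraus_sub] at h1 h2
  have k1 := key (norm_nonneg D) (norm_nonneg T) hDr hTr (frob_nonneg Δ) (frob_nonneg (E - T'))
    (hg _) (frob_nonneg _)
  have k2 := key (norm_nonneg D') (norm_nonneg T') hDr' hTr' (frob_nonneg Δ') (frob_nonneg (E' - T))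
    (hg' _) (frob_nonneg _)
  linarith

/-- The iterates of the canonical equation. -/
def canonicalIter {I J κ : Type} [Fintype I] [Fintype J] [Fintype κ] [DecidableEq I] [DecidableEq J]
    (A : κ → Matrix I J ℂ) : ℕ → (ℂ → Matrix I I ℂ) × (ℂ → Matrix J J ℂ)
  | 0 => (fun z => (-1 / z) • 1, fun z => (-1 / z) • 1)
  | k + 1 => (fun z => (-1 / z) • (1 + kraus A ((canonicalIter A k).2 z))⁻¹,
      fun z => (-1 / z) • (1 + kraus (fun a => (A a)ᴴ) ((canonicalIter A k).1 z))⁻¹)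

lemma exists_isCorner_canonicalIter (A : κ → Matrix I J ℂ) : ∃ b : NNReal, ∀ k,
    IsCorner (canonicalIter A k).1 b ∧ IsCorner (canonicalIter A k).2 b := by
  refine ⟨⟨max ‖kraus A 1‖ ‖kraus (fun a => (A a)ᴴ) 1‖, by positivity⟩, fun k => ?_⟩
  induction k with
  | zero => exact ⟨isCorner_neg_inv (NNReal.coe_nonneg _), isCorner_neg_inv (NNReal.coe_nonneg _)⟩
  | succ k ih =>
    exact ⟨(ih.2.next A fun _ _ => rfl).1.mono (le_max_left _ _),
      (ih.1.next (fun a => (A a)ᴴ) fun _ _ => rfl).1.mono (le_max_right _ _)⟩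

lemma canonicalIter_succ (A : κ → Matrix I J ℂ) (k : ℕ) {z : ℂ} (hz : z ∈ cutPlane) :
    (canonicalIter A (k + 1)).1 z * (1 + kraus A ((canonicalIter A k).2 z)) = (-1 / z) • 1 ∧
    (canonicalIter A (k + 1)).2 z * (1 + kraus (fun a => (A a)ᴴ) ((canonicalIter A k).1 z)) =
      (-1 / z) • 1 := by
  obtain ⟨b, hb⟩ := exists_isCorner_canonicalIter A
  exact ⟨((hb k).2.next A fun _ _ => rfl).2 z hz,
    ((hb k).1.next (fun a => (A a)ᴴ) fun _ _ => rfl).2 z hz⟩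

/-- The two Frobenius distances between consecutive iterates, added together, are at least halved at
each step. -/
lemma tendsto_frob_canonicalIter_sub (A : κ → Matrix I J ℂ) {g : ℝ}
    (hg : ∀ B, frob (kraus A B) ≤ g * frob B)
    (hg' : ∀ D, frob (kraus (fun a => (A a)ᴴ) D) ≤ g * frob D) {z : ℂ} (hz : z ∈ cutPlane)
    (hsmall : ‖z‖ * ((rayDist z)⁻¹) ^ 2 * g ≤ 1 / 2) :
    Tendsto (fun k => frob ((canonicalIter A (k + 1)).1 z - (canonicalIter A k).1 z) +
      frob ((canonicalIter A (k + 1)).2 z - (canonicalIter A k).2 z)) atTop (𝓝 0) := by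
  obtain ⟨b, hb⟩ := exists_isCorner_canonicalIter A
  set e : ℕ → ℝ := fun k => frob ((canonicalIter A (k + 1)).1 z - (canonicalIter A k).1 z) +
      frob ((canonicalIter A (k + 1)).2 z - (canonicalIter A k).2 z) with he
  have hr : 0 ≤ (rayDist z)⁻¹ := inv_nonneg.2 (rayDist_pos hz).le
  have hz0 := ne_zero_of_mem_cutPlane hz
  have hstep : ∀ k, e (k + 1) ≤ 1 / 2 * e k := by
    intro k
    obtain ⟨h1, h2⟩ := canonicalIter_succ A (k + 1) hz
    obtain ⟨h3, h4⟩ := canonicalIter_succ A k hz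
    have k1 := frob_sub_le_of_mul_one_add (Δ := 0) hz0 (by rw [h1, add_zero]) h3
    have k2 := frob_sub_le_of_mul_one_add (Δ := 0) hz0 (by rw [h2, add_zero]) h4
    rw [← kraus_sub] at k1 k2
    have f0 : ∀ {n : Type} [Fintype n], frob (0 : Matrix n n ℂ) = 0 := by
      intro n _
      simp [frob, ← Pi.zero_def]
    rw [f0, mul_zero, add_zero] at k1 k2
    have l1 : ∀ {n m : Type} [Fintype n] [DecidableEq n] [Fintype m] [DecidableEq m]
        {X Y : Matrix n n ℂ} {Z : Matrix n n ℂ} {W : Matrix m m ℂ},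
        ‖X‖ ≤ (rayDist z)⁻¹ → ‖Y‖ ≤ (rayDist z)⁻¹ → frob Z ≤ g * frob W →
        ‖z‖ * (‖X‖ * ‖Y‖) * frob Z ≤ 1 / 2 * frob W := by
      intro n m _ _ _ _ X Y Z W hX hY hZ
      have := frob_nonneg Z
      have := frob_nonneg W
      calc ‖z‖ * (‖X‖ * ‖Y‖) * frob Z ≤
            ‖z‖ * ((rayDist z)⁻¹ * (rayDist z)⁻¹) * (g * frob W) := by gcongr
        _ = ‖z‖ * ((rayDist z)⁻¹) ^ 2 * g * frob W := by ring
        _ ≤ _ := by gcongr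
    have m1 := k1.trans (l1 ((hb (k + 2)).1.norm_le hz) ((hb (k + 1)).1.norm_le hz) (hg _))
    have m2 := k2.trans (l1 ((hb (k + 2)).2.norm_le hz) ((hb (k + 1)).2.norm_le hz) (hg' _))
    simp only [he]
    linarith
  have hpow : ∀ k, e k ≤ e 0 * (1 / 2) ^ k := by
    intro k
    induction k with
    | zero => simp
    | succ k ih => rw [pow_succ]; linarith [hstep k]
  refine squeeze_zero (fun k => add_nonneg (frob_nonneg _) (frob_nonneg _)) hpow ?_
  have := (tendsto_pow_atTop_nhds_zero_of_lt_one (r := (1 / 2 : ℝ)) (by norm_num)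
    (by norm_num)).const_mul (e 0)
  rwa [mul_zero] at this

lemma norm_le_of_tendsto_entry {α : Type*} {l : Filter α} [l.NeBot] {S : α → Matrix I I ℂ}
    {T : Matrix I I ℂ} (h : ∀ i j, Tendsto (fun k => S k i j) l (𝓝 (T i j))) {C : ℝ} (hC : 0 ≤ C)
    (hS : ∀ k, ‖S k‖ ≤ C) : ‖T‖ ≤ C := by
  refine norm_le_of_sum_norm_sq_mulVec_le hC fun v => ?_
  have h1 : Tendsto (fun k => ∑ i, ‖(S k *ᵥ v) i‖ ^ 2) l (𝓝 (∑ i, ‖(T *ᵥ v) i‖ ^ 2)) := by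
    simp only [Matrix.mulVec, dotProduct]
    exact tendsto_finsetSum _ fun i _ => ((tendsto_finsetSum _ fun j _ =>
      (h i j).mul_const _).norm.pow 2)
  refine le_of_tendsto' h1 fun k => (sum_norm_sq_mulVec_le _ _).trans ?_
  gcongr
  exact hS k

/-- Ultrafilter limits of the iterates exist on the whole cut plane but need not obviously solve the
equation. On the disc where the map contracts, the shifted sequence has the same limit, so the
recursion becomes the equation; both sides are holomorphic, and the identity theorem does the rest.
-/
theorem exists_isStieltjes_isSolutionAt (A : κ → Matrix I J ℂ) :
    ∃ (T : ℂ → Matrix I I ℂ) (T' : ℂ → Matrix J J ℂ), IsStieltjes T ∧ IsStieltjes T' ∧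
      (∀ z ∈ cutPlane, ‖T z‖ ≤ (rayDist z)⁻¹ ∧ ‖T' z‖ ≤ (rayDist z)⁻¹) ∧
      ∀ z ∈ cutPlane, IsSolutionAt A z (T z) (T' z) := by
  obtain ⟨b, hb⟩ := exists_isCorner_canonicalIter A
  obtain ⟨g, hg0, hg, hg'⟩ := exists_frob_kraus_le A
  obtain ⟨T, hT, hTlim⟩ := exists_isStieltjes_of_hasSpectralForm (Filter.hyperfilter ℕ)
    fun k => (hb k).1.hasSpectralForm
  obtain ⟨T', hT', hTlim'⟩ := exists_isStieltjes_of_hasSpectralForm (Filter.hyperfilter ℕ)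
    fun k => (hb k).2.hasSpectralForm
  have hball : ∀ z ∈ Metric.ball (-((4 * g + 5 : ℝ)) : ℂ) 1, IsSolutionAt A z (T z) (T' z) := by
    intro z hz
    have hzc := ball_neg_subset_cutPlane (by linarith) hz
    have ht := tendsto_frob_canonicalIter_sub A hg hg' hzc (norm_mul_inv_rayDist_sq_le hg0 hz)
    have h1 : ∀ i j, Tendsto (fun k => (canonicalIter A (k + 1)).1 z i j) (Filter.hyperfilter ℕ)
        (𝓝 (T z i j)) := by
      intro i j
      have h0 : Tendsto (fun k => ((canonicalIter A (k + 1)).1 z - (canonicalIter A k).1 z) i j)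
          atTop (𝓝 0) := squeeze_zero_norm (fun k => (norm_entry_le_frob _ i j).trans
            (le_add_of_nonneg_right (frob_nonneg _))) ht
      have := (h0.mono_left Nat.hyperfilter_le_atTop).add (hTlim z hzc i j)
      simpa using this
    have h2 : ∀ i j, Tendsto (fun k => (canonicalIter A (k + 1)).2 z i j) (Filter.hyperfilter ℕ)
        (𝓝 (T' z i j)) := by
      intro i j
      have h0 : Tendsto (fun k => ((canonicalIter A (k + 1)).2 z - (canonicalIter A k).2 z) i j)
          atTop (𝓝 0) := squeeze_zero_norm (fun k => (norm_entry_le_frob _ i j).trans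
            (le_add_of_nonneg_left (frob_nonneg _))) ht
      have := (h0.mono_left Nat.hyperfilter_le_atTop).add (hTlim' z hzc i j)
      simpa using this
    constructor
    · ext i j
      refine tendsto_nhds_unique (tendsto_mul_one_add_kraus A h1 (hTlim' z hzc) i j) ?_
      simp only [(canonicalIter_succ A _ hzc).1]
      exact tendsto_const_nhds
    · ext i j
      refine tendsto_nhds_unique
        (tendsto_mul_one_add_kraus (fun a => (A a)ᴴ) h2 (hTlim z hzc) i j) ?_
      simp only [(canonicalIter_succ A _ hzc).2]
      exact tendsto_const_nhds
  have hconst : ∀ c : ℂ, DifferentiableOn ℂ (fun z => (-1 / z) * c) cutPlane := fun c z hz =>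
    (((differentiableAt_const _).div differentiableAt_id
      (ne_zero_of_mem_cutPlane hz)).mul_const c).differentiableWithinAt
  refine ⟨T, T', hT, hT', fun z hz => ⟨?_, ?_⟩, fun z hz => ⟨?_, ?_⟩⟩
  · exact norm_le_of_tendsto_entry (hTlim z hz) (inv_nonneg.2 (rayDist_pos hz).le)
      fun k => (hb k).1.norm_le hz
  · exact norm_le_of_tendsto_entry (hTlim' z hz) (inv_nonneg.2 (rayDist_pos hz).le)
      fun k => (hb k).2.norm_le hz
  · ext i j
    exact eqOn_cutPlane (differentiableOn_mul_one_add_kraus A hT.differentiableOn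
      hT'.differentiableOn i j) (hconst ((1 : Matrix I I ℂ) i j)) (by linarith)
      (fun w hw => congrFun (congrFun (hball w hw).1 i) j) hz
  · ext i j
    exact eqOn_cutPlane (differentiableOn_mul_one_add_kraus (fun a => (A a)ᴴ) hT'.differentiableOn
      hT.differentiableOn i j) (hconst ((1 : Matrix J J ℂ) i j)) (by linarith)
      (fun w hw => congrFun (congrFun (hball w hw).2 i) j) hz

lemma IsStieltjes.exists_norm_le {S : ℂ → Matrix I I ℂ} (hS : IsStieltjes S) :
    ∃ C : ℝ, 0 ≤ C ∧ ∀ z ∈ cutPlane, ‖S z‖ ≤ C * (rayDist z)⁻¹ := by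
  obtain ⟨C, hC0, hC⟩ := hS.exists_norm_entry_le
  refine ⟨Fintype.card I * C, by positivity, fun z hz => (norm_le_frob _).trans ?_⟩
  have := (rayDist_pos hz).le
  refine abs_le_of_sq_le_sq' ?_ (by positivity) |>.2
  rw [frob_sq]
  calc ∑ i, ∑ j, ‖S z i j‖ ^ 2 ≤ ∑ _i : I, ∑ _j : I, (C * (rayDist z)⁻¹) ^ 2 := by
        gcongr with i _ j _
        exact hC z hz i j
    _ = _ := by simp; ring

/-- A general member of the class is only known to satisfy `‖S z‖ ≤ C (rayDist z)⁻¹`. Enlarging the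
coupling constant to `C² g` still makes the map a contraction far enough to the left, and equality
there propagates by the identity theorem. -/
theorem IsSolutionAt.eqOn {A : κ → Matrix I J ℂ} {T U : ℂ → Matrix I I ℂ}
    {T' U' : ℂ → Matrix J J ℂ} (hT : IsStieltjes T) (hT' : IsStieltjes T') (hU : IsStieltjes U)
    (hU' : IsStieltjes U') (h : ∀ z ∈ cutPlane, IsSolutionAt A z (T z) (T' z))
    (hu : ∀ z ∈ cutPlane, IsSolutionAt A z (U z) (U' z)) :
    Set.EqOn U T cutPlane ∧ Set.EqOn U' T' cutPlane := by
  obtain ⟨g, hg0, hg, hg'⟩ := exists_frob_kraus_le A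
  obtain ⟨C1, hC1, h1⟩ := hT.exists_norm_le
  obtain ⟨C2, hC2, h2⟩ := hT'.exists_norm_le
  obtain ⟨C3, hC3, h3⟩ := hU.exists_norm_le
  obtain ⟨C4, hC4, h4⟩ := hU'.exists_norm_le
  set C := C1 + C2 + C3 + C4
  set K := C ^ 2 * g with hK
  have hK0 : 0 ≤ K := by positivity
  have hball : ∀ z ∈ Metric.ball (-((4 * K + 5 : ℝ)) : ℂ) 1, U z = T z ∧ U' z = T' z := by
    intro z hz
    have hzc := ball_neg_subset_cutPlane (by linarith) hz
    have hr : 0 ≤ (rayDist z)⁻¹ := inv_nonneg.2 (rayDist_pos hzc).le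
    have hs := norm_mul_inv_rayDist_sq_le hK0 hz
    have hle := (h z hzc).frob_le (ne_zero_of_mem_cutPlane hzc) (Δ := 0) (Δ' := 0)
      (by rw [add_zero]; exact (hu z hzc).1) (by rw [add_zero]; exact (hu z hzc).2) hg hg'
      (s := C * (rayDist z)⁻¹) (r := C * (rayDist z)⁻¹)
      ((h3 z hzc).trans (by gcongr; linarith)) ((h4 z hzc).trans (by gcongr; linarith))
      ((h1 z hzc).trans (by gcongr; linarith)) ((h2 z hzc).trans (by gcongr; linarith))
      (by rw [hK] at hs; linarith)
    have f0 : ∀ {n : Type} [Fintype n], frob (0 : Matrix n n ℂ) = 0 := by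
      intro n _
      simp [frob, ← Pi.zero_def]
    rw [f0, f0, add_zero, mul_zero] at hle
    have k1 := frob_nonneg (U z - T z)
    have k2 := frob_nonneg (U' z - T' z)
    exact ⟨sub_eq_zero.1 (eq_zero_of_frob_eq_zero (by linarith)),
      sub_eq_zero.1 (eq_zero_of_frob_eq_zero (by linarith))⟩
  constructor
  · intro z hz
    ext i j
    exact eqOn_cutPlane (hU.differentiableOn i j) (hT.differentiableOn i j) (by linarith)
      (fun w hw => congrFun (congrFun (hball w hw).1 i) j) hz
  · intro z hz
    ext i j
    exact eqOn_cutPlane (hU'.differentiableOn i j) (hT'.differentiableOn i j) (by linarith)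
      (fun w hw => congrFun (congrFun (hball w hw).2 i) j) hz

end Corner

end

section



/-! ### Gaussian measures: moments, Poincaré type inequality, integration by parts -/

lemma sq_integral_le {α : Type*} [MeasurableSpace α] {ν : Measure α} [IsFiniteMeasure ν]
    {f : α → ℝ} (hf : Integrable f ν) (hf2 : Integrable (fun x => f x ^ 2) ν) :
    (∫ x, f x ∂ν) ^ 2 ≤ ν.real Set.univ * ∫ x, f x ^ 2 ∂ν := by
  set T := ν.real Set.univ with hT
  set a := ∫ x, f x ∂ν with ha
  rcases (measureReal_nonneg : 0 ≤ T).eq_or_lt with h0 | h0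
  · have : ν = 0 := by
      rwa [eq_comm, measureReal_eq_zero_iff, Measure.measure_univ_eq_zero] at h0
    simp [ha, this]
  · have h : 0 ≤ ∫ x, (T * f x - a) ^ 2 ∂ν := integral_nonneg fun x => sq_nonneg _
    have h1 : ∫ x, (T * f x - a) ^ 2 ∂ν = T * (T * (∫ x, f x ^ 2 ∂ν) - a ^ 2) := by
      have : ∀ x, (T * f x - a) ^ 2 = T ^ 2 * f x ^ 2 - 2 * T * a * f x + a ^ 2 := fun x => by ring
      simp_rw [this]
      have hi : Integrable (fun x => T ^ 2 * f x ^ 2 - 2 * T * a * f x) ν :=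
        (hf2.const_mul _).sub (hf.const_mul _)
      rw [integral_add hi (integrable_const _),
        integral_sub (hf2.const_mul _) (hf.const_mul _), integral_const_mul, integral_const_mul,
        integral_const, ← ha, ← hT, smul_eq_mul]
      ring
    rw [h1] at h
    have := nonneg_of_mul_nonneg_right h h0
    linarith

lemma pow_four_integral_le {α : Type*} [MeasurableSpace α] {ν : Measure α} [IsFiniteMeasure ν]
    {f : α → ℝ} (hf : Integrable f ν) (hf2 : Integrable (fun x => f x ^ 2) ν)
    (hf4 : Integrable (fun x => f x ^ 4) ν) :
    (∫ x, f x ∂ν) ^ 4 ≤ ν.real Set.univ ^ 3 * ∫ x, f x ^ 4 ∂ν := by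
  have h1 := sq_integral_le hf hf2
  have h2 := sq_integral_le hf2 (by simpa only [← pow_mul] using hf4)
  simp only [← pow_mul, Nat.reduceMul] at h2
  have h0 : 0 ≤ ∫ x, f x ^ 2 ∂ν := integral_nonneg fun x => sq_nonneg _
  calc (∫ x, f x ∂ν) ^ 4 = ((∫ x, f x ∂ν) ^ 2) ^ 2 := by ring
    _ ≤ (ν.real Set.univ * ∫ x, f x ^ 2 ∂ν) ^ 2 := by gcongr
    _ = ν.real Set.univ ^ 2 * (∫ x, f x ^ 2 ∂ν) ^ 2 := by ring
    _ ≤ ν.real Set.univ ^ 2 * (ν.real Set.univ * ∫ x, f x ^ 4 ∂ν) := by gcongr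
    _ = _ := by ring

section Gaussian

variable {E : Type*} [NormedAddCommGroup E] [NormedSpace ℝ E] [MeasurableSpace E] [BorelSpace E]
  [CompleteSpace E] [SecondCountableTopology E] {μ : Measure E} [IsGaussian μ]

lemma integrable_norm_pow_of_isGaussian (μ : Measure E) [IsGaussian μ] (k : ℕ) :
    Integrable (fun x => ‖x‖ ^ k) μ :=
  (IsGaussian.memLp_id μ k (by simp)).integrable_norm_pow'

lemma integrable_prod_pow (μ : Measure E) [IsGaussian μ] (k : ℕ) :
    Integrable (fun p : E × E => (‖p.1‖ + ‖p.2‖) ^ k) (μ.prod μ) := by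
  refine ((integrable_norm_pow_of_isGaussian (μ.prod μ) k).const_mul (2 ^ k)).mono'
    (by fun_prop) (ae_of_all _ fun p => ?_)
  rw [Real.norm_of_nonneg (by positivity), ← mul_pow]
  have h1 : ‖p.1‖ ≤ ‖p‖ := norm_fst_le p
  have h2 : ‖p.2‖ ≤ ‖p‖ := norm_snd_le p
  gcongr
  linarith

/-- Rotation invariance of the law of two independent centred Gaussian copies; the fourth moment,
the Poincaré inequality and the integration by parts below all rest on it. -/
lemma integral_rotation {F : Type*} [NormedAddCommGroup F] [NormedSpace ℝ F]
    [SecondCountableTopology F] (hμ : μ[id] = 0) {f : E × E → F} (hf : Continuous f)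
    (θ : ℝ) :
    ∫ p, f (Real.cos θ • p.1 + Real.sin θ • p.2, -Real.sin θ • p.1 + Real.cos θ • p.2) ∂μ.prod μ =
      ∫ p, f p ∂μ.prod μ := by
  conv_rhs => rw [← IsGaussian.map_rotation_eq_self hμ θ]
  rw [integral_map (by fun_prop) hf.aestronglyMeasurable]
  rfl

/-- Rotate by `π/4`: with `m₂`, `m₄` the moments, expanding `((L x + L y)/√2)⁴` gives `m₄ = m₄/2 +
(3/2) m₂²`, the odd terms vanishing by centring. -/
lemma integral_dual_pow_four (hμ : μ[id] = 0) (L : E →L[ℝ] ℝ) :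
    ∫ x, L x ^ 4 ∂μ = 3 * (∫ x, L x ^ 2 ∂μ) ^ 2 := by
  have hint : ∀ k : ℕ, Integrable (fun x => L x ^ k) μ := by
    intro k
    refine ((integrable_norm_pow_of_isGaussian μ k).const_mul (‖L‖ ^ k)).mono'
      (by fun_prop) (ae_of_all _ fun x => ?_)
    rw [norm_pow, ← mul_pow]
    gcongr
    exact L.le_opNorm x
  have h1 : ∫ x, L x ^ 1 ∂μ = 0 := by
    simp only [pow_one]
    rw [IsGaussian.integral_dual]
    simp only [id_eq] at hμ
    rw [hμ, map_zero]
  have hprod : ∀ a b : ℕ, Integrable (fun p : E × E => L p.1 ^ a * L p.2 ^ b) (μ.prod μ) :=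
    fun a b => (hint a).mul_prod (hint b)
  have hval : ∀ a b : ℕ, ∫ p : E × E, L p.1 ^ a * L p.2 ^ b ∂μ.prod μ =
      (∫ x, L x ^ a ∂μ) * ∫ x, L x ^ b ∂μ := fun a b =>
    integral_prod_mul (fun x => L x ^ a) fun x => L x ^ b
  have h := integral_rotation (F := ℝ) hμ (f := fun p : E × E => L p.1 ^ 4 * L p.2 ^ 0)
    (by fun_prop) (Real.pi / 4)
  have hc : Real.cos (Real.pi / 4) ^ 4 = 1 / 4 := by
    rw [Real.cos_pi_div_four, div_pow, show (4 : ℕ) = 2 * 2 from rfl, pow_mul,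
      Real.sq_sqrt (by norm_num)]
    norm_num
  have hexp : ∀ p : E × E, L (Real.cos (Real.pi / 4) • p.1 + Real.sin (Real.pi / 4) • p.2) ^ 4 *
      L (-Real.sin (Real.pi / 4) • p.1 + Real.cos (Real.pi / 4) • p.2) ^ 0 =
      1 / 4 * (L p.1 ^ 4 * L p.2 ^ 0) + (L p.1 ^ 3 * L p.2 ^ 1) +
        3 / 2 * (L p.1 ^ 2 * L p.2 ^ 2) + (L p.1 ^ 1 * L p.2 ^ 3) +
        1 / 4 * (L p.1 ^ 0 * L p.2 ^ 4) := by
    intro p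
    rw [Real.sin_pi_div_four, ← Real.cos_pi_div_four, ← smul_add, map_smul, map_add, smul_eq_mul,
      mul_pow, hc]
    ring
  simp_rw [hexp] at h
  rw [integral_add, integral_add, integral_add, integral_add, integral_const_mul,
    integral_const_mul, integral_const_mul, hval, hval, hval, hval, hval, h1] at h
  · simp only [pow_zero, integral_const, probReal_univ, smul_eq_mul, mul_one, one_mul, mul_zero,
      zero_mul, add_zero] at h
    linarith
  all_goals
    first
    | exact hprod _ _
    | exact (hprod _ _).const_mul _
    | skip
  · exact ((hprod _ _).const_mul _).add (hprod _ _)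
  · exact (((hprod _ _).const_mul _).add (hprod _ _)).add ((hprod _ _).const_mul _)
  · exact ((((hprod _ _).const_mul _).add (hprod _ _)).add ((hprod _ _).const_mul _)).add
      (hprod _ _)

lemma integrable_norm_clm_pow (L : E →L[ℝ] ℂ) (k : ℕ) : Integrable (fun x => ‖L x‖ ^ k) μ := by
  refine ((integrable_norm_pow_of_isGaussian μ k).const_mul (‖L‖ ^ k)).mono'
    (by fun_prop) (ae_of_all _ fun x => ?_)
  rw [norm_pow, norm_norm, ← mul_pow]
  gcongr
  exact L.le_opNorm x

lemma integral_norm_pow_four_le (hμ : μ[id] = 0) (L : E →L[ℝ] ℂ) :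
    ∫ x, ‖L x‖ ^ 4 ∂μ ≤ 6 * (∫ x, ‖L x‖ ^ 2 ∂μ) ^ 2 := by
  set R := Complex.reCLM.comp L with hR
  set S := Complex.imCLM.comp L with hS
  have hint : ∀ (L : E →L[ℝ] ℝ) (k : ℕ), Integrable (fun x => L x ^ k) μ := by
    intro L k
    refine ((integrable_norm_pow_of_isGaussian μ k).const_mul (‖L‖ ^ k)).mono'
      (by fun_prop) (ae_of_all _ fun x => ?_)
    rw [norm_pow, ← mul_pow]
    gcongr
    exact L.le_opNorm x
  have hsq : ∀ x, ‖L x‖ ^ 2 = R x ^ 2 + S x ^ 2 := by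
    intro x
    rw [← Complex.normSq_eq_norm_sq, Complex.normSq_apply]
    simp [hR, hS, sq]
  have h4 : ∀ x, ‖L x‖ ^ 4 ≤ 2 * R x ^ 4 + 2 * S x ^ 4 := by
    intro x
    have : ‖L x‖ ^ 4 = (‖L x‖ ^ 2) ^ 2 := by ring
    rw [this, hsq]
    nlinarith [sq_nonneg (R x ^ 2 - S x ^ 2)]
  calc ∫ x, ‖L x‖ ^ 4 ∂μ ≤ ∫ x, (2 * R x ^ 4 + 2 * S x ^ 4) ∂μ :=
        integral_mono (integrable_norm_clm_pow L 4)
          (((hint R 4).const_mul 2).add ((hint S 4).const_mul 2)) h4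
    _ = 6 * ((∫ x, R x ^ 2 ∂μ) ^ 2 + (∫ x, S x ^ 2 ∂μ) ^ 2) := by
        rw [integral_add ((hint R 4).const_mul 2) ((hint S 4).const_mul 2), integral_const_mul,
          integral_const_mul, integral_dual_pow_four hμ, integral_dual_pow_four hμ]
        ring
    _ ≤ 6 * (∫ x, R x ^ 2 ∂μ + ∫ x, S x ^ 2 ∂μ) ^ 2 := by
        have h1 : 0 ≤ ∫ x, R x ^ 2 ∂μ := integral_nonneg fun x => sq_nonneg _
        have h2 : 0 ≤ ∫ x, S x ^ 2 ∂μ := integral_nonneg fun x => sq_nonneg _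
        nlinarith [mul_nonneg h1 h2]
    _ = _ := by
        simp_rw [hsq]
        rw [integral_add (hint R 2) (hint S 2)]

/-- `f` is bounded, and differentiable along all curves `cos θ x + sin θ y`, with derivative `f'`
of linear growth. -/
structure HasCircularDeriv {E : Type*} [NormedAddCommGroup E] [NormedSpace ℝ E] (f : E → ℂ)
    (f' : E → E → ℂ) (C : ℝ) : Prop where
  cont : Continuous f
  cont' : Continuous fun p : E × E => f' p.1 p.2
  deriv : ∀ x y (θ : ℝ), HasDerivAt (fun θ : ℝ => f (Real.cos θ • x + Real.sin θ • y))
    (f' (Real.cos θ • x + Real.sin θ • y) (-Real.sin θ • x + Real.cos θ • y)) θ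
  bound : ∀ x, ‖f x‖ ≤ C
  bound' : ∀ x y, ‖f' x y‖ ≤ C * ‖y‖

lemma norm_cos_smul_add_le (θ : ℝ) (x y : E) : ‖Real.cos θ • x + Real.sin θ • y‖ ≤ ‖x‖ + ‖y‖ := by
  refine (norm_add_le _ _).trans (add_le_add ?_ ?_) <;> rw [norm_smul]
  · exact mul_le_of_le_one_left (norm_nonneg _) (Real.abs_cos_le_one _)
  · exact mul_le_of_le_one_left (norm_nonneg _) (Real.abs_sin_le_one _)

lemma norm_neg_sin_smul_add_le (θ : ℝ) (x y : E) :
    ‖-Real.sin θ • x + Real.cos θ • y‖ ≤ ‖x‖ + ‖y‖ := by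
  refine (norm_add_le _ _).trans (add_le_add ?_ ?_) <;> rw [norm_smul]
  · rw [norm_neg]
    exact mul_le_of_le_one_left (norm_nonneg _) (Real.abs_sin_le_one _)
  · exact mul_le_of_le_one_left (norm_nonneg _) (Real.abs_cos_le_one _)

/-- The fundamental theorem of calculus along the quarter circle from `x` to `y`, followed by Hölder
on an interval of length `π/2`. -/
lemma HasCircularDeriv.norm_sub_pow_four_le {f : E → ℂ} {f' : E → E → ℂ} {C : ℝ}
    (hf : HasCircularDeriv f f' C) (x y : E) :
    ‖f x - f y‖ ^ 4 ≤ (Real.pi / 2) ^ 3 * ∫ θ in (0 : ℝ)..(Real.pi / 2),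
      ‖f' (Real.cos θ • x + Real.sin θ • y) (-Real.sin θ • x + Real.cos θ • y)‖ ^ 4 := by
  set g : ℝ → ℂ := fun θ =>
    f' (Real.cos θ • x + Real.sin θ • y) (-Real.sin θ • x + Real.cos θ • y) with hg
  have hgc : Continuous g := hf.cont'.comp (f := fun θ : ℝ =>
    ((Real.cos θ • x + Real.sin θ • y, -Real.sin θ • x + Real.cos θ • y) : E × E)) (by fun_prop)
  have hpi : (0 : ℝ) ≤ Real.pi / 2 := by positivity
  have h1 := intervalIntegral.integral_eq_sub_of_hasDerivAt (fun θ _ => hf.deriv x y θ)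
    (hgc.intervalIntegrable 0 (Real.pi / 2))
  simp only [Real.cos_pi_div_two, Real.sin_pi_div_two, Real.cos_zero, Real.sin_zero, zero_smul,
    one_smul, zero_add, add_zero] at h1
  have h2 : ‖f x - f y‖ ≤ ∫ θ in (0 : ℝ)..(Real.pi / 2), ‖g θ‖ := by
    rw [norm_sub_rev, ← h1]
    exact intervalIntegral.norm_integral_le_integral_norm hpi
  have h3 := pow_four_integral_le (ν := volume.restrict (Set.Ioc 0 (Real.pi / 2)))
    (f := fun θ => ‖g θ‖) (hgc.norm.integrableOn_Ioc) ((hgc.norm.pow 2).integrableOn_Ioc)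
    ((hgc.norm.pow 4).integrableOn_Ioc)
  rw [measureReal_restrict_apply_univ, Real.volume_real_Ioc_of_le hpi, sub_zero] at h3
  rw [intervalIntegral.integral_of_le hpi] at h2 ⊢
  exact (pow_le_pow_left₀ (norm_nonneg _) h2 4).trans h3

/-- The rotation argument of Maurey and Pisier: Jensen replaces the mean by an independent copy, the
quarter circle joins the two copies, and at each angle the position and the velocity are again an
independent pair with the original law. -/
theorem HasCircularDeriv.integral_norm_sub_integral_pow_four_le (hμ : μ[id] = 0) {f : E → ℂ}
    {f' : E → E → ℂ} {C : ℝ} (hf : HasCircularDeriv f f' C) :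
    ∫ x, ‖f x - ∫ y, f y ∂μ‖ ^ 4 ∂μ ≤
      (Real.pi / 2) ^ 4 * ∫ p : E × E, ‖f' p.1 p.2‖ ^ 4 ∂μ.prod μ := by
  have hpi : (0 : ℝ) ≤ Real.pi / 2 := by positivity
  have hfc := hf.cont
  have hfc' := hf.cont'
  have hfint : Integrable f μ := (integrable_const C).mono' hfc.aestronglyMeasurable
    (ae_of_all _ hf.bound)
  have hC : 0 ≤ C := (norm_nonneg _).trans (hf.bound 0)
  have hbd : ∀ x y, ‖f x - f y‖ ≤ 2 * C := fun x y =>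
    (norm_sub_le _ _).trans (by linarith [hf.bound x, hf.bound y])
  have hint : ∀ k : ℕ, Integrable (fun p : E × E => ‖f p.1 - f p.2‖ ^ k) (μ.prod μ) := fun k =>
    (integrable_const ((2 * C) ^ k)).mono' (by fun_prop) (ae_of_all _ fun p => by
      rw [norm_pow, norm_norm]
      exact pow_le_pow_left₀ (norm_nonneg _) (hbd _ _) k)
  have hint' : ∀ x (k : ℕ), Integrable (fun y => ‖f x - f y‖ ^ k) μ := fun x k =>
    (integrable_const ((2 * C) ^ k)).mono' (by fun_prop) (ae_of_all _ fun p => by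
      rw [norm_pow, norm_norm]
      exact pow_le_pow_left₀ (norm_nonneg _) (hbd _ _) k)
  -- first step: symmetrization
  have h1 : ∫ x, ‖f x - ∫ y, f y ∂μ‖ ^ 4 ∂μ ≤ ∫ p : E × E, ‖f p.1 - f p.2‖ ^ 4 ∂μ.prod μ := by
    rw [integral_prod _ (hint 4)]
    have hpt : ∀ x, ‖f x - ∫ y, f y ∂μ‖ ^ 4 ≤ ∫ y, ‖f x - f y‖ ^ 4 ∂μ := by
      intro x
      have h2 : f x - ∫ y, f y ∂μ = ∫ y, (f x - f y) ∂μ := by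
        rw [integral_sub (integrable_const _) hfint]
        simp
      have h3 : ‖f x - ∫ y, f y ∂μ‖ ≤ ∫ y, ‖f x - f y‖ ∂μ := by
        rw [h2]
        exact norm_integral_le_integral_norm _
      have h4 := pow_four_integral_le (by simpa using hint' x 1) (hint' x 2) (hint' x 4)
      rw [probReal_univ, one_pow, one_mul] at h4
      exact (pow_le_pow_left₀ (norm_nonneg _) h3 4).trans h4
    refine integral_mono_of_nonneg (ae_of_all _ fun x => by positivity) ?_ (ae_of_all _ hpt)
    exact (hint 4).integral_prod_left
  refine h1.trans ?_
  -- second step: integration along the rotations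
  set G : E × E → ℝ → ℝ := fun p θ =>
    ‖f' (Real.cos θ • p.1 + Real.sin θ • p.2) (-Real.sin θ • p.1 + Real.cos θ • p.2)‖ ^ 4 with hG
  have hGc : Continuous (Function.uncurry G) :=
    ((hfc'.comp (f := fun q : (E × E) × ℝ => ((Real.cos q.2 • q.1.1 + Real.sin q.2 • q.1.2,
      -Real.sin q.2 • q.1.1 + Real.cos q.2 • q.1.2) : E × E)) (by fun_prop)).norm).pow 4
  have hGint : Integrable (Function.uncurry G)
      ((μ.prod μ).prod (volume.restrict (Set.Ioc 0 (Real.pi / 2)))) := by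
    have hb : Integrable (fun q : (E × E) × ℝ => C ^ 4 * (‖q.1.1‖ + ‖q.1.2‖) ^ 4)
        ((μ.prod μ).prod (volume.restrict (Set.Ioc 0 (Real.pi / 2)))) :=
      (((integrable_prod_pow μ 4).const_mul (C ^ 4))).comp_fst _
    refine hb.mono' hGc.aestronglyMeasurable (ae_of_all _ fun q => ?_)
    simp only [Function.uncurry, hG]
    rw [norm_pow, norm_norm, ← mul_pow]
    refine pow_le_pow_left₀ (norm_nonneg _) ((hf.bound' _ _).trans ?_) 4
    gcongr
    exact norm_neg_sin_smul_add_le _ _ _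
  calc ∫ p : E × E, ‖f p.1 - f p.2‖ ^ 4 ∂μ.prod μ
      ≤ ∫ p : E × E, ((Real.pi / 2) ^ 3 * ∫ θ in Set.Ioc 0 (Real.pi / 2), G p θ) ∂μ.prod μ := by
        refine integral_mono (hint 4) (hGint.integral_prod_left.const_mul _) fun p => ?_
        have := hf.norm_sub_pow_four_le p.1 p.2
        rwa [intervalIntegral.integral_of_le hpi] at this
    _ = (Real.pi / 2) ^ 3 * ∫ θ in Set.Ioc 0 (Real.pi / 2), ∫ p, G p θ ∂μ.prod μ := by
        rw [integral_const_mul, integral_integral_swap hGint]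
    _ = (Real.pi / 2) ^ 3 * ∫ _θ in Set.Ioc 0 (Real.pi / 2),
          ∫ p : E × E, ‖f' p.1 p.2‖ ^ 4 ∂μ.prod μ := by
        congr 1
        refine integral_congr_ae (ae_of_all _ fun θ => ?_)
        exact integral_rotation hμ (f := fun p : E × E => ‖f' p.1 p.2‖ ^ 4) (by fun_prop) θ
    _ = _ := by
        rw [integral_const, measureReal_restrict_apply_univ, Real.volume_real_Ioc_of_le hpi,
          sub_zero, smul_eq_mul]
        ring

/-- Gaussian integration by parts. -/
theorem HasCircularDeriv.integral_clm_mul (hμ : μ[id] = 0) {f : E → ℂ} {f' : E → E → ℂ} {C : ℝ}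
    (hf : HasCircularDeriv f f' C) (L : E →L[ℝ] ℂ) :
    ∫ x, L x * f x ∂μ = ∫ p : E × E, L p.2 * f' p.1 p.2 ∂μ.prod μ := by
  have hfc := hf.cont
  have hfc' := hf.cont'
  have hC : 0 ≤ C := (norm_nonneg _).trans (hf.bound 0)
  -- By rotation invariance `∫ F θ` does not depend on `θ`. Its derivative at `θ = 0`, the integral
  -- of `L(y) f'(x, y) - L(x) f(x)`, therefore vanishes, which is the formula.
  set F : ℝ → E × E → ℂ := fun θ p => L (-Real.sin θ • p.1 + Real.cos θ • p.2) *
    f (Real.cos θ • p.1 + Real.sin θ • p.2) with hF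
  set F' : ℝ → E × E → ℂ := fun θ p => L (-Real.cos θ • p.1 + -Real.sin θ • p.2) *
    f (Real.cos θ • p.1 + Real.sin θ • p.2) + L (-Real.sin θ • p.1 + Real.cos θ • p.2) *
    f' (Real.cos θ • p.1 + Real.sin θ • p.2) (-Real.sin θ • p.1 + Real.cos θ • p.2) with hF'
  have hconst : ∀ θ, ∫ p, F θ p ∂μ.prod μ = ∫ p : E × E, L p.2 * f p.1 ∂μ.prod μ := fun θ =>
    integral_rotation hμ (f := fun p : E × E => L p.2 * f p.1) (by fun_prop) θ
  have hdiff : ∀ (p : E × E) θ, HasDerivAt (F · p) (F' θ p) θ := by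
    intro p θ
    have h1 : HasDerivAt (fun θ : ℝ => -Real.sin θ • p.1 + Real.cos θ • p.2)
        (-Real.cos θ • p.1 + -Real.sin θ • p.2) θ :=
      ((Real.hasDerivAt_sin θ).neg.smul_const _).add ((Real.hasDerivAt_cos θ).smul_const _)
    exact (L.hasFDerivAt.comp_hasDerivAt θ h1).mul (hf.deriv p.1 p.2 θ)
  have hFc : ∀ θ, Continuous (F θ) := fun θ => by simp only [hF]; fun_prop
  have hFc' : Continuous (F' 0) := by
    simp only [hF', Real.cos_zero, Real.sin_zero]
    have : Continuous fun p : E × E => f' ((1 : ℝ) • p.1 + (0 : ℝ) • p.2)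
        (-(0 : ℝ) • p.1 + (1 : ℝ) • p.2) := hfc'.comp (f := fun p : E × E =>
          (((1 : ℝ) • p.1 + (0 : ℝ) • p.2, -(0 : ℝ) • p.1 + (1 : ℝ) • p.2) : E × E)) (by fun_prop)
    fun_prop
  have hFint : ∀ θ, Integrable (F θ) (μ.prod μ) := by
    intro θ
    refine ((integrable_prod_pow μ 1).const_mul (‖L‖ * C)).mono' (hFc θ).aestronglyMeasurable
      (ae_of_all _ fun p => ?_)
    rw [norm_mul, pow_one]
    calc _ ≤ (‖L‖ * (‖p.1‖ + ‖p.2‖)) * C := by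
          gcongr
          · exact (L.le_opNorm _).trans (by gcongr; exact norm_neg_sin_smul_add_le _ _ _)
          · exact hf.bound _
      _ = _ := by ring
  have hbound : ∀ (p : E × E) θ, ‖F' θ p‖ ≤
      ‖L‖ * C * (‖p.1‖ + ‖p.2‖) ^ 1 + ‖L‖ * C * (‖p.1‖ + ‖p.2‖) ^ 2 := by
    intro p θ
    refine (norm_add_le _ _).trans (add_le_add ?_ ?_)
    · rw [norm_mul, pow_one]
      calc _ ≤ (‖L‖ * (‖p.1‖ + ‖p.2‖)) * C := by
            gcongr
            · refine (L.le_opNorm _).trans ?_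
              gcongr
              have := norm_cos_smul_add_le θ p.1 p.2
              rw [← norm_neg, neg_add, ← neg_smul, ← neg_smul] at this
              exact this
            · exact hf.bound _
        _ = _ := by ring
    · rw [norm_mul]
      calc _ ≤ (‖L‖ * (‖p.1‖ + ‖p.2‖)) * (C * (‖p.1‖ + ‖p.2‖)) := by
            gcongr
            · exact (L.le_opNorm _).trans (by gcongr; exact norm_neg_sin_smul_add_le _ _ _)
            · exact (hf.bound' _ _).trans (by gcongr; exact norm_neg_sin_smul_add_le _ _ _)
        _ = _ := by ring
  obtain ⟨hint, hd⟩ := hasDerivAt_integral_of_dominated_loc_of_deriv_le (x₀ := (0 : ℝ))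
    (s := Set.univ) (μ := μ.prod μ) Filter.univ_mem
    (Filter.Eventually.of_forall fun θ => (hFc θ).aestronglyMeasurable) (hFint 0)
    hFc'.aestronglyMeasurable (ae_of_all _ fun p θ _ => hbound p θ)
    (((integrable_prod_pow μ 1).const_mul _).add ((integrable_prod_pow μ 2).const_mul _))
    (ae_of_all _ fun p θ _ => hdiff p θ)
  simp_rw [hconst] at hd
  have h0 := hd.unique (hasDerivAt_const _ _)
  have hA : Integrable (fun p : E × E => L p.1 * f p.1) (μ.prod μ) := by
    refine ((integrable_prod_pow μ 1).const_mul (‖L‖ * C)).mono' (by fun_prop)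
      (ae_of_all _ fun p => ?_)
    rw [norm_mul, pow_one]
    calc _ ≤ (‖L‖ * (‖p.1‖ + ‖p.2‖)) * C := by
          gcongr
          · exact (L.le_opNorm _).trans (by gcongr; linarith [norm_nonneg p.2])
          · exact hf.bound _
      _ = _ := by ring
  have hF0 : F' 0 = fun p : E × E => L p.2 * f' p.1 p.2 - L p.1 * f p.1 := by
    funext p
    simp only [hF', Real.cos_zero, Real.sin_zero, neg_zero, zero_smul, one_smul, add_zero, zero_add,
      neg_smul, map_neg]
    ring
  have hB : Integrable (fun p : E × E => L p.2 * f' p.1 p.2) (μ.prod μ) := by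
    have := hint.add hA
    rw [hF0] at this
    refine this.congr (ae_of_all _ fun p => ?_)
    simp
  rw [hF0, integral_sub hB hA, integral_fun_fst (fun x => L x * f x), probReal_univ, one_smul,
    sub_eq_zero] at h0
  exact h0.symm

end Gaussian

end

section



/-! ### The resolvent as a function of the entries -/

/-- The matrix with a given family of entries. -/
def mat {I J : Type*} (x : I × J → ℂ) : Matrix I J ℂ := Matrix.of fun p j => x (p, j)

/-- The directional derivative of `G ↦ res G z` in the direction `Y`. -/
def resDeriv {I J : Type*} [Fintype I] [Fintype J] [DecidableEq I] (G : Matrix I J ℂ) (z : ℂ)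
    (Y : Matrix I J ℂ) : Matrix I I ℂ :=
  -(res G z * (Y * Gᴴ + G * Yᴴ) * res G z)

section Continuity

variable {I J : Type*} [Fintype I] [Fintype J] [DecidableEq I] [DecidableEq J]

lemma continuous_mat : Continuous (mat : (I × J → ℂ) → Matrix I J ℂ) :=
  continuous_matrix fun p j => continuous_apply (p, j)

lemma continuous_res {z : ℂ} (hz : z ∈ cutPlane) :
    Continuous fun G : Matrix I J ℂ => res G z := by
  have h : ∀ G : Matrix I J ℂ, (G * Gᴴ - z • 1).det ≠ 0 := fun G =>
    ((Matrix.isUnit_iff_isUnit_det _).1 (isUnit_mul_conjTranspose_sub G hz)).ne_zero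
  have h2 : (fun G : Matrix I J ℂ => res G z) =
      fun G => (G * Gᴴ - z • 1).det⁻¹ • (G * Gᴴ - z • 1).adjugate := by
    funext G
    rw [res, Matrix.inv_def, Ring.inverse_eq_inv']
  rw [h2]
  have hc : Continuous fun G : Matrix I J ℂ => G * Gᴴ - z • (1 : Matrix I I ℂ) := by fun_prop
  exact (hc.matrix_det.inv₀ h).smul hc.matrix_adjugate

lemma continuous_resDeriv {z : ℂ} (hz : z ∈ cutPlane) :
    Continuous fun p : Matrix I J ℂ × Matrix I J ℂ => resDeriv p.1 z p.2 := by
  have h : Continuous fun p : Matrix I J ℂ × Matrix I J ℂ => res p.1 z :=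
    (continuous_res hz).comp continuous_fst
  unfold resDeriv
  fun_prop

end Continuity

open scoped Matrix.Norms.L2Operator

section Deriv

variable {I J : Type*} [Fintype I] [Fintype J] [DecidableEq I] [DecidableEq J]

lemma hasDerivAt_entry {M : ℝ → Matrix I I ℂ} {M' : Matrix I I ℂ} {θ : ℝ} (h : HasDerivAt M M' θ)
    (i j : I) : HasDerivAt (fun θ => M θ i j) (M' i j) θ :=
  (Matrix.entryLinearMap ℝ ℂ i j).toContinuousLinearMap.hasFDerivAt.comp_hasDerivAt θ h

lemma hasDerivAt_res_circle {z : ℂ} (hz : z ∈ cutPlane) (X Y : Matrix I J ℂ) (θ : ℝ) :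
    HasDerivAt (fun θ : ℝ => res (Real.cos θ • X + Real.sin θ • Y) z)
      (resDeriv (Real.cos θ • X + Real.sin θ • Y) z (-Real.sin θ • X + Real.cos θ • Y)) θ := by
  -- Along the circle `G Gᴴ - z` is a trigonometric polynomial with fixed matrix coefficients; it is
  -- differentiated as such and composed with the derivative of inversion.
  have hexp : ∀ θ : ℝ, (Real.cos θ • X + Real.sin θ • Y) * (Real.cos θ • X + Real.sin θ • Y)ᴴ -
      z • (1 : Matrix I I ℂ) = (Real.cos θ * Real.cos θ) • (X * Xᴴ) +
        (Real.cos θ * Real.sin θ) • (X * Yᴴ + Y * Xᴴ) + (Real.sin θ * Real.sin θ) • (Y * Yᴴ) -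
        z • 1 := by
    intro θ
    simp only [conjTranspose_add, conjTranspose_smul, star_trivial, Matrix.add_mul, Matrix.mul_add,
      Matrix.smul_mul, Matrix.mul_smul, smul_smul, smul_add, mul_comm (Real.sin θ) (Real.cos θ)]
    abel
  have hd : HasDerivAt (fun θ : ℝ => (Real.cos θ • X + Real.sin θ • Y) *
      (Real.cos θ • X + Real.sin θ • Y)ᴴ - z • (1 : Matrix I I ℂ))
      ((-Real.sin θ • X + Real.cos θ • Y) * (Real.cos θ • X + Real.sin θ • Y)ᴴ +
        (Real.cos θ • X + Real.sin θ • Y) * (-Real.sin θ • X + Real.cos θ • Y)ᴴ) θ := by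
    simp_rw [hexp]
    have hc := Real.hasDerivAt_cos θ
    have hs := Real.hasDerivAt_sin θ
    refine (((((hc.mul hc).smul_const (X * Xᴴ)).add ((hc.mul hs).smul_const
      (X * Yᴴ + Y * Xᴴ))).add ((hs.mul hs).smul_const (Y * Yᴴ))).sub_const (z • 1)).congr_deriv ?_
    simp only [conjTranspose_add, conjTranspose_smul, star_trivial, Matrix.add_mul, Matrix.mul_add,
      Matrix.smul_mul, Matrix.mul_smul]
    module
  have hu := isUnit_mul_conjTranspose_sub (Real.cos θ • X + Real.sin θ • Y) hz
  obtain ⟨u, hu⟩ := hu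
  have hi := hasFDerivAt_ringInverse (𝕜 := ℝ) u
  rw [hu] at hi
  have h := hi.comp_hasDerivAt θ hd
  have hinv : ((u⁻¹ : (Matrix I I ℂ)ˣ) : Matrix I I ℂ) =
      res (Real.cos θ • X + Real.sin θ • Y) z := by
    rw [res, ← hu, Matrix.coe_units_inv]
  refine (h.congr_deriv ?_).congr_of_eventuallyEq (Filter.Eventually.of_forall fun t => ?_)
  · rw [hinv]
    simp [resDeriv, ContinuousLinearMap.mulLeftRight_apply]
  · simp only [res, Function.comp_apply, Matrix.nonsing_inv_eq_ringInverse]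

lemma exists_norm_mat_le : ∃ c : ℝ, 0 ≤ c ∧ ∀ y : I × J → ℂ, frob (mat y) ≤ c * ‖y‖ := by
  refine ⟨Fintype.card I * Fintype.card J, by positivity, fun y => ?_⟩
  have h : frob (mat y) ^ 2 ≤ (Fintype.card I * Fintype.card J) * ‖y‖ ^ 2 := by
    rw [frob_sq]
    calc ∑ i, ∑ j, ‖mat y i j‖ ^ 2 ≤ ∑ _i : I, ∑ _j : J, ‖y‖ ^ 2 := by
          gcongr with i _ j _
          exact norm_le_pi_norm y (i, j)
      _ = _ := by simp; ring
  refine abs_le_of_sq_le_sq' ?_ (by positivity) |>.2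
  refine h.trans ?_
  rw [mul_pow]
  gcongr
  have : Fintype.card I * Fintype.card J ≤ (Fintype.card I * Fintype.card J) ^ 2 :=
    Nat.le_self_pow two_ne_zero _
  exact_mod_cast this

lemma mat_circle (a b : ℝ) (x y : I × J → ℂ) : mat (a • x + b • y) = a • mat x + b • mat y := rfl

/-- A bound for `res G z * G` and `Gᴴ * res G z`. -/
def resGrowth (z : ℂ) : ℝ := Real.sqrt ((1 + ‖z‖ * (rayDist z)⁻¹) * (rayDist z)⁻¹)

lemma norm_res_mul_le (G : Matrix I J ℂ) {z : ℂ} (hz : z ∈ cutPlane) :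
    ‖res G z * G‖ ≤ resGrowth z :=
  Real.le_sqrt_of_sq_le (norm_res_mul_sq_le G hz)

lemma norm_conjTranspose_mul_res_le (G : Matrix I J ℂ) {z : ℂ} (hz : z ∈ cutPlane) :
    ‖Gᴴ * res G z‖ ≤ resGrowth z :=
  Real.le_sqrt_of_sq_le (norm_conjTranspose_mul_res_sq_le G hz)

lemma resDeriv_eq (G Y : Matrix I J ℂ) (z : ℂ) :
    resDeriv G z Y = -(res G z * Y * (Gᴴ * res G z) + (res G z * G) * (Yᴴ * res G z)) := by
  rw [resDeriv]
  simp only [Matrix.mul_add, Matrix.add_mul, Matrix.mul_assoc]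

lemma frob_mul_mul_le {I J K L : Type*} [Fintype I] [Fintype J] [Fintype K] [Fintype L]
    [DecidableEq I] [DecidableEq J] [DecidableEq K] [DecidableEq L]
    (A : Matrix I J ℂ) (B : Matrix J K ℂ) (C : Matrix K L ℂ) {a c : ℝ} (ha : ‖A‖ ≤ a)
    (hc : ‖C‖ ≤ c) : frob (A * B * C) ≤ a * frob B * c := by
  have h0 := frob_nonneg B
  have := (norm_nonneg A).trans ha
  exact (frob_mul_le' _ _).trans (mul_le_mul ((frob_mul_le A B).trans (by gcongr)) hc
    (norm_nonneg _) (by positivity))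

lemma frob_neg (A : Matrix I J ℂ) : frob (-A) = frob A := by
  rw [← neg_one_smul ℂ A, frob_smul]
  simp

lemma frob_resDeriv_le (G Y : Matrix I J ℂ) {z : ℂ} (hz : z ∈ cutPlane) :
    frob (resDeriv G z Y) ≤ 2 * ((rayDist z)⁻¹ * resGrowth z) * frob Y := by
  rw [resDeriv_eq, frob_neg]
  refine (frob_add_le _ _).trans ?_
  have h1 := frob_mul_mul_le (res G z) Y (Gᴴ * res G z) (norm_res_le G hz)
    (norm_conjTranspose_mul_res_le G hz)
  have h2 := frob_mul_mul_le (res G z * G) Yᴴ (res G z) (norm_res_mul_le G hz) (norm_res_le G hz)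
  rw [frob_conjTranspose] at h2
  rw [Matrix.mul_assoc] at h2
  linarith

lemma hasCircularDeriv_trace {z : ℂ} (hz : z ∈ cutPlane) (A : Matrix I I ℂ) :
    ∃ C, HasCircularDeriv (fun x : I × J → ℂ => (A * res (mat x) z).trace)
      (fun x y => (A * resDeriv (mat x) z (mat y)).trace) C := by
  obtain ⟨c, hc, hmat⟩ := exists_norm_mat_le (I := I) (J := J)
  have hr : 0 ≤ (rayDist z)⁻¹ := inv_nonneg.2 (rayDist_pos hz).le
  have hg : 0 ≤ resGrowth z := Real.sqrt_nonneg _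
  have hA := frob_nonneg A
  have h1 := (continuous_res (I := I) (J := J) hz).comp continuous_mat
  have h2 := (continuous_resDeriv (I := I) (J := J) hz).comp
    ((continuous_mat.comp continuous_fst).prodMk (continuous_mat.comp continuous_snd))
  refine ⟨frob A * (frob (1 : Matrix I I ℂ) * (rayDist z)⁻¹) +
    frob A * (2 * ((rayDist z)⁻¹ * resGrowth z) * c), ?_, ?_, ?_, ?_, ?_⟩
  · exact (continuous_const.matrix_mul h1).matrix_trace
  · exact (continuous_const.matrix_mul h2).matrix_trace
  · intro x y θ
    have h := hasDerivAt_res_circle hz (mat x) (mat y) θ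
    simp only [mat_circle, Matrix.trace, Matrix.diag, Matrix.mul_apply]
    exact HasDerivAt.fun_sum fun i _ => HasDerivAt.fun_sum fun j _ =>
      (hasDerivAt_entry h j i).const_mul _
  · intro x
    refine (norm_trace_mul_le _ _).trans ?_
    have h3 := frob_mul_le' (1 : Matrix I I ℂ) (res (mat x) z)
    rw [Matrix.one_mul] at h3
    have h4 : frob (res (mat x) z) ≤ frob (1 : Matrix I I ℂ) * (rayDist z)⁻¹ :=
      h3.trans (mul_le_mul_of_nonneg_left (norm_res_le _ hz) (frob_nonneg _))
    have : 0 ≤ frob A * (2 * ((rayDist z)⁻¹ * resGrowth z) * c) := by positivity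
    have := mul_le_mul_of_nonneg_left h4 hA
    linarith
  · intro x y
    refine (norm_trace_mul_le _ _).trans ?_
    have h3 : frob (resDeriv (mat x) z (mat y)) ≤
        2 * ((rayDist z)⁻¹ * resGrowth z) * (c * ‖y‖) :=
      (frob_resDeriv_le _ _ hz).trans (by gcongr; exact hmat y)
    have h4 := mul_le_mul_of_nonneg_left h3 hA
    have h5 : 0 ≤ frob A * (frob (1 : Matrix I I ℂ) * (rayDist z)⁻¹) * ‖y‖ := by
      have := frob_nonneg (1 : Matrix I I ℂ)
      positivity
    linarith

/-- The products `Q G` and `Gᴴ Q G = 1 + z res Gᴴ z` are bounded uniformly in `G`, so `Q G` and its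
derivative satisfy bounds independent of the base point. This is the function fed to the integration
by parts. -/
lemma hasCircularDeriv_res_mul {z : ℂ} (hz : z ∈ cutPlane) (p : I) (j : J) :
    ∃ C, HasCircularDeriv (fun x : I × J → ℂ => (res (mat x) z * mat x) p j)
      (fun x y => (resDeriv (mat x) z (mat y) * mat x + res (mat x) z * mat y) p j) C := by
  obtain ⟨c, hc, hmat⟩ := exists_norm_mat_le (I := I) (J := J)
  have hr : 0 ≤ (rayDist z)⁻¹ := inv_nonneg.2 (rayDist_pos hz).le
  have hg : 0 ≤ resGrowth z := Real.sqrt_nonneg _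
  have h1 := (continuous_res (I := I) (J := J) hz).comp continuous_mat
  have hf : Continuous fun p : (I × J → ℂ) × (I × J → ℂ) => mat p.1 :=
    continuous_mat.comp continuous_fst
  have hs : Continuous fun p : (I × J → ℂ) × (I × J → ℂ) => mat p.2 :=
    continuous_mat.comp continuous_snd
  have h2 := (continuous_resDeriv (I := I) (J := J) hz).comp (hf.prodMk hs)
  have h3 := (continuous_res (I := I) (J := J) hz).comp hf
  refine ⟨resGrowth z + ((rayDist z)⁻¹ * (1 + ‖z‖ * (rayDist z)⁻¹) + resGrowth z * resGrowth z +
    (rayDist z)⁻¹) * c, ?_, ?_, ?_, ?_, ?_⟩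
  · exact (h1.matrix_mul continuous_mat).matrix_elem p j
  · exact ((h2.matrix_mul hf).add (h3.matrix_mul hs)).matrix_elem p j
  · intro x y θ
    have h := hasDerivAt_res_circle hz (mat x) (mat y) θ
    have hw : ∀ k, HasDerivAt (fun θ : ℝ => (Real.cos θ • mat x + Real.sin θ • mat y) k j)
        ((-Real.sin θ • mat x + Real.cos θ • mat y) k j) θ := fun k =>
      ((Real.hasDerivAt_cos θ).smul_const (mat x k j)).add
        ((Real.hasDerivAt_sin θ).smul_const (mat y k j))
    simp only [mat_circle, Matrix.add_apply (_ * _), Matrix.mul_apply, ← Finset.sum_add_distrib]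
    exact HasDerivAt.fun_sum fun k _ => (hasDerivAt_entry h p k).mul (hw k)
  · intro x
    refine ((norm_entry_le _ _ _).trans (norm_res_mul_le _ hz)).trans ?_
    have : 0 ≤ ((rayDist z)⁻¹ * (1 + ‖z‖ * (rayDist z)⁻¹) + resGrowth z * resGrowth z +
      (rayDist z)⁻¹) * c := by positivity
    linarith
  · intro x y
    have hn := (norm_entry_le_frob (resDeriv (mat x) z (mat y) * mat x +
      res (mat x) z * mat y) p j).trans (frob_add_le _ _)
    have e1 : resDeriv (mat x) z (mat y) * mat x =
        -(res (mat x) z * mat y * ((mat x)ᴴ * res (mat x) z * mat x) +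
          (res (mat x) z * mat x) * (mat y)ᴴ * (res (mat x) z * mat x)) := by
      rw [resDeriv_eq]
      simp only [Matrix.neg_mul, Matrix.add_mul, Matrix.mul_assoc]
    rw [e1, frob_neg, conjTranspose_mul_res_mul _ hz] at hn
    have k1 := frob_mul_mul_le (res (mat x) z) (mat y) (1 + z • res (mat x)ᴴ z)
      (norm_res_le _ hz) (norm_one_add_smul_res_le _ hz)
    have k2 := frob_mul_mul_le (res (mat x) z * mat x) (mat y)ᴴ (res (mat x) z * mat x)
      (norm_res_mul_le _ hz) (norm_res_mul_le _ hz)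
    rw [frob_conjTranspose] at k2
    have k3 : frob (res (mat x) z * mat y) ≤ (rayDist z)⁻¹ * frob (mat y) :=
      (frob_mul_le _ _).trans (mul_le_mul_of_nonneg_right (norm_res_le _ hz) (frob_nonneg _))
    have k4 := frob_add_le (res (mat x) z * mat y * (1 + z • res (mat x)ᴴ z))
      (res (mat x) z * mat x * (mat y)ᴴ * (res (mat x) z * mat x))
    have k5 : ‖(resDeriv (mat x) z (mat y) * mat x + res (mat x) z * mat y) p j‖ ≤
        ((rayDist z)⁻¹ * (1 + ‖z‖ * (rayDist z)⁻¹) + resGrowth z * resGrowth z +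
          (rayDist z)⁻¹) * frob (mat y) := by
      rw [e1, conjTranspose_mul_res_mul _ hz]
      linarith
    refine k5.trans ?_
    calc _ ≤ ((rayDist z)⁻¹ * (1 + ‖z‖ * (rayDist z)⁻¹) + resGrowth z * resGrowth z +
          (rayDist z)⁻¹) * (c * ‖y‖) := by gcongr; exact hmat y
      _ ≤ _ := by nlinarith [mul_nonneg hg (norm_nonneg y)]

end Deriv

end

section



/-! ### Resolvents of circular Gaussian matrices -/

/-- `G` is a centred, circularly symmetric, jointly Gaussian random matrix. -/
structure IsCircularGaussian {Ω : Type*} [MeasurableSpace Ω] {I J : Type*} [Fintype I] [Fintype J]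
    (P : Measure Ω) (G : Ω → Matrix I J ℂ) : Prop where
  gaussian : HasGaussianLaw (fun ω (a : I × J) => G ω a.1 a.2) P
  mean : ∀ p j, ∫ ω, G ω p j ∂P = 0
  circular : ∀ p j q k, ∫ ω, G ω p j * G ω q k ∂P = 0

/-- The entrywise expectation of the resolvent. -/
def meanRes {Ω : Type*} [MeasurableSpace Ω] {I J : Type*} [Fintype I] [Fintype J] [DecidableEq I]
    (P : Measure Ω) (G : Ω → Matrix I J ℂ) (z : ℂ) : Matrix I I ℂ :=
  Matrix.of fun p q => ∫ ω, res (G ω) z p q ∂P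

lemma norm_integral_sq_le {α : Type*} [MeasurableSpace α] {ν : Measure α} [IsProbabilityMeasure ν]
    {f : α → ℂ} (hf : Integrable f ν) (hf2 : Integrable (fun x => ‖f x‖ ^ 2) ν) :
    ‖∫ x, f x ∂ν‖ ^ 2 ≤ ∫ x, ‖f x‖ ^ 2 ∂ν := by
  have h := sq_integral_le hf.norm hf2
  rw [probReal_univ, one_mul] at h
  exact (pow_le_pow_left₀ (norm_nonneg _) (norm_integral_le_integral_norm _) 2).trans h

section Linear

variable {E : Type*} [NormedAddCommGroup E] [NormedSpace ℝ E] [MeasurableSpace E] [BorelSpace E]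
  [CompleteSpace E] [SecondCountableTopology E] {μ : Measure E} [IsGaussian μ]

lemma integrable_clm_mul_clm (L L' : E →L[ℝ] ℂ) : Integrable (fun x => L x * L' x) μ := by
  refine ((integrable_norm_pow_of_isGaussian μ 2).const_mul (‖L‖ * ‖L'‖)).mono'
    (by fun_prop) (ae_of_all _ fun x => ?_)
  rw [norm_mul]
  calc _ ≤ (‖L‖ * ‖x‖) * (‖L'‖ * ‖x‖) := by gcongr <;> exact ContinuousLinearMap.le_opNorm _ _
    _ = _ := by ring

lemma HasCircularDeriv.integrable_clm_mul {f : E → ℂ} {f' : E → E → ℂ} {C : ℝ}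
    (hf : HasCircularDeriv f f' C) (L : E →L[ℝ] ℂ) : Integrable (fun x => L x * f x) μ := by
  have hfc := hf.cont
  refine ((integrable_norm_pow_of_isGaussian μ 1).const_mul (‖L‖ * C)).mono' (by fun_prop)
    (ae_of_all _ fun x => ?_)
  have hC : 0 ≤ C := (norm_nonneg _).trans (hf.bound 0)
  rw [norm_mul, pow_one]
  calc _ ≤ (‖L‖ * ‖x‖) * C := by gcongr; exacts [L.le_opNorm _, hf.bound _]
    _ = _ := by ring

lemma HasCircularDeriv.integrable_clm_mul_deriv {f : E → ℂ} {f' : E → E → ℂ} {C : ℝ}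
    (hf : HasCircularDeriv f f' C) (L : E →L[ℝ] ℂ) :
    Integrable (fun p : E × E => L p.2 * f' p.1 p.2) (μ.prod μ) := by
  have hfc := hf.cont'
  refine (((integrable_norm_pow_of_isGaussian μ 2).const_mul (‖L‖ * C)).comp_snd μ).mono'
    (by fun_prop) (ae_of_all _ fun p => ?_)
  rw [norm_mul]
  calc _ ≤ (‖L‖ * ‖p.2‖) * (C * ‖p.2‖) := by gcongr; exacts [L.le_opNorm _, hf.bound' _ _]
    _ = _ := by ring

lemma HasCircularDeriv.integrable_deriv_pow {f : E → ℂ} {f' : E → E → ℂ} {C : ℝ}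
    (hf : HasCircularDeriv f f' C) (k : ℕ) :
    Integrable (fun p : E × E => ‖f' p.1 p.2‖ ^ k) (μ.prod μ) := by
  have hfc := hf.cont'
  refine (((integrable_norm_pow_of_isGaussian μ k).const_mul (C ^ k)).comp_snd μ).mono'
    (by fun_prop) (ae_of_all _ fun p => ?_)
  rw [norm_pow, norm_norm, ← mul_pow]
  gcongr
  exact hf.bound' _ _

end Linear

/-! ### Concentration and integration by parts under the law of the entries. -/

section Law

variable {I J κ : Type*} [Fintype I] [Fintype J] [Fintype κ] [DecidableEq I] [DecidableEq J]

/-- The coordinates, as continuous real linear forms. -/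
def coordCLM (a : I × J) : (I × J → ℂ) →L[ℝ] ℂ := ContinuousLinearMap.proj a

lemma coordCLM_apply (a : I × J) (x : I × J → ℂ) : coordCLM a x = x a := rfl

/-- The conjugate coordinates, as continuous real linear forms. -/
def conjCoordCLM (a : I × J) : (I × J → ℂ) →L[ℝ] ℂ :=
  (Complex.conjCLE : ℂ →L[ℝ] ℂ).comp (coordCLM a)

lemma conjCoordCLM_apply (a : I × J) (x : I × J → ℂ) : conjCoordCLM a x = star (x a) := rfl

/-- `y ↦ tr (B y)` as a continuous real linear form. -/
def traceCLM (B : Matrix J I ℂ) : (I × J → ℂ) →L[ℝ] ℂ :=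
  LinearMap.toContinuousLinearMap
    { toFun := fun y => (B * mat y).trace
      map_add' := fun x y => by
        rw [show mat (x + y) = mat x + mat y from rfl, Matrix.mul_add, Matrix.trace_add]
      map_smul' := fun c x => by
        rw [show mat (c • x) = c • mat x from rfl, Matrix.mul_smul, Matrix.trace_smul]; rfl }

lemma traceCLM_apply (B : Matrix J I ℂ) (y : I × J → ℂ) : traceCLM B y = (B * mat y).trace := rfl

/-- `Y ↦ tr (A (D res(G))[Y])` as a continuous real linear form. -/
def traceResDerivCLM (A : Matrix I I ℂ) (G : Matrix I J ℂ) (z : ℂ) : (I × J → ℂ) →L[ℝ] ℂ :=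
  LinearMap.toContinuousLinearMap
    { toFun := fun y => (A * resDeriv G z (mat y)).trace
      map_add' := fun x y => by
        rw [show mat (x + y) = mat x + mat y from rfl, ← Matrix.trace_add, ← Matrix.mul_add]
        congr 2
        simp only [resDeriv, conjTranspose_add, Matrix.mul_add, Matrix.add_mul]
        abel
      map_smul' := fun c x => by
        rw [show mat (c • x) = c • mat x from rfl]
        simp only [resDeriv, conjTranspose_smul, star_trivial, Matrix.smul_mul, Matrix.mul_smul,
          ← smul_add, ← smul_neg, Matrix.trace_smul]
        rfl }

lemma traceResDerivCLM_apply (A : Matrix I I ℂ) (G : Matrix I J ℂ) (z : ℂ) (y : I × J → ℂ) :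
    traceResDerivCLM A G z y = (A * resDeriv G z (mat y)).trace := rfl

open scoped Matrix.Norms.L2Operator

variable {μ : Measure (I × J → ℂ)} [IsGaussian μ]

/-- By cyclicity the derivative is `-(tr(B₁ Y) + conj tr(B₂ Y))`. The Frobenius norms of `B₁` and
`B₂` are at most a function of `z` times `frob A`, uniformly in `G`, so the covariance bound `v`
applies to each. -/
lemma integral_norm_traceResDeriv_sq_le {v : ℝ}
    (hv : ∀ B : Matrix J I ℂ, ∫ y, ‖(B * mat y).trace‖ ^ 2 ∂μ ≤ v * frob B ^ 2) (hv0 : 0 ≤ v)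
    {z : ℂ} (hz : z ∈ cutPlane) (A : Matrix I I ℂ) (G : Matrix I J ℂ) :
    ∫ y, ‖traceResDerivCLM A G z y‖ ^ 2 ∂μ ≤
      4 * ((rayDist z)⁻¹ * resGrowth z) ^ 2 * v * frob A ^ 2 := by
  set Q := res G z with hQ
  set B₁ : Matrix J I ℂ := Gᴴ * Q * A * Q with hB₁
  set B₂ : Matrix J I ℂ := (Q * A * (Q * G))ᴴ with hB₂
  have hpt : ∀ y, ‖traceResDerivCLM A G z y‖ ^ 2 ≤
      2 * ‖traceCLM B₁ y‖ ^ 2 + 2 * ‖traceCLM B₂ y‖ ^ 2 := by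
    intro y
    have h1 : traceResDerivCLM A G z y = -(traceCLM B₁ y + star (traceCLM B₂ y)) := by
      rw [traceResDerivCLM_apply, traceCLM_apply, traceCLM_apply, resDeriv_eq, ← hQ,
        ← Matrix.trace_conjTranspose, conjTranspose_mul, hB₂, conjTranspose_conjTranspose,
        Matrix.mul_neg, Matrix.trace_neg, Matrix.mul_add, Matrix.trace_add]
      congr 2
      · rw [hB₁, show A * (Q * mat y * (Gᴴ * Q)) = (A * Q * mat y) * (Gᴴ * Q) by
          simp only [Matrix.mul_assoc], Matrix.trace_mul_comm]
        simp only [Matrix.mul_assoc]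
      · rw [show A * (Q * G * ((mat y)ᴴ * Q)) = (A * (Q * G) * (mat y)ᴴ) * Q by
          simp only [Matrix.mul_assoc], Matrix.trace_mul_comm, Matrix.trace_mul_comm (mat y)ᴴ]
        simp only [Matrix.mul_assoc]
    have h2 : ‖traceResDerivCLM A G z y‖ ≤ ‖traceCLM B₁ y‖ + ‖traceCLM B₂ y‖ := by
      rw [h1, norm_neg]
      exact (norm_add_le _ _).trans (by rw [norm_star])
    calc _ ≤ (‖traceCLM B₁ y‖ + ‖traceCLM B₂ y‖) ^ 2 := by gcongr
      _ ≤ _ := by nlinarith [sq_nonneg (‖traceCLM B₁ y‖ - ‖traceCLM B₂ y‖)]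
  have hg : 0 ≤ resGrowth z := Real.sqrt_nonneg _
  have hr : 0 ≤ (rayDist z)⁻¹ := inv_nonneg.2 (rayDist_pos hz).le
  have hA := frob_nonneg A
  have hf1 : frob B₁ ≤ ((rayDist z)⁻¹ * resGrowth z) * frob A := by
    refine (frob_mul_mul_le (Gᴴ * Q) A Q (norm_conjTranspose_mul_res_le G hz)
      (norm_res_le G hz)).trans (le_of_eq (by ring))
  have hf2 : frob B₂ ≤ ((rayDist z)⁻¹ * resGrowth z) * frob A := by
    rw [hB₂, frob_conjTranspose]
    refine (frob_mul_mul_le Q A (Q * G) (norm_res_le G hz) (norm_res_mul_le G hz)).trans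
      (le_of_eq (by ring))
  have hi := fun B : Matrix J I ℂ => integrable_norm_clm_pow (μ := μ) (traceCLM B) 2
  calc ∫ y, ‖traceResDerivCLM A G z y‖ ^ 2 ∂μ
      ≤ ∫ y, (2 * ‖traceCLM B₁ y‖ ^ 2 + 2 * ‖traceCLM B₂ y‖ ^ 2) ∂μ :=
        integral_mono (integrable_norm_clm_pow _ 2) (((hi B₁).const_mul 2).add
          ((hi B₂).const_mul 2)) hpt
    _ = 2 * ∫ y, ‖(B₁ * mat y).trace‖ ^ 2 ∂μ + 2 * ∫ y, ‖(B₂ * mat y).trace‖ ^ 2 ∂μ := by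
        rw [integral_add ((hi B₁).const_mul 2) ((hi B₂).const_mul 2), integral_const_mul,
          integral_const_mul]
        rfl
    _ ≤ 2 * (v * (((rayDist z)⁻¹ * resGrowth z) * frob A) ^ 2) +
          2 * (v * (((rayDist z)⁻¹ * resGrowth z) * frob A) ^ 2) := by
        have k1 := frob_nonneg B₁
        have k2 := frob_nonneg B₂
        gcongr
        · exact (hv B₁).trans (by gcongr)
        · exact (hv B₂).trans (by gcongr)
    _ = _ := by ring

/-- The constant of the concentration inequality. -/
def concConst (z : ℂ) : ℝ :=
  (Real.pi / 2) ^ 4 * (6 * (4 * ((rayDist z)⁻¹ * resGrowth z) ^ 2) ^ 2)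

/-- At a fixed base point the derivative is a Gaussian linear form in the direction, so its fourth
moment is controlled by the square of its second moment; the Poincaré inequality then applies. -/
lemma integral_norm_trace_res_sub_pow_four_le_of_law (hμ : μ[id] = 0) {v : ℝ}
    (hv : ∀ B : Matrix J I ℂ, ∫ y, ‖(B * mat y).trace‖ ^ 2 ∂μ ≤ v * frob B ^ 2) (hv0 : 0 ≤ v)
    {z : ℂ} (hz : z ∈ cutPlane) (A : Matrix I I ℂ) :
    ∫ x, ‖(A * res (mat x) z).trace - ∫ y, (A * res (mat y) z).trace ∂μ‖ ^ 4 ∂μ ≤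
      concConst z * v ^ 2 * frob A ^ 4 := by
  obtain ⟨C, hC⟩ := hasCircularDeriv_trace (I := I) (J := J) hz A
  refine (hC.integral_norm_sub_integral_pow_four_le hμ).trans ?_
  have hA := frob_nonneg A
  have h1 : ∀ x : I × J → ℂ, ∫ y, ‖(A * resDeriv (mat x) z (mat y)).trace‖ ^ 4 ∂μ ≤
      6 * (4 * ((rayDist z)⁻¹ * resGrowth z) ^ 2 * v * frob A ^ 2) ^ 2 := by
    intro x
    refine (integral_norm_pow_four_le hμ (traceResDerivCLM A (mat x) z)).trans ?_
    have h2 : 0 ≤ ∫ y, ‖traceResDerivCLM A (mat x) z y‖ ^ 2 ∂μ :=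
      integral_nonneg fun _ => by positivity
    gcongr
    exact integral_norm_traceResDeriv_sq_le hv hv0 hz A (mat x)
  rw [integral_prod _ (hC.integrable_deriv_pow 4)]
  calc _ ≤ (Real.pi / 2) ^ 4 * ∫ _x : I × J → ℂ,
        6 * (4 * ((rayDist z)⁻¹ * resGrowth z) ^ 2 * v * frob A ^ 2) ^ 2 ∂μ := by
        refine mul_le_mul_of_nonneg_left ?_ (by positivity)
        exact integral_mono (hC.integrable_deriv_pow 4).integral_prod_left (integrable_const _) h1
    _ = _ := by
        rw [integral_const, probReal_univ, one_smul, concConst]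
        ring

lemma mul_mul_apply {I J K L : Type*} [Fintype J] [Fintype K] (A : Matrix I J ℂ) (B : Matrix J K ℂ)
    (C : Matrix K L ℂ) (i : I) (l : L) :
    (A * B * C) i l = ∑ j, ∑ k, A i j * B j k * C k l := by
  simp only [Matrix.mul_apply, Finset.sum_mul]
  exact Finset.sum_comm

lemma integral_conj_mul_mul_apply (K : Matrix I I ℂ) (K' : Matrix J J ℂ) (p q : I) (j : J) :
    ∫ y : I × J → ℂ, star (y (q, j)) * (K * mat y * K') p j ∂μ =
      ∑ p', ∑ j', K p p' * (∫ y : I × J → ℂ, y (p', j') * star (y (q, j)) ∂μ) * K' j' j := by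
  have h1 : ∀ y : I × J → ℂ, star (y (q, j)) * (K * mat y * K') p j =
      ∑ p', ∑ j', (K p p' * K' j' j) * (coordCLM (p', j') y * conjCoordCLM (q, j) y) := by
    intro y
    rw [mul_mul_apply, Finset.mul_sum]
    refine Finset.sum_congr rfl fun p' _ => ?_
    rw [Finset.mul_sum]
    refine Finset.sum_congr rfl fun j' _ => ?_
    rw [coordCLM_apply, conjCoordCLM_apply, show mat y p' j' = y (p', j') from rfl]
    ring
  simp_rw [h1]
  rw [integral_finsetSum _ fun p' _ => integrable_finsetSum _ fun j' _ =>
    (integrable_clm_mul_clm _ _).const_mul _]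
  refine Finset.sum_congr rfl fun p' _ => ?_
  rw [integral_finsetSum _ fun j' _ => (integrable_clm_mul_clm _ _).const_mul _]
  refine Finset.sum_congr rfl fun j' _ => ?_
  rw [integral_const_mul]
  simp only [coordCLM_apply, conjCoordCLM_apply]
  ring

/-- Only products of two conjugated coordinates occur, and these have mean zero by circularity. This
removes the unwanted term of the integration by parts. -/
lemma integral_conj_mul_mul_conjTranspose_apply (hc : ∀ a b, ∫ y : I × J → ℂ, y a * y b ∂μ = 0)
    (K K' : Matrix I J ℂ) (p q : I) (j : J) :
    ∫ y : I × J → ℂ, star (y (q, j)) * (K * (mat y)ᴴ * K') p j ∂μ = 0 := by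
  have h1 : ∀ y : I × J → ℂ, star (y (q, j)) * (K * (mat y)ᴴ * K') p j =
      ∑ j', ∑ p', (K p j' * K' p' j) * (conjCoordCLM (p', j') y * conjCoordCLM (q, j) y) := by
    intro y
    rw [mul_mul_apply, Finset.mul_sum]
    refine Finset.sum_congr rfl fun p' _ => ?_
    rw [Finset.mul_sum]
    refine Finset.sum_congr rfl fun j' _ => ?_
    rw [conjCoordCLM_apply, conjCoordCLM_apply, conjTranspose_apply,
      show mat y j' p' = y (j', p') from rfl]
    ring
  simp_rw [h1]
  rw [integral_finsetSum _ fun p' _ => integrable_finsetSum _ fun j' _ =>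
    (integrable_clm_mul_clm _ _).const_mul _]
  refine Finset.sum_eq_zero fun p' _ => ?_
  rw [integral_finsetSum _ fun j' _ => (integrable_clm_mul_clm _ _).const_mul _]
  refine Finset.sum_eq_zero fun j' _ => ?_
  rw [integral_const_mul]
  simp only [conjCoordCLM_apply]
  have h2 : ∫ y : I × J → ℂ, star (y (j', p')) * star (y (q, j)) ∂μ =
      (starRingEnd ℂ) (∫ y : I × J → ℂ, y (j', p') * y (q, j) ∂μ) := by
    rw [← integral_conj]
    simp
  rw [h2, hc, map_zero, mul_zero]

/-- Integrate by parts against each conjugated entry of `X`. The derivative of `Q X` along `Y` is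
`-z Q Y Q' - (Q X) Yᴴ (Q X)`, with `Q'` the companion resolvent; circularity kills the second term
and the covariance turns the first into `-z Q η(Q')`. -/
lemma integral_res_mul_mul_of_law (hμ : μ[id] = 0) (hc : ∀ a b, ∫ y : I × J → ℂ, y a * y b ∂μ = 0)
    {A : κ → Matrix I J ℂ} (hA : ∀ p j q k, ∫ y : I × J → ℂ, y (p, j) * star (y (q, k)) ∂μ =
      ∑ a, A a p j * star (A a q k)) {z : ℂ} (hz : z ∈ cutPlane) (p q : I) :
    ∫ x : I × J → ℂ, (res (mat x) z * (mat x * (mat x)ᴴ)) p q ∂μ =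
      ∫ x, -z * (res (mat x) z * kraus A (res (mat x)ᴴ z)) p q ∂μ := by
  choose C hC using fun j : J => hasCircularDeriv_res_mul (I := I) hz p j
  have h1 : ∀ x : I × J → ℂ, (res (mat x) z * (mat x * (mat x)ᴴ)) p q =
      ∑ j, conjCoordCLM (q, j) x * (res (mat x) z * mat x) p j := by
    intro x
    rw [← Matrix.mul_assoc, Matrix.mul_apply]
    exact Finset.sum_congr rfl fun j _ => mul_comm _ _
  have h2 : ∀ (x : I × J → ℂ) j, ∫ y, conjCoordCLM (q, j) y *
      (resDeriv (mat x) z (mat y) * mat x + res (mat x) z * mat y) p j ∂μ =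
      -z * ∑ p', ∑ j', res (mat x) z p p' * (∑ a, A a p' j' * star (A a q j)) *
        res (mat x)ᴴ z j' j := by
    intro x j
    have h3 : ∀ y : I × J → ℂ, conjCoordCLM (q, j) y *
        (resDeriv (mat x) z (mat y) * mat x + res (mat x) z * mat y) p j =
        -z * (star (y (q, j)) * (res (mat x) z * mat y * res (mat x)ᴴ z) p j) -
        star (y (q, j)) * ((res (mat x) z * mat x) * (mat y)ᴴ * (res (mat x) z * mat x)) p j := by
      intro y
      have h4 : resDeriv (mat x) z (mat y) * mat x + res (mat x) z * mat y =
          -z • (res (mat x) z * mat y * res (mat x)ᴴ z) -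
          (res (mat x) z * mat x) * (mat y)ᴴ * (res (mat x) z * mat x) := by
        have h5 : resDeriv (mat x) z (mat y) * mat x =
            -(res (mat x) z * mat y * ((mat x)ᴴ * res (mat x) z * mat x) +
              (res (mat x) z * mat x) * (mat y)ᴴ * (res (mat x) z * mat x)) := by
          rw [resDeriv_eq]
          simp only [Matrix.neg_mul, Matrix.add_mul, Matrix.mul_assoc]
        rw [h5, conjTranspose_mul_res_mul _ hz, Matrix.mul_add, Matrix.mul_one, Matrix.mul_smul]
        module
      rw [h4, conjCoordCLM_apply]
      simp only [Matrix.sub_apply, Matrix.smul_apply, smul_eq_mul]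
      ring
    simp_rw [h3]
    have hi1 : Integrable (fun y : I × J → ℂ => star (y (q, j)) *
        (res (mat x) z * mat y * res (mat x)ᴴ z) p j) μ := by
      have := fun p' j' => integrable_clm_mul_clm (μ := μ) (conjCoordCLM (q, j)) (coordCLM (p', j'))
      simp only [mul_mul_apply, Finset.mul_sum]
      refine integrable_finsetSum _ fun p' _ => integrable_finsetSum _ fun j' _ => ?_
      refine ((this p' j').const_mul (res (mat x) z p p' * res (mat x)ᴴ z j' j)).congr
        (ae_of_all _ fun y => ?_)
      simp only [coordCLM_apply, conjCoordCLM_apply, mat, Matrix.of_apply]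
      ring
    have hi2 : Integrable (fun y : I × J → ℂ => star (y (q, j)) *
        ((res (mat x) z * mat x) * (mat y)ᴴ * (res (mat x) z * mat x)) p j) μ := by
      have := fun p' j' => integrable_clm_mul_clm (μ := μ) (conjCoordCLM (q, j))
        (conjCoordCLM (p', j'))
      simp only [mul_mul_apply, Finset.mul_sum]
      refine integrable_finsetSum _ fun j' _ => integrable_finsetSum _ fun p' _ => ?_
      refine ((this p' j').const_mul ((res (mat x) z * mat x) p j' *
        (res (mat x) z * mat x) p' j)).congr (ae_of_all _ fun y => ?_)
      simp only [conjCoordCLM_apply, mat, Matrix.of_apply, conjTranspose_apply]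
      ring
    rw [integral_sub (hi1.const_mul _) hi2, integral_const_mul,
      integral_conj_mul_mul_conjTranspose_apply hc, sub_zero, integral_conj_mul_mul_apply]
    simp only [hA]
  simp_rw [h1]
  rw [integral_finsetSum _ fun j _ => (hC j).integrable_clm_mul _]
  have h3 : ∀ j, ∫ x : I × J → ℂ, conjCoordCLM (q, j) x * (res (mat x) z * mat x) p j ∂μ =
      ∫ x, -z * ∑ p', ∑ j', res (mat x) z p p' * (∑ a, A a p' j' * star (A a q j)) *
        res (mat x)ᴴ z j' j ∂μ := by
    intro j
    rw [(hC j).integral_clm_mul hμ, integral_prod _ ((hC j).integrable_clm_mul_deriv _)]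
    exact integral_congr_ae (ae_of_all _ fun x => h2 x j)
  have h4 : ∀ j, Integrable (fun x => -z * ∑ p', ∑ j', res (mat x) z p p' *
      (∑ a, A a p' j' * star (A a q j)) * res (mat x)ᴴ z j' j) μ := fun j =>
    (((hC j).integrable_clm_mul_deriv (conjCoordCLM (q, j))).integral_prod_left).congr
      (ae_of_all _ fun x => h2 x j)
  simp_rw [h3]
  rw [← integral_finsetSum _ fun j _ => h4 j]
  refine integral_congr_ae (ae_of_all _ fun x => ?_)
  simp only
  rw [← Finset.mul_sum, Matrix.mul_apply]
  congr 1
  rw [Finset.sum_comm]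
  refine Finset.sum_congr rfl fun p' _ => ?_
  rw [kraus_apply, Finset.mul_sum, Finset.sum_comm]
  refine Finset.sum_congr rfl fun j' _ => ?_
  rw [Finset.mul_sum]
  exact Finset.sum_congr rfl fun j _ => by ring

end Law

end

section



/-! ### Deterministic equivalent of the mean resolvent -/

section Model

variable {Ω : Type*} [MeasurableSpace Ω] {P : Measure Ω} {I J κ : Type} [Fintype I] [Fintype J]
  [Fintype κ] [DecidableEq I] [DecidableEq J] {G : Ω → Matrix I J ℂ}

lemma IsCircularGaussian.isGaussian (hG : IsCircularGaussian P G) :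
    IsGaussian (P.map fun ω (a : I × J) => G ω a.1 a.2) := hG.gaussian.isGaussian_map

lemma IsCircularGaussian.integral_law {F : Type*} [NormedAddCommGroup F] [NormedSpace ℝ F]
    [SecondCountableTopology F] (hG : IsCircularGaussian P G) {f : (I × J → ℂ) → F}
    (hf : Continuous f) :
    ∫ x, f x ∂(P.map fun ω (a : I × J) => G ω a.1 a.2) = ∫ ω, f (fun a => G ω a.1 a.2) ∂P :=
  integral_map hG.gaussian.aemeasurable hf.aestronglyMeasurable

lemma IsCircularGaussian.integral_id (hG : IsCircularGaussian P G) :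
    (P.map fun ω (a : I × J) => G ω a.1 a.2)[id] = 0 := by
  have := hG.isGaussian
  funext a
  have h := (coordCLM a).integral_comp_comm (IsGaussian.integrable_id
    (μ := P.map fun ω (a : I × J) => G ω a.1 a.2))
  refine h.symm.trans ((hG.integral_law (f := fun x => x a) (continuous_apply a)).trans ?_)
  exact hG.mean a.1 a.2

lemma IsCircularGaussian.conjTranspose (hG : IsCircularGaussian P G) :
    IsCircularGaussian P fun ω => (G ω)ᴴ where
  gaussian := hG.gaussian.map_fun (ContinuousLinearMap.pi fun a : J × I => conjCoordCLM (a.2, a.1))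
  mean j p := by
    have := congrArg (starRingEnd ℂ) (hG.mean p j)
    rw [map_zero, ← integral_conj] at this
    exact this
  circular j p k q := by
    have := congrArg (starRingEnd ℂ) (hG.circular p j q k)
    rw [map_zero, ← integral_conj] at this
    simp only [map_mul] at this
    exact this

lemma IsCircularGaussian.integrable_of_bounded (hG : IsCircularGaussian P G)
    {F : Matrix I J ℂ → ℂ} (hF : Continuous F) {C : ℝ} (hC : ∀ X, ‖F X‖ ≤ C) :
    Integrable (fun ω => F (G ω)) P := by
  have := hG.gaussian.isProbabilityMeasure
  refine (integrable_const C).mono' ?_ (ae_of_all _ fun ω => hC _)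
  have h := (hF.comp continuous_mat).measurable.comp_aemeasurable hG.gaussian.aemeasurable
  exact h.aestronglyMeasurable

lemma IsCircularGaussian.integrable_norm_pow_of_bounded (hG : IsCircularGaussian P G)
    {F : Matrix I J ℂ → ℂ} (hF : Continuous F) {C : ℝ} (hC : ∀ X, ‖F X‖ ≤ C) (k : ℕ) :
    Integrable (fun ω => ‖F (G ω)‖ ^ k) P := by
  have h := (hG.integrable_of_bounded (F := fun X => ((‖F X‖ ^ k : ℝ) : ℂ)) (by fun_prop)
    (C := C ^ k) fun X => by
      rw [Complex.norm_real, norm_pow, norm_norm]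
      exact pow_le_pow_left₀ (norm_nonneg _) (hC X) k)
  exact h.re.congr (ae_of_all _ fun ω => Complex.ofReal_re _)

lemma continuous_kraus {I J κ : Type*} [Fintype J] [Fintype κ] (A : κ → Matrix I J ℂ) :
    Continuous (kraus A) := by
  unfold kraus
  fun_prop

lemma kraus_apply_eq_trace (A : κ → Matrix I J ℂ) (B : Matrix J J ℂ) (p q : I) :
    kraus A B p q = ((Matrix.of fun k j => ∑ a, A a p j * star (A a q k)) * B).trace := by
  rw [kraus_apply, Matrix.trace, Finset.sum_comm]
  rfl

/-- The squared Hilbert-Schmidt norm of the covariance. -/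
def covNormSq {I J κ : Type*} [Fintype I] [Fintype J] [Fintype κ] (A : κ → Matrix I J ℂ) : ℝ :=
  ∑ x : I × I, ∑ y : J × J, ‖∑ a, A a x.1 y.1 * star (A a x.2 y.2)‖ ^ 2

lemma covNormSq_conjTranspose (A : κ → Matrix I J ℂ) :
    covNormSq (fun a => (A a)ᴴ) = covNormSq A := by
  rw [covNormSq, covNormSq, Finset.sum_comm]
  refine Finset.sum_congr rfl fun x _ => Finset.sum_congr rfl fun y _ => ?_
  have : ∑ a, (A a)ᴴ y.1 x.1 * star ((A a)ᴴ y.2 x.2) =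
      star (∑ a, A a x.1 y.1 * star (A a x.2 y.2)) := by
    rw [star_sum]
    refine Finset.sum_congr rfl fun a _ => ?_
    rw [conjTranspose_apply, conjTranspose_apply, star_mul, star_star, mul_comm]
  rw [this, norm_star]

lemma covNormSq_nonneg (A : κ → Matrix I J ℂ) : 0 ≤ covNormSq A :=
  Finset.sum_nonneg fun _ _ => Finset.sum_nonneg fun _ _ => by positivity

open scoped Matrix.Norms.L2Operator

lemma IsCircularGaussian.integrable_res (hG : IsCircularGaussian P G) {z : ℂ} (hz : z ∈ cutPlane)
    (p q : I) : Integrable (fun ω => res (G ω) z p q) P :=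
  hG.integrable_of_bounded (F := fun X => res X z p q) ((continuous_res hz).matrix_elem p q)
    fun X => (norm_entry_le _ _ _).trans (norm_res_le X hz)

lemma IsCircularGaussian.integral_trace_mul_res (hG : IsCircularGaussian P G) {z : ℂ}
    (hz : z ∈ cutPlane) (A : Matrix I I ℂ) :
    ∫ ω, (A * res (G ω) z).trace ∂P = (A * meanRes P G z).trace := by
  simp only [Matrix.trace, Matrix.diag, Matrix.mul_apply]
  refine (integral_finsetSum _ fun i _ => integrable_finsetSum _ fun j _ =>
    (hG.integrable_res hz j i).const_mul _).trans ?_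
  refine Finset.sum_congr rfl fun i _ => ?_
  rw [integral_finsetSum _ fun j _ => (hG.integrable_res hz j i).const_mul _]
  refine Finset.sum_congr rfl fun j _ => ?_
  rw [integral_const_mul]
  rfl

lemma IsCircularGaussian.norm_meanRes_le (hG : IsCircularGaussian P G) {z : ℂ}
    (hz : z ∈ cutPlane) : ‖meanRes P G z‖ ≤ (rayDist z)⁻¹ := by
  have := hG.gaussian.isProbabilityMeasure
  refine norm_le_of_sum_norm_sq_mulVec_le (inv_nonneg.2 (rayDist_pos hz).le) fun v => ?_
  have h1 : ∀ i, (meanRes P G z *ᵥ v) i = ∫ ω, (res (G ω) z *ᵥ v) i ∂P := by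
    intro i
    simp only [Matrix.mulVec, dotProduct]
    rw [integral_finsetSum _ fun j _ => (hG.integrable_res hz i j).mul_const _]
    refine Finset.sum_congr rfl fun j _ => ?_
    rw [integral_mul_const]
    rfl
  have hF : ∀ i, Continuous fun X : Matrix I J ℂ => (res X z *ᵥ v) i := fun i =>
    (continuous_apply i).comp ((continuous_res hz).matrix_mulVec continuous_const)
  have hbd : ∀ X : Matrix I J ℂ, ∑ i, ‖(res X z *ᵥ v) i‖ ^ 2 ≤
      (rayDist z)⁻¹ ^ 2 * ∑ j, ‖v j‖ ^ 2 := fun X =>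
    (sum_norm_sq_mulVec_le _ _).trans (by gcongr; exact norm_res_le X hz)
  have hC : ∀ i (X : Matrix I J ℂ), ‖(res X z *ᵥ v) i‖ ≤
      Real.sqrt ((rayDist z)⁻¹ ^ 2 * ∑ j, ‖v j‖ ^ 2) := fun i X =>
    Real.le_sqrt_of_sq_le ((Finset.single_le_sum (f := fun i => ‖(res X z *ᵥ v) i‖ ^ 2)
      (fun _ _ => by positivity) (Finset.mem_univ i)).trans (hbd X))
  have hi := fun i => hG.integrable_norm_pow_of_bounded (hF i) (hC i) 2
  calc ∑ i, ‖(meanRes P G z *ᵥ v) i‖ ^ 2 ≤ ∑ i, ∫ ω, ‖(res (G ω) z *ᵥ v) i‖ ^ 2 ∂P := by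
        refine Finset.sum_le_sum fun i _ => ?_
        rw [h1]
        exact norm_integral_sq_le (hG.integrable_of_bounded (hF i) (hC i)) (hi i)
    _ = ∫ ω, ∑ i, ‖(res (G ω) z *ᵥ v) i‖ ^ 2 ∂P := (integral_finsetSum _ fun i _ => hi i).symm
    _ ≤ ∫ _ω, (rayDist z)⁻¹ ^ 2 * ∑ j, ‖v j‖ ^ 2 ∂P :=
        integral_mono (integrable_finsetSum _ fun i _ => hi i) (integrable_const _)
          fun ω => hbd (G ω)
    _ = _ := by rw [integral_const, probReal_univ, one_smul]

theorem IsCircularGaussian.integral_norm_trace_sub_pow_four_le (hG : IsCircularGaussian P G)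
    {v : ℝ} (hv : ∀ B : Matrix J I ℂ, ∫ ω, ‖(B * G ω).trace‖ ^ 2 ∂P ≤ v * frob B ^ 2) (hv0 : 0 ≤ v)
    {z : ℂ} (hz : z ∈ cutPlane) (A : Matrix I I ℂ) :
    ∫ ω, ‖(A * (res (G ω) z - meanRes P G z)).trace‖ ^ 4 ∂P ≤
      concConst z * v ^ 2 * frob A ^ 4 := by
  have := hG.isGaussian
  obtain ⟨C, hC⟩ := hasCircularDeriv_trace (I := I) (J := J) hz A
  have hCc := hC.cont
  have h := integral_norm_trace_res_sub_pow_four_le_of_law hG.integral_id (v := v) (fun B => by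
    rw [hG.integral_law (f := fun y => ‖(B * mat y).trace‖ ^ 2)
      (((continuous_const.matrix_mul continuous_mat).matrix_trace.norm).pow 2)]
    exact hv B) hv0 hz A
  rw [hG.integral_law hC.cont, hG.integral_law (by fun_prop)] at h
  have h2 := hG.integral_trace_mul_res hz A
  simp only [Matrix.mul_sub, Matrix.trace_sub, ← h2]
  exact h

lemma concConst_nonneg (z : ℂ) : 0 ≤ concConst z := by
  unfold concConst
  positivity

lemma IsCircularGaussian.integral_norm_trace_sub_sq_le (hG : IsCircularGaussian P G)
    {v : ℝ} (hv : ∀ B : Matrix J I ℂ, ∫ ω, ‖(B * G ω).trace‖ ^ 2 ∂P ≤ v * frob B ^ 2) (hv0 : 0 ≤ v)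
    {z : ℂ} (hz : z ∈ cutPlane) (A : Matrix I I ℂ) :
    ∫ ω, ‖(A * (res (G ω) z - meanRes P G z)).trace‖ ^ 2 ∂P ≤
      Real.sqrt (concConst z) * v * frob A ^ 2 := by
  have := hG.gaussian.isProbabilityMeasure
  have h := hG.integral_norm_trace_sub_pow_four_le hv hv0 hz A
  have hF : Continuous fun X : Matrix I J ℂ => (A * (res X z - meanRes P G z)).trace :=
    (continuous_const.matrix_mul ((continuous_res hz).sub continuous_const)).matrix_trace
  have hC : ∀ X : Matrix I J ℂ, ‖(A * (res X z - meanRes P G z)).trace‖ ≤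
      frob A * (frob (1 : Matrix I I ℂ) * (2 * (rayDist z)⁻¹)) := by
    intro X
    refine (norm_trace_mul_le _ _).trans (mul_le_mul_of_nonneg_left ?_ (frob_nonneg _))
    have h3 := frob_mul_le' (1 : Matrix I I ℂ) (res X z - meanRes P G z)
    rw [Matrix.one_mul] at h3
    refine h3.trans (mul_le_mul_of_nonneg_left ?_ (frob_nonneg _))
    linarith [norm_sub_le (res X z) (meanRes P G z), norm_res_le X hz, hG.norm_meanRes_le hz]
  have h2 := sq_integral_le (hG.integrable_norm_pow_of_bounded hF hC 2)
    (by simpa only [← pow_mul] using hG.integrable_norm_pow_of_bounded hF hC 4)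
  simp only [← pow_mul, Nat.reduceMul, probReal_univ, one_mul] at h2
  have hf := frob_nonneg A
  refine abs_le_of_sq_le_sq' ((h2.trans h).trans (le_of_eq ?_)) (by positivity) |>.2
  rw [mul_pow, mul_pow, Real.sq_sqrt (concConst_nonneg z)]
  ring

/-- The covariance bound is inherited by `Gᴴ`, so that the companion resolvent concentrates as well.
-/
lemma IsCircularGaussian.integral_norm_trace_conjTranspose_sq_le
    {v : ℝ} (hv : ∀ B : Matrix J I ℂ, ∫ ω, ‖(B * G ω).trace‖ ^ 2 ∂P ≤ v * frob B ^ 2)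
    (B : Matrix I J ℂ) : ∫ ω, ‖(B * (G ω)ᴴ).trace‖ ^ 2 ∂P ≤ v * frob B ^ 2 := by
  have h : ∀ ω, ‖(B * (G ω)ᴴ).trace‖ = ‖(Bᴴ * G ω).trace‖ := by
    intro ω
    rw [← norm_star, ← Matrix.trace_conjTranspose, conjTranspose_mul, conjTranspose_conjTranspose,
      Matrix.trace_mul_comm]
  simp_rw [h]
  simpa only [frob_conjTranspose] using hv Bᴴ

lemma continuous_res_mul_kraus (A : κ → Matrix I J ℂ) {z : ℂ} (hz : z ∈ cutPlane)
    (B : Matrix J J ℂ) (p q : I) :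
    Continuous fun X : Matrix I J ℂ => (res X z * kraus A (res Xᴴ z - B)) p q :=
  ((continuous_res hz).matrix_mul ((continuous_kraus A).comp
    (((continuous_res hz).comp continuous_id.matrix_conjTranspose).sub
      continuous_const))).matrix_elem p q

lemma exists_norm_res_mul_kraus_le (A : κ → Matrix I J ℂ) {z : ℂ} (hz : z ∈ cutPlane)
    (B : Matrix J J ℂ) : ∃ C, ∀ (X : Matrix I J ℂ) (p q : I),
      ‖kraus A (res Xᴴ z - B) p q‖ ≤ C ∧ ‖(res X z * kraus A (res Xᴴ z - B)) p q‖ ≤ C := by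
  obtain ⟨g, hg0, hg, -⟩ := exists_frob_kraus_le A
  have hr : 0 ≤ (rayDist z)⁻¹ := inv_nonneg.2 (rayDist_pos hz).le
  set C := g * (frob (1 : Matrix J J ℂ) * (rayDist z)⁻¹ + frob B) with hC
  have hf1 := frob_nonneg (1 : Matrix J J ℂ)
  have hfB := frob_nonneg B
  have hC0 : 0 ≤ C := by positivity
  have h1 : ∀ X : Matrix I J ℂ, frob (kraus A (res Xᴴ z - B)) ≤ C := by
    intro X
    refine (hg _).trans (mul_le_mul_of_nonneg_left ((frob_sub_le _ _).trans ?_) hg0)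
    have h3 := frob_mul_le' (1 : Matrix J J ℂ) (res Xᴴ z)
    rw [Matrix.one_mul] at h3
    have := mul_le_mul_of_nonneg_left (norm_res_le Xᴴ hz) hf1
    linarith
  refine ⟨C + (rayDist z)⁻¹ * C, fun X p q => ⟨?_, ?_⟩⟩
  · have : 0 ≤ (rayDist z)⁻¹ * C := by positivity
    linarith [norm_entry_le_frob (kraus A (res Xᴴ z - B)) p q, h1 X]
  · refine ((norm_entry_le_frob _ p q).trans (frob_mul_le _ _)).trans ?_
    have := mul_le_mul (norm_res_le X hz) (h1 X) (frob_nonneg _) hr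
    linarith

/-- The approximate canonical equation satisfied by the mean resolvents. -/
theorem IsCircularGaussian.meanRes_mul_one_add (hG : IsCircularGaussian P G)
    {A : κ → Matrix I J ℂ} (hA : ∀ p j q k, ∫ ω, G ω p j * star (G ω q k) ∂P =
      ∑ a, A a p j * star (A a q k)) {z : ℂ} (hz : z ∈ cutPlane) :
    meanRes P G z * (1 + kraus A (meanRes P (fun ω => (G ω)ᴴ) z)) = (-1 / z) • 1 +
      Matrix.of fun p q => -∫ ω, (res (G ω) z *
        kraus A (res (G ω)ᴴ z - meanRes P (fun ω => (G ω)ᴴ) z)) p q ∂P := by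
  have := hG.gaussian.isProbabilityMeasure
  have := hG.isGaussian
  have hz0 := ne_zero_of_mem_cutPlane hz
  set M := meanRes P (fun ω => (G ω)ᴴ) z with hM
  ext p q
  have h := integral_res_mul_mul_of_law (A := A) hG.integral_id
    (fun a b => by
      rw [hG.integral_law (f := fun y => y a * y b) (by fun_prop)]
      exact hG.circular _ _ _ _)
    (fun p j q k => by
      rw [hG.integral_law (f := fun y => y (p, j) * star (y (q, k))) (by fun_prop)]
      exact hA p j q k) hz p q
  have hc1 : Continuous fun x : I × J → ℂ => (res (mat x) z * (mat x * (mat x)ᴴ)) p q :=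
    (((continuous_res hz).comp continuous_mat).matrix_mul
      (continuous_mat.matrix_mul continuous_mat.matrix_conjTranspose)).matrix_elem p q
  have hc2 : Continuous fun x : I × J → ℂ =>
      -z * (res (mat x) z * kraus A (res (mat x)ᴴ z)) p q := by
    have := (continuous_res_mul_kraus A hz 0 p q).comp continuous_mat
    simp only [sub_zero] at this
    exact continuous_const.mul this
  rw [hG.integral_law hc1, hG.integral_law hc2] at h
  change ∫ ω, (res (G ω) z * (G ω * (G ω)ᴴ)) p q ∂P =
    ∫ ω, -z * (res (G ω) z * kraus A (res (G ω)ᴴ z)) p q ∂P at h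
  have hi := hG.integrable_res hz
  obtain ⟨C, hC⟩ := exists_norm_res_mul_kraus_le A hz M
  have hiK := hG.integrable_of_bounded (continuous_res_mul_kraus A hz M p q) fun X => (hC X p q).2
  have hiM : Integrable (fun ω => (res (G ω) z * kraus A M) p q) P := by
    simp only [Matrix.mul_apply]
    exact integrable_finsetSum _ fun k _ => (hi p k).mul_const _
  -- The resolvent identity rewrites one side of the integration by parts as `1 + z 𝔼Q`; on the
  -- other side the companion resolvent is split around its mean, which isolates the error.
  have h1 : ∀ ω, (res (G ω) z * (G ω * (G ω)ᴴ)) p q =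
      (1 : Matrix I I ℂ) p q + z * res (G ω) z p q := by
    intro ω
    rw [res_mul_self _ hz]
    rfl
  have h2 : ∀ ω, (res (G ω) z * kraus A (res (G ω)ᴴ z)) p q =
      (res (G ω) z * kraus A (res (G ω)ᴴ z - M)) p q + (res (G ω) z * kraus A M) p q := by
    intro ω
    rw [kraus_sub, Matrix.mul_sub, Matrix.sub_apply, sub_add_cancel]
  have h3 : ∫ ω, (res (G ω) z * kraus A M) p q ∂P = (meanRes P G z * kraus A M) p q := by
    simp only [Matrix.mul_apply]
    rw [integral_finsetSum _ fun k _ => (hi p k).mul_const _]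
    refine Finset.sum_congr rfl fun k _ => ?_
    rw [integral_mul_const]
    rfl
  simp_rw [h1, h2] at h
  rw [integral_add (integrable_const _) ((hi p q).const_mul z), integral_const, probReal_univ,
    one_smul, integral_const_mul, integral_const_mul, integral_add hiK hiM, h3] at h
  rw [Matrix.mul_add, Matrix.mul_one, Matrix.add_apply, Matrix.add_apply, Matrix.smul_apply,
    Matrix.of_apply, smul_eq_mul]
  have h4 : meanRes P G z p q = ∫ ω, res (G ω) z p q ∂P := rfl
  rw [← h4] at h
  field_simp
  linear_combination h

/-- The `(p, q)` entry of `η(Q' - 𝔼Q')` is the centred trace of `Q'` against the `(p, q)` slice of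
the covariance. Its variance is bounded by concentration, and the squared Frobenius norms of the
slices add up to `covNormSq A`. -/
lemma IsCircularGaussian.frob_error_sq_le (hG : IsCircularGaussian P G)
    {v : ℝ} (hv : ∀ B : Matrix J I ℂ, ∫ ω, ‖(B * G ω).trace‖ ^ 2 ∂P ≤ v * frob B ^ 2) (hv0 : 0 ≤ v)
    (A : κ → Matrix I J ℂ) {z : ℂ} (hz : z ∈ cutPlane) :
    frob (Matrix.of fun p q => -∫ ω, (res (G ω) z *
      kraus A (res (G ω)ᴴ z - meanRes P (fun ω => (G ω)ᴴ) z)) p q ∂P) ^ 2 ≤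
      (rayDist z)⁻¹ ^ 2 * (Real.sqrt (concConst z) * v * covNormSq A) := by
  have := hG.gaussian.isProbabilityMeasure
  set M := meanRes P (fun ω => (G ω)ᴴ) z with hM
  obtain ⟨C, hC⟩ := exists_norm_res_mul_kraus_le A hz M
  have hcK : ∀ p q, Continuous fun X : Matrix I J ℂ => kraus A (res Xᴴ z - M) p q := fun p q =>
    ((continuous_kraus A).comp (((continuous_res hz).comp
      continuous_id.matrix_conjTranspose).sub continuous_const)).matrix_elem p q
  have hi := fun p q => hG.integrable_norm_pow_of_bounded (continuous_res_mul_kraus A hz M p q)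
    (fun X => (hC X p q).2) 2
  have hiK := fun p q => hG.integrable_norm_pow_of_bounded (hcK p q) (fun X => (hC X p q).1) 2
  rw [frob_sq]
  simp only [Matrix.of_apply, norm_neg]
  calc _ ≤ ∑ p, ∑ q, ∫ ω, ‖(res (G ω) z * kraus A (res (G ω)ᴴ z - M)) p q‖ ^ 2 ∂P := by
        refine Finset.sum_le_sum fun p _ => Finset.sum_le_sum fun q _ => ?_
        exact norm_integral_sq_le (hG.integrable_of_bounded (continuous_res_mul_kraus A hz M p q)
          fun X => (hC X p q).2) (hi p q)
    _ = ∫ ω, frob (res (G ω) z * kraus A (res (G ω)ᴴ z - M)) ^ 2 ∂P := by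
        simp only [frob_sq]
        rw [integral_finsetSum _ fun p _ => integrable_finsetSum _ fun q _ => hi p q]
        exact Finset.sum_congr rfl fun p _ => (integral_finsetSum _ fun q _ => hi p q).symm
    _ ≤ ∫ ω, (rayDist z)⁻¹ ^ 2 * frob (kraus A (res (G ω)ᴴ z - M)) ^ 2 ∂P := by
        refine integral_mono ?_ ?_ fun ω => ?_
        · simp only [frob_sq]
          exact integrable_finsetSum _ fun p _ => integrable_finsetSum _ fun q _ => hi p q
        · simp only [frob_sq]
          exact (integrable_finsetSum _ fun p _ => integrable_finsetSum _ fun q _ =>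
            hiK p q).const_mul _
        · rw [← mul_pow]
          refine pow_le_pow_left₀ (frob_nonneg _) ((frob_mul_le _ _).trans ?_) 2
          exact mul_le_mul_of_nonneg_right (norm_res_le _ hz) (frob_nonneg _)
    _ = (rayDist z)⁻¹ ^ 2 * ∑ p, ∑ q, ∫ ω, ‖kraus A (res (G ω)ᴴ z - M) p q‖ ^ 2 ∂P := by
        rw [integral_const_mul]
        simp only [frob_sq]
        rw [integral_finsetSum _ fun p _ => integrable_finsetSum _ fun q _ => hiK p q]
        congr 1
        exact Finset.sum_congr rfl fun p _ => integral_finsetSum _ fun q _ => hiK p q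
    _ ≤ (rayDist z)⁻¹ ^ 2 * ∑ p, ∑ q, Real.sqrt (concConst z) * v *
          frob (Matrix.of fun k j => ∑ a, A a p j * star (A a q k)) ^ 2 := by
        refine mul_le_mul_of_nonneg_left (Finset.sum_le_sum fun p _ => Finset.sum_le_sum
          fun q _ => ?_) (by positivity)
        simp only [kraus_apply_eq_trace]
        exact hG.conjTranspose.integral_norm_trace_sub_sq_le
          (IsCircularGaussian.integral_norm_trace_conjTranspose_sq_le hv) hv0 hz _
    _ = _ := by
        simp only [← Finset.mul_sum, covNormSq, Fintype.sum_prod_type]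
        congr 2
        refine Finset.sum_congr rfl fun p _ => Finset.sum_congr rfl fun q _ => ?_
        rw [frob_sq, Finset.sum_comm]
        rfl

/-- The mean resolvent is close to the solution of the canonical equation. -/
theorem IsCircularGaussian.frob_meanRes_sub_le [DecidableEq κ] (hG : IsCircularGaussian P G)
    {v : ℝ} (hv : ∀ B : Matrix J I ℂ, ∫ ω, ‖(B * G ω).trace‖ ^ 2 ∂P ≤ v * frob B ^ 2) (hv0 : 0 ≤ v)
    {A : κ → Matrix I J ℂ} (hA : ∀ p j q k, ∫ ω, G ω p j * star (G ω q k) ∂P =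
      ∑ a, A a p j * star (A a q k)) {g : ℝ} (hg : ∀ B, frob (kraus A B) ≤ g * frob B)
    (hg' : ∀ D, frob (kraus (fun a => (A a)ᴴ) D) ≤ g * frob D) {z : ℂ} (hz : z ∈ cutPlane)
    (hsmall : ‖z‖ * (rayDist z)⁻¹ ^ 2 * g ≤ 1 / 2) {T : Matrix I I ℂ} {T' : Matrix J J ℂ}
    (hT : IsSolutionAt A z T T') (hTr : ‖T‖ ≤ (rayDist z)⁻¹) (hTr' : ‖T'‖ ≤ (rayDist z)⁻¹) :
    frob (meanRes P G z - T) ≤ 4 * ‖z‖ * (rayDist z)⁻¹ ^ 2 *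
      Real.sqrt (Real.sqrt (concConst z) * v * covNormSq A) := by
  have hr : 0 ≤ (rayDist z)⁻¹ := inv_nonneg.2 (rayDist_pos hz).le
  have hA' : ∀ j p k q, ∫ ω, (G ω)ᴴ j p * star ((G ω)ᴴ k q) ∂P =
      ∑ a, (A a)ᴴ j p * star ((A a)ᴴ k q) := by
    intro j p k q
    have h := congrArg (starRingEnd ℂ) (hA p j q k)
    rw [← integral_conj, map_sum] at h
    simpa using h
  have h1 := hG.meanRes_mul_one_add hA hz
  have h2 := hG.conjTranspose.meanRes_mul_one_add hA' hz
  have e1 := hG.frob_error_sq_le hv hv0 A hz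
  have e2 := hG.conjTranspose.frob_error_sq_le
    (IsCircularGaussian.integral_norm_trace_conjTranspose_sq_le hv) hv0 (fun a => (A a)ᴴ) hz
  simp only [conjTranspose_conjTranspose] at h2 e2
  rw [covNormSq_conjTranspose] at e2
  -- The inputs `E`, `E'` are the mean resolvents themselves, so half of the left side is absorbed;
  -- this doubles the two equal error bounds, whence the factor `4`.
  have h := hT.frob_le (ne_zero_of_mem_cutPlane hz) h1 h2 hg hg' (hG.norm_meanRes_le hz)
    (hG.conjTranspose.norm_meanRes_le hz) hTr hTr' (by rw [← sq]; exact hsmall)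
  have key : ∀ {x : ℝ}, x ^ 2 ≤ (rayDist z)⁻¹ ^ 2 * (Real.sqrt (concConst z) * v * covNormSq A) →
      x ≤ (rayDist z)⁻¹ * Real.sqrt (Real.sqrt (concConst z) * v * covNormSq A) := by
    intro x hx
    refine abs_le_of_sq_le_sq' (hx.trans (le_of_eq ?_)) (by positivity) |>.2
    rw [mul_pow, Real.sq_sqrt]
    have := covNormSq_nonneg A
    positivity
  have k1 := key e1
  have k2 := key e2
  have hn := frob_nonneg (meanRes P (fun ω => (G ω)ᴴ) z - T')
  have k3 := mul_le_mul_of_nonneg_left (add_le_add k1 k2) (mul_nonneg (norm_nonneg z) hr)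
  calc frob (meanRes P G z - T) ≤ 2 * (‖z‖ * (rayDist z)⁻¹ *
        ((rayDist z)⁻¹ * Real.sqrt (Real.sqrt (concConst z) * v * covNormSq A) +
          (rayDist z)⁻¹ * Real.sqrt (Real.sqrt (concConst z) * v * covNormSq A))) := by linarith
    _ = _ := by ring

end Model

end

section



/-! ### Toeplitz quadratic forms -/

lemma norm_exp_two_pi_I_mul (x : ℝ) (k : ℤ) :
    ‖Complex.exp (2 * Complex.I * Real.pi * x * k)‖ = 1 := by
  rw [show (2 * Complex.I * Real.pi * x * k : ℂ) = ((2 * Real.pi * x * k : ℝ) : ℂ) * Complex.I by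
    push_cast; ring]
  exact Complex.norm_exp_ofReal_mul_I _

lemma intervalIntegrable_mul_exp {S : ℝ → ℝ} (hS : IntervalIntegrable S volume 0 1) (k : ℤ) :
    IntervalIntegrable (fun x : ℝ => (S x : ℂ) * Complex.exp (2 * Complex.I * Real.pi * x * k))
      volume 0 1 := by
  rw [intervalIntegrable_iff] at hS ⊢
  refine hS.norm.mono' (hS.ofReal.aestronglyMeasurable.mul
    (by fun_prop : Continuous fun x : ℝ =>
      Complex.exp (2 * Complex.I * Real.pi * x * k)).aestronglyMeasurable) (ae_of_all _ fun x => ?_)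
  rw [norm_mul, norm_exp_two_pi_I_mul, mul_one, Complex.norm_real]

lemma corr_const (b : ℝ) (k : ℤ) : corr (fun _ => b) k = if k = 0 then (b : ℂ) else 0 := by
  split_ifs with h
  · simp [corr, h]
  · have hc : (2 * Complex.I * Real.pi * k : ℂ) ≠ 0 := by
      simp [Real.pi_ne_zero, h, Complex.I_ne_zero]
    have h1 : ∀ x : ℝ, Complex.exp (2 * Complex.I * Real.pi * x * k) =
        Complex.exp ((2 * Complex.I * Real.pi * k) * x) := fun x => by ring_nf
    simp only [corr, h1, intervalIntegral.integral_const_mul]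
    rw [integral_exp_mul_complex hc]
    have h2 : Complex.exp (2 * Complex.I * Real.pi * k) = 1 := by
      rw [show (2 * Complex.I * Real.pi * k : ℂ) = k * (2 * Real.pi * Complex.I) by ring]
      exact Complex.exp_int_mul_two_pi_mul_I k
    simp [h2]

/-- Expanding the square: a Toeplitz form is the integral of its symbol against the squared modulus
of a trigonometric polynomial. -/
lemma sum_mul_corr_eq_integral {S : ℝ → ℝ} (hS : IntervalIntegrable S volume 0 1) {n : ℕ}
    (x : Fin n → ℂ) :
    ∑ k, ∑ k', x k * star (x k') * corr S ((k : ℤ) - (k' : ℤ)) =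
      ((∫ ν in (0 : ℝ)..1, S ν *
        ‖∑ k, x k * Complex.exp (2 * Complex.I * Real.pi * ν * ((k : ℕ) : ℤ))‖ ^ 2 : ℝ) : ℂ) := by
  have h1 : ∀ ν : ℝ, ((S ν *
      ‖∑ k, x k * Complex.exp (2 * Complex.I * Real.pi * ν * ((k : ℕ) : ℤ))‖ ^ 2 : ℝ) : ℂ) =
      ∑ k, ∑ k', x k * star (x k') * ((S ν : ℂ) *
        Complex.exp (2 * Complex.I * Real.pi * ν * (((k : ℤ) - (k' : ℤ) : ℤ) : ℂ))) := by
    intro ν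
    push_cast
    rw [← Complex.mul_conj', map_sum, Finset.sum_mul_sum, Finset.mul_sum]
    refine Finset.sum_congr rfl fun k _ => ?_
    rw [Finset.mul_sum]
    refine Finset.sum_congr rfl fun k' _ => ?_
    rw [map_mul, ← Complex.exp_conj]
    simp only [map_mul, Complex.conj_I, Complex.conj_ofReal, map_natCast, map_ofNat]
    rw [mul_sub, sub_eq_add_neg, Complex.exp_add, ← starRingEnd_apply]
    rw [show 2 * -Complex.I * (Real.pi : ℂ) * (ν : ℂ) * ((k' : ℕ) : ℂ) =
      -(2 * Complex.I * (Real.pi : ℂ) * (ν : ℂ) * ((k' : ℕ) : ℂ)) by ring]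
    ring
  rw [← intervalIntegral.integral_ofReal]
  simp_rw [h1]
  have hi := fun k : ℤ => intervalIntegrable_mul_exp hS k
  rw [intervalIntegral.integral_finsetSum]
  · refine Finset.sum_congr rfl fun k _ => ?_
    rw [intervalIntegral.integral_finsetSum]
    · refine Finset.sum_congr rfl fun k' _ => ?_
      rw [intervalIntegral.integral_const_mul]
      rfl
    · exact fun k' _ => (hi _).const_mul _
  · intro k _
    have := IntervalIntegrable.sum Finset.univ (fun (k' : Fin n) _ =>
      (hi ((k : ℤ) - (k' : ℤ))).const_mul (x k * star (x k')))
    exact this.congr (fun ν _ => Finset.sum_apply _ _ _)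

/-- The integral representation is monotone in the symbol, and for the constant symbol `b` the
Toeplitz matrix is `b` times the identity. -/
lemma re_sum_mul_corr_le {S : ℝ → ℝ} (hS : IntervalIntegrable S volume 0 1) {b : ℝ}
    (hb : ∀ ν ∈ Set.Icc (0 : ℝ) 1, S ν ≤ b) {n : ℕ} (x : Fin n → ℂ) :
    (∑ k, ∑ k', x k * star (x k') * corr S ((k : ℤ) - (k' : ℤ))).re ≤ b * ∑ k, ‖x k‖ ^ 2 := by
  have h1 : ∑ k, ∑ k', x k * star (x k') * corr (fun _ => b) ((k : ℤ) - (k' : ℤ)) =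
      ((b * ∑ k, ‖x k‖ ^ 2 : ℝ) : ℂ) := by
    push_cast
    rw [Finset.mul_sum]
    refine Finset.sum_congr rfl fun k _ => ?_
    rw [Finset.sum_eq_single k]
    · rw [sub_self, corr_const, if_pos rfl, ← Complex.mul_conj']
      exact mul_comm _ _
    · intro k' _ hk
      rw [corr_const, if_neg, mul_zero]
      rw [sub_eq_zero]
      exact fun h => hk (Fin.ext (by exact_mod_cast h.symm))
    · simp
  have h2 := h1
  rw [sum_mul_corr_eq_integral intervalIntegrable_const] at h2
  rw [← Complex.ofReal_inj.1 h2, sum_mul_corr_eq_integral hS, Complex.ofReal_re]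
  have hc : Continuous fun ν : ℝ =>
      ‖∑ k, x k * Complex.exp (2 * Complex.I * Real.pi * ν * (((k : Fin n) : ℕ) : ℤ))‖ ^ 2 := by
    fun_prop
  refine intervalIntegral.integral_mono_on zero_le_one (hS.mul_continuousOn hc.continuousOn)
    ((hc.const_mul b).intervalIntegrable _ _) fun ν hν => ?_
  exact mul_le_mul_of_nonneg_right (hb ν hν) (by positivity)

/-- Distinct channels `m` are uncorrelated, so the variance splits into Toeplitz forms, one for each
channel. -/
lemma integral_norm_sum_sq_le {Ω : Type*} [MeasurableSpace Ω] {P : Measure Ω} {M n : ℕ} {N b : ℝ}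
    (hN : 0 ≤ N) {S : ℕ → ℝ → ℝ} (hS : ∀ m, IntervalIntegrable (S m) volume 0 1)
    (hb : ∀ m, ∀ ν ∈ Set.Icc (0 : ℝ) 1, S m ν ≤ b) {ξ : Fin M → Fin n → Ω → ℂ}
    (hint : ∀ m k m' k', Integrable (fun ω => ξ m k ω * star (ξ m' k' ω)) P)
    (hcov : ∀ m m' k k', ∫ ω, ξ m k ω * star (ξ m' k' ω) ∂P =
      if m = m' then corr (S m) ((k : ℤ) - (k' : ℤ)) / (N : ℂ) else 0) (x : Fin M → Fin n → ℂ) :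
    ∫ ω, ‖∑ m, ∑ k, x m k * ξ m k ω‖ ^ 2 ∂P ≤ b / N * ∑ m, ∑ k, ‖x m k‖ ^ 2 := by
  have h1 : ∀ ω, ((‖∑ m, ∑ k, x m k * ξ m k ω‖ ^ 2 : ℝ) : ℂ) =
      ∑ m, ∑ m', ∑ k, ∑ k', (x m k * star (x m' k')) * (ξ m k ω * star (ξ m' k' ω)) := by
    intro ω
    push_cast
    rw [← Complex.mul_conj', map_sum, Finset.sum_mul_sum]
    refine Finset.sum_congr rfl fun m _ => Finset.sum_congr rfl fun m' _ => ?_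
    rw [map_sum, Finset.sum_mul_sum]
    refine Finset.sum_congr rfl fun k _ => Finset.sum_congr rfl fun k' _ => ?_
    rw [map_mul, starRingEnd_apply, starRingEnd_apply]
    ring
  have h2 : ((∫ ω, ‖∑ m, ∑ k, x m k * ξ m k ω‖ ^ 2 ∂P : ℝ) : ℂ) =
      ∑ m, (∑ k, ∑ k', x m k * star (x m k') * corr (S m) ((k : ℤ) - (k' : ℤ))) / (N : ℂ) := by
    rw [← integral_complex_ofReal]
    simp_rw [h1]
    have hi := fun m m' k k' => (hint m k m' k').const_mul (x m k * star (x m' k'))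
    rw [integral_finsetSum _ fun m _ => integrable_finsetSum _ fun m' _ =>
      integrable_finsetSum _ fun k _ => integrable_finsetSum _ fun k' _ => hi m m' k k']
    refine Finset.sum_congr rfl fun m _ => ?_
    rw [integral_finsetSum _ fun m' _ =>
      integrable_finsetSum _ fun k _ => integrable_finsetSum _ fun k' _ => hi m m' k k']
    rw [Finset.sum_eq_single m]
    · rw [integral_finsetSum _ fun k _ => integrable_finsetSum _ fun k' _ => hi m m k k',
        Finset.sum_div]
      refine Finset.sum_congr rfl fun k _ => ?_
      rw [integral_finsetSum _ fun k' _ => hi m m k k', Finset.sum_div]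
      refine Finset.sum_congr rfl fun k' _ => ?_
      rw [integral_const_mul, hcov, if_pos rfl, mul_div_assoc]
    · intro m' _ hm
      rw [integral_finsetSum _ fun k _ => integrable_finsetSum _ fun k' _ => hi m m' k k']
      refine Finset.sum_eq_zero fun k _ => ?_
      rw [integral_finsetSum _ fun k' _ => hi m m' k k']
      refine Finset.sum_eq_zero fun k' _ => ?_
      rw [integral_const_mul, hcov, if_neg (Ne.symm hm), mul_zero]
    · simp
  have h3 := congrArg Complex.re h2
  rw [Complex.ofReal_re, Complex.re_sum] at h3
  rw [h3, Finset.mul_sum]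
  refine Finset.sum_le_sum fun m _ => ?_
  rw [Complex.div_ofReal_re, div_mul_eq_mul_div]
  exact div_le_div_of_nonneg_right (re_sum_mul_corr_le (hS m) (hb m) (x m)) hN

/-! ### The covariance of the block-Hankel model -/

open scoped Matrix.Norms.L2Operator

/-! ### Dimension-free bounds for completely positive maps and their covariances. -/

section Kadison

variable {I J κ : Type*} [Fintype I] [Fintype J] [Fintype κ] [DecidableEq I] [DecidableEq J]

lemma sum_frob_conjTranspose_mul_sq_le {A : κ → Matrix I J ℂ} {α : ℝ}
    (hα : ∀ u : I → ℂ, ∑ a, ∑ j, ‖((A a)ᴴ *ᵥ u) j‖ ^ 2 ≤ α * ∑ i, ‖u i‖ ^ 2)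
    {K : Type*} [Fintype K] [DecidableEq K] (D : Matrix I K ℂ) :
    ∑ a, frob ((A a)ᴴ * D) ^ 2 ≤ α * frob D ^ 2 := by
  have h : ∀ a, frob ((A a)ᴴ * D) ^ 2 = ∑ k, ∑ j, ‖((A a)ᴴ *ᵥ fun i => D i k) j‖ ^ 2 := by
    intro a
    rw [frob_sq, Finset.sum_comm]
    rfl
  simp_rw [h]
  rw [Finset.sum_comm, frob_sq, Finset.sum_comm (s := Finset.univ (α := I)), Finset.mul_sum]
  exact Finset.sum_le_sum fun k _ => hα fun i => D i k

/-- A completely positive map is bounded in the Frobenius norm by the geometric mean of the norms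
of its values, and of the values of its adjoint, at the identity. -/
lemma frob_kraus_le_sqrt {A : κ → Matrix I J ℂ} {α β : ℝ}
    (hα : ∀ u : I → ℂ, ∑ a, ∑ j, ‖((A a)ᴴ *ᵥ u) j‖ ^ 2 ≤ α * ∑ i, ‖u i‖ ^ 2)
    (hβ : ∀ v : J → ℂ, ∑ a, ∑ i, ‖(A a *ᵥ v) i‖ ^ 2 ≤ β * ∑ j, ‖v j‖ ^ 2) (B : Matrix J J ℂ) :
    frob (kraus A B) ≤ Real.sqrt (α * β) * frob B := by
  set D := kraus A B with hD
  -- Expand one factor of `tr(Dᴴ D)` and move `A_a` across: each term pairs `A_aᴴ D` with `A_a Bᴴ`.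
  -- Cauchy–Schwarz, in the trace and then in `a`, separates the two one-sided bounds.
  have h1 : frob D ^ 2 ≤ ∑ a, frob ((A a)ᴴ * D) * frob (A a * Bᴴ) := by
    have h2 : (Dᴴ * D).trace = ((frob D ^ 2 : ℝ) : ℂ) := by
      rw [frob_sq, Matrix.trace, Finset.sum_comm]
      push_cast
      refine Finset.sum_congr rfl fun i _ => ?_
      rw [Matrix.diag, Matrix.mul_apply]
      refine Finset.sum_congr rfl fun j _ => ?_
      rw [conjTranspose_apply, RCLike.star_def, Complex.conj_mul']
    have h3 : (Dᴴ * D).trace = ∑ a, (((A a)ᴴ * D)ᴴ * (A a * Bᴴ)ᴴ).trace := by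
      nth_rw 2 [hD]
      rw [kraus, Matrix.mul_sum, Matrix.trace_sum]
      refine Finset.sum_congr rfl fun a _ => ?_
      simp only [conjTranspose_mul, conjTranspose_conjTranspose, Matrix.mul_assoc]
    have h4 : frob D ^ 2 = ‖(Dᴴ * D).trace‖ := by
      rw [h2, Complex.norm_real, Real.norm_of_nonneg (by positivity)]
    rw [h4, h3]
    refine (norm_sum_le _ _).trans (Finset.sum_le_sum fun a _ => ?_)
    refine (norm_trace_mul_le _ _).trans (le_of_eq ?_)
    rw [frob_conjTranspose, frob_conjTranspose]
  have h5 := sum_frob_conjTranspose_mul_sq_le hα D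
  have h6 := sum_frob_conjTranspose_mul_sq_le (A := fun a => (A a)ᴴ)
    (by simpa only [conjTranspose_conjTranspose] using hβ) Bᴴ
  simp only [conjTranspose_conjTranspose, frob_conjTranspose] at h6
  have h7 := Finset.sum_mul_sq_le_sq_mul_sq Finset.univ (fun a => frob ((A a)ᴴ * D))
    (fun a => frob (A a * Bᴴ))
  have hDn := frob_nonneg D
  have hBn := frob_nonneg B
  rcases hDn.eq_or_lt with h0 | h0
  · rw [← h0]
    positivity
  · have h8 : (frob D ^ 2) ^ 2 ≤ (α * frob D ^ 2) * (β * frob B ^ 2) := by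
      refine (pow_le_pow_left₀ (by positivity) h1 2).trans (h7.trans ?_)
      exact mul_le_mul h5 h6 (Finset.sum_nonneg fun _ _ => by positivity)
        ((Finset.sum_nonneg fun _ _ => by positivity).trans h5)
    have h9 : frob D ^ 2 ≤ α * β * frob B ^ 2 := by
      refine le_of_mul_le_mul_left ?_ (by positivity : 0 < frob D ^ 2)
      linarith
    rw [← Real.sqrt_sq hBn, ← Real.sqrt_mul' _ (sq_nonneg _)]
    exact Real.le_sqrt_of_sq_le h9

/-- The Hilbert-Schmidt norm of the covariance is controlled by its operator norm and its trace. -/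
lemma covNormSq_le {A : κ → Matrix I J ℂ} {v s : ℝ} (hv0 : 0 ≤ v) [DecidableEq κ]
    (hv : ∀ x : I × J → ℂ, ∑ a, ‖∑ y, A a y.1 y.2 * x y‖ ^ 2 ≤ v * ∑ y, ‖x y‖ ^ 2)
    (hs : ∑ a, frob (A a) ^ 2 ≤ s) : covNormSq A ≤ v * s := by
  -- The rows of `F` are the flattened factors, so `Fᴴ F` is the covariance up to conjugation, and
  -- its Frobenius norm is at most `‖F‖ · frob F`.
  set F : Matrix κ (I × J) ℂ := Matrix.of fun a y => A a y.1 y.2 with hF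
  have h1 : covNormSq A = frob (Fᴴ * F) ^ 2 := by
    rw [covNormSq, frob_sq, Fintype.sum_prod_type, Fintype.sum_prod_type]
    refine Finset.sum_congr rfl fun p _ => ?_
    simp only [Fintype.sum_prod_type]
    rw [Finset.sum_comm]
    refine Finset.sum_congr rfl fun j _ => Finset.sum_congr rfl fun q _ =>
      Finset.sum_congr rfl fun k _ => ?_
    rw [← norm_star, star_sum, Matrix.mul_apply]
    congr 2
    refine Finset.sum_congr rfl fun a _ => ?_
    rw [star_mul, star_star, mul_comm]
    rfl
  have h2 : ‖F‖ ≤ Real.sqrt v := by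
    refine norm_le_of_sum_norm_sq_mulVec_le (Real.sqrt_nonneg _) fun x => ?_
    rw [Real.sq_sqrt hv0]
    exact hv x
  have h3 : frob F ^ 2 ≤ s := by
    refine le_trans (le_of_eq ?_) hs
    rw [frob_sq]
    refine Finset.sum_congr rfl fun a _ => ?_
    rw [frob_sq, Fintype.sum_prod_type]
    rfl
  rw [h1]
  calc frob (Fᴴ * F) ^ 2 ≤ (Real.sqrt v * frob F) ^ 2 := by
        have := frob_nonneg F
        refine pow_le_pow_left₀ (frob_nonneg _) ((frob_mul_le _ _).trans ?_) 2
        rw [Matrix.l2_opNorm_conjTranspose]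
        gcongr
    _ = v * frob F ^ 2 := by rw [mul_pow, Real.sq_sqrt hv0]
    _ ≤ v * s := by gcongr

end Kadison

/-! ### Factorization of the covariance of a Gaussian matrix. -/

section Covariance

variable {Ω : Type*} [MeasurableSpace Ω] {P : Measure Ω} {I J κ : Type} [Fintype I] [Fintype J]
  [Fintype κ] [DecidableEq I] [DecidableEq J] {G : Ω → Matrix I J ℂ}

lemma IsCircularGaussian.integrable_mul_star (hG : IsCircularGaussian P G) (p : I) (j : J) (q : I)
    (k : J) : Integrable (fun ω => G ω p j * star (G ω q k)) P := by
  have := hG.isGaussian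
  exact (integrable_clm_mul_clm (coordCLM (p, j)) (conjCoordCLM (q, k))).comp_aemeasurable
    hG.gaussian.aemeasurable

lemma IsCircularGaussian.integral_norm_sum_sq_eq (hG : IsCircularGaussian P G) (x : I × J → ℂ) :
    ((∫ ω, ‖∑ y, G ω y.1 y.2 * x y‖ ^ 2 ∂P : ℝ) : ℂ) =
      ∑ y, ∑ y', x y * star (x y') * ∫ ω, G ω y.1 y.2 * star (G ω y'.1 y'.2) ∂P := by
  have h1 : ∀ ω, ((‖∑ y, G ω y.1 y.2 * x y‖ ^ 2 : ℝ) : ℂ) =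
      ∑ y, ∑ y', (x y * star (x y')) * (G ω y.1 y.2 * star (G ω y'.1 y'.2)) := by
    intro ω
    push_cast
    rw [← Complex.mul_conj', map_sum, Finset.sum_mul_sum]
    refine Finset.sum_congr rfl fun k _ => Finset.sum_congr rfl fun k' _ => ?_
    rw [map_mul, starRingEnd_apply, starRingEnd_apply]
    ring
  have hi := fun y y' : I × J => (hG.integrable_mul_star y.1 y.2 y'.1 y'.2).const_mul
    (x y * star (x y'))
  rw [← integral_complex_ofReal]
  simp_rw [h1]
  rw [integral_finsetSum _ fun y _ => integrable_finsetSum _ fun y' _ => hi y y']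
  refine Finset.sum_congr rfl fun y _ => ?_
  rw [integral_finsetSum _ fun y' _ => hi y y']
  exact Finset.sum_congr rfl fun y' _ => integral_const_mul _ _

/-- A factorization of the covariance. -/
lemma IsCircularGaussian.exists_kraus (hG : IsCircularGaussian P G) :
    ∃ (m : ℕ) (A : Fin m → Matrix I J ℂ), ∀ p j q k, ∫ ω, G ω p j * star (G ω q k) ∂P =
      ∑ a, A a p j * star (A a q k) := by
  set C : Matrix (I × J) (I × J) ℂ :=
    Matrix.of fun y y' => ∫ ω, G ω y.1 y.2 * star (G ω y'.1 y'.2) ∂P with hC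
  have hpos : C.PosSemidef := by
    refine posSemidef_of_quad fun x => ?_
    have h := hG.integral_norm_sum_sq_eq (fun y => star (x y))
    have h2 : quad C x = ((∫ ω, ‖∑ y, G ω y.1 y.2 * star (x y)‖ ^ 2 ∂P : ℝ) : ℂ) := by
      rw [h, quad_eq_sum]
      simp only [star_star]
      rfl
    rw [h2]
    exact_mod_cast integral_nonneg fun ω => by positivity
  obtain ⟨m, V, hV⟩ := Matrix.posSemidef_iff_eq_sum_vecMulVec.1 hpos
  refine ⟨m, fun a => Matrix.of fun p j => V a (p, j), fun p j q k => ?_⟩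
  refine (congrFun (congrFun hV (p, j)) (q, k)).trans ?_
  rw [Matrix.sum_apply]
  rfl

/-- Sums over the abstract factors become variances of linear forms in `G`, so later bounds need no
explicit form of the factors. -/
lemma IsCircularGaussian.sum_norm_sum_sq_eq (hG : IsCircularGaussian P G) {A : κ → Matrix I J ℂ}
    (hA : ∀ p j q k, ∫ ω, G ω p j * star (G ω q k) ∂P = ∑ a, A a p j * star (A a q k))
    (x : I × J → ℂ) :
    ∑ a, ‖∑ y, A a y.1 y.2 * x y‖ ^ 2 = ∫ ω, ‖∑ y, G ω y.1 y.2 * x y‖ ^ 2 ∂P := by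
  have h := hG.integral_norm_sum_sq_eq x
  refine Complex.ofReal_injective (Eq.trans ?_ h.symm)
  simp only [hA, Finset.mul_sum]
  push_cast
  have h1 : ∀ a, ((‖∑ y, A a y.1 y.2 * x y‖ : ℂ)) ^ 2 =
      ∑ y, ∑ y', x y * star (x y') * (A a y.1 y.2 * star (A a y'.1 y'.2)) := by
    intro a
    rw [← Complex.mul_conj', map_sum, Finset.sum_mul_sum]
    refine Finset.sum_congr rfl fun k _ => Finset.sum_congr rfl fun k' _ => ?_
    rw [map_mul, starRingEnd_apply, starRingEnd_apply]
    ring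
  simp_rw [h1]
  rw [Finset.sum_comm]
  refine Finset.sum_congr rfl fun y _ => ?_
  rw [Finset.sum_comm]

end Covariance

end

section


/-! ### The block-Hankel model -/

open scoped Matrix.Norms.L2Operator

/-! ### Second moments of a Gaussian matrix read off from the factors. -/

section CovarianceFactor

variable {Ω : Type*} [MeasurableSpace Ω] {P : Measure Ω} {I J κ : Type} [Fintype I] [Fintype J]
  [Fintype κ] [DecidableEq I] [DecidableEq J] {G : Ω → Matrix I J ℂ} {A : κ → Matrix I J ℂ}

lemma integrable_norm_sum_sq {ι : Type*} [Fintype ι] {ξ : ι → Ω → ℂ}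
    (hint : ∀ i j, Integrable (fun ω => ξ i ω * star (ξ j ω)) P) (x : ι → ℂ) :
    Integrable (fun ω => ‖∑ i, x i * ξ i ω‖ ^ 2) P := by
  have h := (integrable_finsetSum Finset.univ fun i _ => integrable_finsetSum Finset.univ
    fun j _ => (hint i j).const_mul (x i * star (x j))).re
  refine h.congr (ae_of_all _ fun ω => ?_)
  have h1 : ((‖∑ i, x i * ξ i ω‖ ^ 2 : ℝ) : ℂ) =
      ∑ i, ∑ j, (x i * star (x j)) * (ξ i ω * star (ξ j ω)) := by
    push_cast
    rw [← Complex.mul_conj', map_sum, Finset.sum_mul_sum]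
    refine Finset.sum_congr rfl fun k _ => Finset.sum_congr rfl fun k' _ => ?_
    rw [map_mul, starRingEnd_apply, starRingEnd_apply]
    ring
  exact (congrArg Complex.re h1).symm.trans (Complex.ofReal_re _)

/-- The quadratic form of `η(1) = 𝔼[G Gᴴ]`, computed column by column with test vectors supported on
one column. -/
lemma IsCircularGaussian.sum_conjTranspose_mulVec_sq_eq (hG : IsCircularGaussian P G)
    (hA : ∀ p j q k, ∫ ω, G ω p j * star (G ω q k) ∂P = ∑ a, A a p j * star (A a q k))
    (u : I → ℂ) : ∑ a, ∑ j, ‖((A a)ᴴ *ᵥ u) j‖ ^ 2 =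
      ∑ j, ∫ ω, ‖∑ p, G ω p j * star (u p)‖ ^ 2 ∂P := by
  rw [Finset.sum_comm]
  refine Finset.sum_congr rfl fun j _ => ?_
  have h := hG.sum_norm_sum_sq_eq hA fun y => if y.2 = j then star (u y.1) else 0
  simp only [Fintype.sum_prod_type, mul_ite, mul_zero, Finset.sum_ite_eq', Finset.mem_univ,
    if_true] at h
  rw [← h]
  refine Finset.sum_congr rfl fun a _ => ?_
  rw [← norm_star, Matrix.mulVec, dotProduct, star_sum]
  simp only [conjTranspose_apply, star_mul, star_star, mul_comm]

lemma IsCircularGaussian.sum_mulVec_sq_eq (hG : IsCircularGaussian P G)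
    (hA : ∀ p j q k, ∫ ω, G ω p j * star (G ω q k) ∂P = ∑ a, A a p j * star (A a q k))
    (v : J → ℂ) : ∑ a, ∑ i, ‖(A a *ᵥ v) i‖ ^ 2 = ∑ i, ∫ ω, ‖∑ j, G ω i j * v j‖ ^ 2 ∂P := by
  rw [Finset.sum_comm]
  refine Finset.sum_congr rfl fun i _ => ?_
  have h := hG.sum_norm_sum_sq_eq hA fun y => if y.1 = i then v y.2 else 0
  simp only [Fintype.sum_prod_type_right, mul_ite, mul_zero, Finset.sum_ite_eq', Finset.mem_univ,
    if_true] at h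
  rw [← h]
  rfl

lemma IsCircularGaussian.sum_frob_sq_eq (hG : IsCircularGaussian P G)
    (hA : ∀ p j q k, ∫ ω, G ω p j * star (G ω q k) ∂P = ∑ a, A a p j * star (A a q k)) :
    ∑ a, frob (A a) ^ 2 = ∑ j, ∑ p, ∫ ω, ‖G ω p j‖ ^ 2 ∂P := by
  have h1 : ∀ a, frob (A a) ^ 2 = ∑ j, ∑ i, ‖(A a *ᵥ Pi.single j 1) i‖ ^ 2 := by
    intro a
    rw [frob_sq, Finset.sum_comm]
    simp
  simp_rw [h1]
  rw [Finset.sum_comm]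
  refine Finset.sum_congr rfl fun j _ => (hG.sum_mulVec_sq_eq hA _).trans ?_
  refine Finset.sum_congr rfl fun p _ => ?_
  simp [Pi.single_apply]

end CovarianceFactor

/-! ### The Toeplitzification operator as a double sum. -/

section Toeplitz

/-- `τ(A)(l)` collects the entries with row minus column equal to `l`; undoing this grouping gives a
form that matches the covariance index by index. -/
lemma toeplitzOp_apply (r : ℤ → ℂ) {R : ℕ} (K : ℕ) (A : Matrix (Fin R) (Fin R) ℂ) (i j : Fin K) :
    toeplitzOp r K A i j = 1 / (R : ℂ) *
      ∑ a : Fin R, ∑ b : Fin R, r ((i : ℤ) - (j : ℤ) - ((a : ℤ) - (b : ℤ))) * A a b := by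
  have h1 : ∀ l : ℤ, tau A l = 1 / (R : ℂ) *
      ∑ a : Fin R, ∑ b : Fin R, if (a : ℤ) - (b : ℤ) = l then A a b else 0 := by
    intro l
    simp only [tau, shiftPow, Matrix.trace, Matrix.diag, Matrix.mul_apply, Matrix.of_apply,
      mul_ite, mul_one, mul_zero]
  simp only [toeplitzOp, Matrix.of_apply, h1, Finset.mul_sum]
  rw [Finset.sum_comm]
  refine Finset.sum_congr rfl fun a _ => ?_
  rw [Finset.sum_comm]
  refine Finset.sum_congr rfl fun b _ => ?_
  rw [Finset.sum_eq_single ((a : ℤ) - (b : ℤ))]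
  · rw [if_pos rfl]
    ring
  · intro l _ hl
    rw [if_neg hl.symm, mul_zero, mul_zero]
  · intro h
    refine absurd ?_ h
    rw [Finset.mem_Ioo]
    omega

end Toeplitz

section Model

variable {Ω : Type*} [MeasurableSpace Ω] {P : Measure Ω} {S : ℕ → ℝ → ℝ} {M L N : ℕ}
  {w : Fin M → Fin (N + L - 1) → Ω → ℂ}

lemma add_lt_add_sub_one (i : Fin L) (j : Fin N) : (i : ℕ) + (j : ℕ) < N + L - 1 := by omega

lemma IsGaussianModel.isCircularGaussian {r : ℕ → ℤ → ℂ} (hw : IsGaussianModel P r M L N w) :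
    IsCircularGaussian P (hankel w) where
  gaussian := hw.gaussian.map_fun (ContinuousLinearMap.pi fun a : (Fin M × Fin L) × Fin N =>
    coordCLM ((a.1.1, ⟨(a.1.2 : ℕ) + (a.2 : ℕ), add_lt_add_sub_one a.1.2 a.2⟩) :
      Fin M × Fin (N + L - 1)))
  mean _ _ := hw.mean _ _
  circular _ _ _ _ := hw.circular _ _ _ _

lemma IsGaussianModel.integral_hankel_mul_star {r : ℕ → ℤ → ℂ} (hw : IsGaussianModel P r M L N w)
    (p : Fin M × Fin L) (j : Fin N) (q : Fin M × Fin L) (k : Fin N) :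
    ∫ ω, hankel w ω p j * star (hankel w ω q k) ∂P =
      if p.1 = q.1 then r p.1 (((p.2 : ℤ) + (j : ℤ)) - ((q.2 : ℤ) + (k : ℤ))) / N else 0 := by
  refine (hw.cov _ _ _ _).trans ?_
  push_cast
  rfl

/-- The Hankel covariance depends on `(i + j) - (i' + k)`, that is, on the difference of rows plus
the difference of columns. Summed against `B j k` this is a Toeplitzification; the transpose appears
because `τ` counts row minus column. -/
lemma IsGaussianModel.kraus_eq_Psi {κ : Type*} [Fintype κ] {r : ℕ → ℤ → ℂ}
    (hw : IsGaussianModel P r M L N w) {A : κ → Matrix (Fin M × Fin L) (Fin N) ℂ}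
    (hA : ∀ p j q k, ∫ ω, hankel w ω p j * star (hankel w ω q k) ∂P =
      ∑ a, A a p j * star (A a q k)) (B : Matrix (Fin N) (Fin N) ℂ) :
    kraus A B = Psi r M L Bᵀ := by
  ext p q
  rw [kraus_apply]
  simp only [← hA, hw.integral_hankel_mul_star, Psi, Matrix.of_apply]
  split_ifs with h
  · rw [toeplitzOp_apply, Finset.mul_sum, Finset.sum_comm]
    refine Finset.sum_congr rfl fun a _ => ?_
    rw [Finset.mul_sum]
    refine Finset.sum_congr rfl fun b _ => ?_
    rw [Matrix.transpose_apply, show ((p.2 : ℤ) - (q.2 : ℤ) - ((a : ℤ) - (b : ℤ))) =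
      ((p.2 : ℤ) + (b : ℤ)) - ((q.2 : ℤ) + (a : ℤ)) by ring]
    ring
  · simp

/-- The same computation for the adjoint map. Only equal blocks contribute, and the prefactors
combine to `(ML/N)(1/M)(1/L) = 1/N`, which requires `M` and `L` to be nonzero. -/
lemma IsGaussianModel.kraus_conjTranspose_eq_PsiBar {κ : Type*} [Fintype κ] {r : ℕ → ℤ → ℂ}
    (hw : IsGaussianModel P r M L N w) {A : κ → Matrix (Fin M × Fin L) (Fin N) ℂ}
    (hA : ∀ p j q k, ∫ ω, hankel w ω p j * star (hankel w ω q k) ∂P =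
      ∑ a, A a p j * star (A a q k)) (hM : 1 ≤ M) (hL : 1 ≤ L)
    (D : Matrix (Fin M × Fin L) (Fin M × Fin L) ℂ) :
    kraus (fun a => (A a)ᴴ) D = ((M * L : ℂ) / N) • (PsiBar r N D)ᵀ := by
  have hM0 : (M : ℂ) ≠ 0 := by exact_mod_cast (by omega : M ≠ 0)
  have hL0 : (L : ℂ) ≠ 0 := by exact_mod_cast (by omega : L ≠ 0)
  have hA' : ∀ p j q k, ∑ a, (A a)ᴴ j p * star ((A a)ᴴ k q) =
      if q.1 = p.1 then r q.1 (((q.2 : ℤ) + (k : ℤ)) - ((p.2 : ℤ) + (j : ℤ))) / N else 0 := by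
    intro p j q k
    rw [← hw.integral_hankel_mul_star, hA]
    refine Finset.sum_congr rfl fun a _ => ?_
    rw [conjTranspose_apply, conjTranspose_apply, star_star, mul_comm]
  ext j k
  rw [kraus_apply]
  simp only [hA', PsiBar, Matrix.smul_apply, Matrix.transpose_apply, Matrix.sum_apply,
    toeplitzOp_apply, smul_eq_mul, Matrix.of_apply, Fintype.sum_prod_type, ite_mul, zero_mul]
  have h1 : ∀ (m : Fin M) (a : Fin L), (∑ m' : Fin M, ∑ b : Fin L, if m' = m then
      r m' (((b : ℤ) + (k : ℤ)) - ((a : ℤ) + (j : ℤ))) / N * D (m, a) (m', b) else 0) =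
      ∑ b : Fin L, r m (((b : ℤ) + (k : ℤ)) - ((a : ℤ) + (j : ℤ))) / N * D (m, a) (m, b) := by
    intro m a
    rw [Finset.sum_comm]
    simp
  simp only [h1]
  rw [Finset.mul_sum, Finset.mul_sum]
  refine Finset.sum_congr rfl fun m _ => ?_
  rw [Finset.mul_sum, Finset.mul_sum, Finset.mul_sum]
  refine Finset.sum_congr rfl fun a _ => ?_
  rw [Finset.mul_sum, Finset.mul_sum, Finset.mul_sum]
  refine Finset.sum_congr rfl fun b _ => ?_
  rw [show ((k : ℤ) - (j : ℤ) - ((a : ℤ) - (b : ℤ))) =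
      ((b : ℤ) + (k : ℤ)) - ((a : ℤ) + (j : ℤ)) by ring]
  field_simp

lemma IsGaussianModel.isCanonicalSolution_iff {κ : Type} [Fintype κ] {r : ℕ → ℤ → ℂ}
    (hw : IsGaussianModel P r M L N w) {A : κ → Matrix (Fin M × Fin L) (Fin N) ℂ}
    (hA : ∀ p j q k, ∫ ω, hankel w ω p j * star (hankel w ω q k) ∂P =
      ∑ a, A a p j * star (A a q k)) (hM : 1 ≤ M) (hL : 1 ≤ L)
    (T : ℂ → Matrix (Fin M × Fin L) (Fin M × Fin L) ℂ) (T' : ℂ → Matrix (Fin N) (Fin N) ℂ) :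
    IsCanonicalSolution r M L N T T' ↔
      IsStieltjes T ∧ IsStieltjes T' ∧ ∀ z ∈ cutPlane, IsSolutionAt A z (T z) (T' z) := by
  have h : ∀ z ∈ cutPlane, IsSolutionAt A z (T z) (T' z) ↔
      (IsUnit (1 + Psi r M L (T' z)ᵀ) ∧ T z = (-1 / z) • (1 + Psi r M L (T' z)ᵀ)⁻¹) ∧
      (IsUnit (1 + ((M * L : ℂ) / N) • (PsiBar r N (T z))ᵀ) ∧
        T' z = (-1 / z) • (1 + ((M * L : ℂ) / N) • (PsiBar r N (T z))ᵀ)⁻¹) := by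
    intro z hz
    have hz0 := ne_zero_of_mem_cutPlane hz
    rw [IsSolutionAt, hw.kraus_eq_Psi hA, hw.kraus_conjTranspose_eq_PsiBar hA hM hL,
      eq_smul_inv_iff hz0, eq_smul_inv_iff hz0]
  constructor
  · rintro ⟨h1, h2, h3, h4, h5, h6⟩
    exact ⟨h1, h2, fun z hz => (h z hz).2 ⟨⟨h3 z hz, h5 z hz⟩, h4 z hz, h6 z hz⟩⟩
  · rintro ⟨h1, h2, h3⟩
    exact ⟨h1, h2, fun z hz => ((h z hz).1 (h3 z hz)).1.1, fun z hz => ((h z hz).1 (h3 z hz)).2.1,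
      fun z hz => ((h z hz).1 (h3 z hz)).1.2, fun z hz => ((h z hz).1 (h3 z hz)).2.2⟩

variable {b : ℝ}

lemma IsGaussianModel.integrable_mul_star {r : ℕ → ℤ → ℂ} (hw : IsGaussianModel P r M L N w)
    (m m' : Fin M) (k k' : Fin (N + L - 1)) :
    Integrable (fun ω => w m k ω * star (w m' k' ω)) P := by
  have hG : IsCircularGaussian P (fun ω => (Matrix.of fun m k => w m k ω :
      Matrix (Fin M) (Fin (N + L - 1)) ℂ)) :=
    ⟨hw.gaussian, fun _ _ => hw.mean _ _, fun _ _ _ _ => hw.circular _ _ _ _⟩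
  exact hG.integrable_mul_star m k m' k'

/-- By stationarity any window `φ` of consecutive samples has the same Toeplitz covariance; rows and
columns of the Hankel blocks are such windows. -/
lemma IsGaussianModel.integral_norm_sum_sq_le
    (hw : IsGaussianModel P (fun m => corr (S m)) M L N w)
    (hS : ∀ m, IntervalIntegrable (S m) volume 0 1)
    (hb : ∀ m, ∀ ν ∈ Set.Icc (0 : ℝ) 1, S m ν ≤ b) {n : ℕ} {φ : Fin n → Fin (N + L - 1)}
    (hφ : ∀ k k', (φ k : ℤ) - (φ k' : ℤ) = (k : ℤ) - (k' : ℤ)) (x : Fin M → Fin n → ℂ) :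
    ∫ ω, ‖∑ m, ∑ k, x m k * w m (φ k) ω‖ ^ 2 ∂P ≤ b / N * ∑ m, ∑ k, ‖x m k‖ ^ 2 := by
  refine BlockHankel.integral_norm_sum_sq_le (N := N) N.cast_nonneg hS hb
    (ξ := fun m k => w m (φ k)) (fun m k m' k' => hw.integrable_mul_star _ _ _ _)
    (fun m m' k k' => ?_) x
  rw [← hφ]
  exact hw.cov _ _ _ _

/-- For a fixed row index `l` inside the blocks, the entries are distinct samples and the variance
is at most `b / N` times the squared coefficients. Cauchy–Schwarz over the `L` values of `l` costs
the factor `L`, the price of the Hankel repetitions. -/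
lemma IsGaussianModel.integral_norm_trace_sq_le
    (hw : IsGaussianModel P (fun m => corr (S m)) M L N w)
    (hS : ∀ m, IntervalIntegrable (S m) volume 0 1)
    (hb : ∀ m, ∀ ν ∈ Set.Icc (0 : ℝ) 1, S m ν ≤ b) (B : Matrix (Fin N) (Fin M × Fin L) ℂ) :
    ∫ ω, ‖(B * hankel w ω).trace‖ ^ 2 ∂P ≤ b * L / N * frob B ^ 2 := by
  set y : Fin L → Ω → ℂ := fun l ω => ∑ m, ∑ j, B j (m, l) * hankel w ω (m, l) j with hy
  have h1 : ∀ ω, (B * hankel w ω).trace = ∑ l, y l ω := by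
    intro ω
    simp only [hy, Matrix.trace, Matrix.diag, Matrix.mul_apply]
    rw [Finset.sum_comm, Fintype.sum_prod_type, Finset.sum_comm]
  have h2 : ∀ l, ∫ ω, ‖y l ω‖ ^ 2 ∂P ≤ b / N * ∑ m, ∑ j, ‖B j (m, l)‖ ^ 2 := fun l =>
    hw.integral_norm_sum_sq_le hS hb (φ := fun j : Fin N => ⟨(l : ℕ) + (j : ℕ), by omega⟩)
      (fun k k' => by push_cast; ring) fun m j => B j (m, l)
  have h3 : ∀ l, Integrable (fun ω => ‖y l ω‖ ^ 2) P := by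
    intro l
    have h := integrable_norm_sum_sq (P := P)
      (ξ := fun (i : Fin M × Fin N) ω => hankel w ω (i.1, l) i.2)
      (fun i j => hw.isCircularGaussian.integrable_mul_star _ _ _ _) (fun i => B i.2 (i.1, l))
    simpa only [Fintype.sum_prod_type] using h
  have h4 : ∀ ω, ‖(B * hankel w ω).trace‖ ^ 2 ≤ L * ∑ l, ‖y l ω‖ ^ 2 := by
    intro ω
    rw [h1]
    refine (pow_le_pow_left₀ (norm_nonneg _) (norm_sum_le _ _) 2).trans ?_
    refine sq_sum_le_card_mul_sum_sq.trans (le_of_eq ?_)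
    rw [Finset.card_univ, Fintype.card_fin]
  calc ∫ ω, ‖(B * hankel w ω).trace‖ ^ 2 ∂P ≤ ∫ ω, L * ∑ l, ‖y l ω‖ ^ 2 ∂P :=
        integral_mono_of_nonneg (ae_of_all _ fun ω => by positivity)
          ((integrable_finsetSum _ fun l _ => h3 l).const_mul _) (ae_of_all _ h4)
    _ = L * ∑ l, ∫ ω, ‖y l ω‖ ^ 2 ∂P := by
        rw [integral_const_mul, integral_finsetSum _ fun l _ => h3 l]
    _ ≤ L * ∑ l, b / N * ∑ m, ∑ j, ‖B j (m, l)‖ ^ 2 := by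
        gcongr with l _
        exact h2 l
    _ = b * L / N * frob B ^ 2 := by
        rw [← Finset.mul_sum, frob_sq, Finset.sum_comm (s := Finset.univ (α := Fin N)),
          Fintype.sum_prod_type, Finset.sum_comm (s := Finset.univ (α := Fin L))]
        ring

lemma IsGaussianModel.integral_norm_sum_row_sq_le
    (hw : IsGaussianModel P (fun m => corr (S m)) M L N w)
    (hS : ∀ m, IntervalIntegrable (S m) volume 0 1)
    (hb : ∀ m, ∀ ν ∈ Set.Icc (0 : ℝ) 1, S m ν ≤ b) (p : Fin M × Fin L) (v : Fin N → ℂ) :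
    ∫ ω, ‖∑ j, hankel w ω p j * v j‖ ^ 2 ∂P ≤ b / N * ∑ j, ‖v j‖ ^ 2 := by
  have h := hw.integral_norm_sum_sq_le hS hb
    (φ := fun j : Fin N => ⟨(p.2 : ℕ) + (j : ℕ), by omega⟩)
    (fun k k' => by push_cast; ring) fun m j => if m = p.1 then v j else 0
  have h1 : ∀ ω, ∑ m : Fin M, ∑ j : Fin N, (if m = p.1 then v j else 0) *
      w m ⟨(p.2 : ℕ) + (j : ℕ), by omega⟩ ω = ∑ j, hankel w ω p j * v j := by
    intro ω
    rw [Finset.sum_comm]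
    simp only [ite_mul, zero_mul, Finset.sum_ite_eq', Finset.mem_univ, if_true]
    exact Finset.sum_congr rfl fun j _ => mul_comm _ _
  have h2 : ∑ m : Fin M, ∑ j : Fin N, ‖if m = p.1 then v j else 0‖ ^ 2 = ∑ j, ‖v j‖ ^ 2 := by
    rw [Finset.sum_comm]
    refine Finset.sum_congr rfl fun j _ => ?_
    rw [Finset.sum_eq_single p.1] <;> simp +contextual
  simp only [h1] at h
  rwa [h2] at h

lemma IsGaussianModel.integral_norm_sum_col_sq_le
    (hw : IsGaussianModel P (fun m => corr (S m)) M L N w)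
    (hS : ∀ m, IntervalIntegrable (S m) volume 0 1)
    (hb : ∀ m, ∀ ν ∈ Set.Icc (0 : ℝ) 1, S m ν ≤ b) (j : Fin N) (u : Fin M × Fin L → ℂ) :
    ∫ ω, ‖∑ p, hankel w ω p j * u p‖ ^ 2 ∂P ≤ b / N * ∑ p, ‖u p‖ ^ 2 := by
  have h := hw.integral_norm_sum_sq_le hS hb
    (φ := fun i : Fin L => ⟨(i : ℕ) + (j : ℕ), by omega⟩)
    (fun k k' => by push_cast; ring) fun m i => u (m, i)
  rw [Fintype.sum_prod_type]
  refine le_trans (le_of_eq (integral_congr_ae (ae_of_all _ fun ω => ?_))) h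
  simp only [Fintype.sum_prod_type, mul_comm]
  rfl

section Factor

variable {κ : Type} [Fintype κ] {A : κ → Matrix (Fin M × Fin L) (Fin N) ℂ}

lemma IsGaussianModel.sum_conjTranspose_mulVec_sq_le
    (hw : IsGaussianModel P (fun m => corr (S m)) M L N w)
    (hS : ∀ m, IntervalIntegrable (S m) volume 0 1)
    (hb : ∀ m, ∀ ν ∈ Set.Icc (0 : ℝ) 1, S m ν ≤ b) (hN : 1 ≤ N)
    (hA : ∀ p j q k, ∫ ω, hankel w ω p j * star (hankel w ω q k) ∂P =
      ∑ a, A a p j * star (A a q k)) (u : Fin M × Fin L → ℂ) :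
    ∑ a, ∑ j, ‖((A a)ᴴ *ᵥ u) j‖ ^ 2 ≤ b * ∑ i, ‖u i‖ ^ 2 := by
  have hN0 : (N : ℝ) ≠ 0 := by exact_mod_cast (by omega : N ≠ 0)
  rw [hw.isCircularGaussian.sum_conjTranspose_mulVec_sq_eq hA]
  refine (Finset.sum_le_sum fun j _ => hw.integral_norm_sum_col_sq_le hS hb j _).trans
    (le_of_eq ?_)
  simp only [norm_star, Finset.sum_const, Finset.card_univ, Fintype.card_fin, nsmul_eq_mul]
  field_simp

lemma IsGaussianModel.sum_mulVec_sq_le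
    (hw : IsGaussianModel P (fun m => corr (S m)) M L N w)
    (hS : ∀ m, IntervalIntegrable (S m) volume 0 1)
    (hb : ∀ m, ∀ ν ∈ Set.Icc (0 : ℝ) 1, S m ν ≤ b)
    (hA : ∀ p j q k, ∫ ω, hankel w ω p j * star (hankel w ω q k) ∂P =
      ∑ a, A a p j * star (A a q k)) (v : Fin N → ℂ) :
    ∑ a, ∑ i, ‖(A a *ᵥ v) i‖ ^ 2 ≤ b * (M * L / N) * ∑ j, ‖v j‖ ^ 2 := by
  rw [hw.isCircularGaussian.sum_mulVec_sq_eq hA]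
  refine (Finset.sum_le_sum fun i _ => hw.integral_norm_sum_row_sq_le hS hb i _).trans
    (le_of_eq ?_)
  simp only [Finset.sum_const, Finset.card_univ, Fintype.card_fin, Fintype.card_prod, nsmul_eq_mul]
  push_cast
  ring

/-- Here `η(1) ≤ b` and `η*(1) ≤ b c_N`, so the geometric mean depends on the dimensions only
through `c_N`; this makes the contraction disc independent of `N`. -/
lemma IsGaussianModel.frob_kraus_le
    (hw : IsGaussianModel P (fun m => corr (S m)) M L N w)
    (hS : ∀ m, IntervalIntegrable (S m) volume 0 1)
    (hb : ∀ m, ∀ ν ∈ Set.Icc (0 : ℝ) 1, S m ν ≤ b) (hN : 1 ≤ N)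
    (hA : ∀ p j q k, ∫ ω, hankel w ω p j * star (hankel w ω q k) ∂P =
      ∑ a, A a p j * star (A a q k)) :
    (∀ B, frob (kraus A B) ≤ Real.sqrt (b * (b * (M * L / N))) * frob B) ∧
      ∀ D, frob (kraus (fun a => (A a)ᴴ) D) ≤ Real.sqrt (b * (b * (M * L / N))) * frob D := by
  have h1 := hw.sum_conjTranspose_mulVec_sq_le hS hb hN hA
  have h2 := hw.sum_mulVec_sq_le hS hb hA
  refine ⟨frob_kraus_le_sqrt h1 h2, ?_⟩
  rw [mul_comm]
  exact frob_kraus_le_sqrt (A := fun a => (A a)ᴴ)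
    (by simpa only [conjTranspose_conjTranspose] using h2) h1

/-- Operator norm times trace: the first is at most `bL/N`, and the second sums `MLN` variances each
at most `b/N`. -/
lemma IsGaussianModel.covNormSq_le [DecidableEq κ]
    (hw : IsGaussianModel P (fun m => corr (S m)) M L N w)
    (hS : ∀ m, IntervalIntegrable (S m) volume 0 1)
    (hb : ∀ m, ∀ ν ∈ Set.Icc (0 : ℝ) 1, S m ν ≤ b) (hb0 : 0 ≤ b) (hN : 1 ≤ N)
    (hA : ∀ p j q k, ∫ ω, hankel w ω p j * star (hankel w ω q k) ∂P =
      ∑ a, A a p j * star (A a q k)) :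
    covNormSq A ≤ b * L / N * (b * (M * L)) := by
  have hN0 : (N : ℝ) ≠ 0 := by exact_mod_cast (by omega : N ≠ 0)
  refine BlockHankel.covNormSq_le (by positivity) (fun x => ?_) ?_
  · rw [hw.isCircularGaussian.sum_norm_sum_sq_eq hA]
    have h := hw.integral_norm_trace_sq_le hS hb (Matrix.of fun j p => x (p, j))
    rw [frob_sq, Finset.sum_comm] at h
    rw [Fintype.sum_prod_type]
    refine le_trans (le_of_eq (integral_congr_ae (ae_of_all _ fun ω => ?_))) h
    simp only [Matrix.trace, Matrix.diag, Matrix.mul_apply, Matrix.of_apply]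
    rw [Finset.sum_comm, Fintype.sum_prod_type]
    simp only [mul_comm]
  · rw [hw.isCircularGaussian.sum_frob_sq_eq hA]
    have h : ∀ j p, ∫ ω, ‖hankel w ω p j‖ ^ 2 ∂P ≤ b / N := by
      intro j p
      have h := hw.integral_norm_sum_row_sq_le hS hb p (Pi.single j 1)
      have h1 : ∑ k, ‖(Pi.single j 1 : Fin N → ℂ) k‖ ^ 2 = 1 := by
        rw [Finset.sum_eq_single j] <;> simp +contextual
      rw [h1, mul_one] at h
      simpa [Pi.single_apply] using h
    refine (Finset.sum_le_sum fun j _ => Finset.sum_le_sum fun p _ => h j p).trans (le_of_eq ?_)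
    simp only [Finset.sum_const, Finset.card_univ, Fintype.card_fin, Fintype.card_prod,
      nsmul_eq_mul]
    push_cast
    field_simp

end Factor

end Model

end

section


/-! ### Almost sure convergence and the deterministic equivalent -/

open scoped Matrix.Norms.L2Operator

/-- By Tonelli the sum of the fourth powers has finite expectation, hence is almost surely finite,
and its terms tend to `0`. No joint law of the `X n` is needed. -/
lemma ae_tendsto_zero_of_integral_norm_pow_four_le {Ω : Type*} [MeasurableSpace Ω] {P : Measure Ω}
    {X : ℕ → Ω → ℂ} {K : ℝ} (hint : ∀ n, Integrable (fun ω => ‖X n ω‖ ^ 4) P)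
    (h : ∀ n, ∫ ω, ‖X n ω‖ ^ 4 ∂P ≤ K / ((n : ℝ) + 1) ^ 2) :
    ∀ᵐ ω ∂P, Tendsto (fun n => X n ω) atTop (𝓝 0) := by
  have hm : ∀ n, AEMeasurable (fun ω => ENNReal.ofReal (‖X n ω‖ ^ 4)) P := fun n =>
    (hint n).aestronglyMeasurable.aemeasurable.ennreal_ofReal
  have hs : Summable fun n : ℕ => K / ((n : ℝ) + 1) ^ 2 := by
    have h1 := (summable_nat_add_iff 1).2 (Real.summable_one_div_nat_pow.2 one_lt_two)
    refine (h1.mul_left K).congr fun n => ?_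
    push_cast
    ring
  have hfin : ∫⁻ ω, ∑' n, ENNReal.ofReal (‖X n ω‖ ^ 4) ∂P ≠ ⊤ := by
    rw [lintegral_tsum hm]
    refine ne_top_of_le_ne_top hs.tsum_ofReal_ne_top (ENNReal.tsum_le_tsum fun n => ?_)
    rw [← ofReal_integral_eq_lintegral_ofReal (hint n) (ae_of_all _ fun ω => by positivity)]
    exact ENNReal.ofReal_le_ofReal (h n)
  filter_upwards [ae_lt_top' (AEMeasurable.tsum hm) hfin] with ω hω
  have h1 := (ENNReal.tendsto_toReal ENNReal.zero_ne_top).comp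
    (ENNReal.tendsto_atTop_zero_of_tsum_ne_top hω.ne)
  have h2 : Tendsto (fun n => ‖X n ω‖ ^ 4) atTop (𝓝 0) :=
    h1.congr fun n => ENNReal.toReal_ofReal (by positivity)
  have h3 := h2.sqrt.sqrt
  rw [Real.sqrt_zero, Real.sqrt_zero] at h3
  refine tendsto_zero_iff_norm_tendsto_zero.2 (h3.congr fun n => ?_)
  rw [show ‖X n ω‖ ^ 4 = (‖X n ω‖ ^ 2) ^ 2 by ring, Real.sqrt_sq (by positivity),
    Real.sqrt_sq (norm_nonneg _)]

lemma trace_inv_sub_smul_one {I : Type*} [Fintype I] [DecidableEq I] {H : Matrix I I ℂ}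
    (hH : H.PosSemidef) {z : ℂ} (hz : z ∈ cutPlane) :
    (H - z • 1)⁻¹.trace = ∑ k, ((hH.1.eigenvalues k : ℂ) - z)⁻¹ := by
  have hU : (hH.1.eigenvectorUnitary : Matrix I I ℂ)ᴴ *
      (hH.1.eigenvectorUnitary : Matrix I I ℂ) = 1 :=
    Unitary.star_mul_self_of_mem hH.1.eigenvectorUnitary.2
  rw [(inv_sub_smul_one_eq hH hz).2, Matrix.trace_mul_comm, ← Matrix.mul_assoc, hU, Matrix.one_mul,
    Matrix.trace_diagonal]

/-! ### Estimates for the normalized trace. -/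

section NormalizedTrace

variable {M L : ℕ}

lemma ntr_add (A B : Matrix (Fin M × Fin L) (Fin M × Fin L) ℂ) :
    ntr (A + B) = ntr A + ntr B := by
  rw [ntr, ntr, ntr, Matrix.trace_add, mul_add]

/-- Cauchy–Schwarz and `frob A² ≤ ML ‖A‖²`; one of the two factors `1/(ML)` survives and pays for
the growth of the Frobenius error. -/
lemma norm_ntr_mul_sq_le (A X : Matrix (Fin M × Fin L) (Fin M × Fin L) ℂ) :
    ‖ntr (A * X)‖ ^ 2 ≤ ‖A‖ ^ 2 * frob X ^ 2 / (M * L) := by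
  have h1 : frob A ^ 2 ≤ (M * L : ℝ) * ‖A‖ ^ 2 := by
    refine (frob_sq_le A).trans (le_of_eq ?_)
    simp
  have h2 : ‖ntr (A * X)‖ ≤ 1 / (M * L : ℝ) * (frob A * frob X) := by
    rw [ntr, norm_mul, norm_div, norm_one, norm_mul, Complex.norm_natCast, Complex.norm_natCast]
    gcongr
    exact norm_trace_mul_le _ _
  calc ‖ntr (A * X)‖ ^ 2 ≤ (1 / (M * L : ℝ) * (frob A * frob X)) ^ 2 := by gcongr
    _ = (1 / (M * L : ℝ)) ^ 2 * frob A ^ 2 * frob X ^ 2 := by ring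
    _ ≤ (1 / (M * L : ℝ)) ^ 2 * ((M * L : ℝ) * ‖A‖ ^ 2) * frob X ^ 2 := by gcongr
    _ = ‖A‖ ^ 2 * frob X ^ 2 / (M * L) := by
      rcases eq_or_ne (M * L : ℝ) 0 with h | h
      · rw [h]; simp
      · field_simp

lemma norm_ntr_mul_le (A X : Matrix (Fin M × Fin L) (Fin M × Fin L) ℂ) :
    ‖ntr (A * X)‖ ≤ ‖A‖ * ‖X‖ := by
  refine abs_le_of_sq_le_sq' ((norm_ntr_mul_sq_le A X).trans ?_) (by positivity) |>.2
  have h1 : frob X ^ 2 ≤ (M * L : ℝ) * ‖X‖ ^ 2 := by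
    refine (frob_sq_le X).trans (le_of_eq ?_)
    simp
  refine div_le_of_le_mul₀ (by positivity) (by positivity) ?_
  calc _ ≤ ‖A‖ ^ 2 * ((M * L : ℝ) * ‖X‖ ^ 2) := by gcongr
    _ = _ := by ring

lemma differentiableOn_ntr_mul {U : Set ℂ} (A : Matrix (Fin M × Fin L) (Fin M × Fin L) ℂ)
    {X : ℂ → Matrix (Fin M × Fin L) (Fin M × Fin L) ℂ}
    (hX : ∀ p q, DifferentiableOn ℂ (fun z => X z p q) U) :
    DifferentiableOn ℂ (fun z => ntr (A * X z)) U := by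
  simp only [ntr, Matrix.trace, Matrix.diag, Matrix.mul_apply]
  exact (DifferentiableOn.fun_sum fun p _ => DifferentiableOn.fun_sum fun q _ =>
    (hX q p).const_mul _).const_mul _

lemma empStieltjes_eq_ntr {Ω : Type*} {N : ℕ} (w : Fin M → Fin (N + L - 1) → Ω → ℂ) {z : ℂ}
    (hz : z ∈ cutPlane) (ω : Ω) : empStieltjes w z ω = ntr (resolvent w z ω) := by
  rw [empStieltjes, ntr, resolvent,
    trace_inv_sub_smul_one (Matrix.posSemidef_self_mul_conjTranspose (hankel w ω)) hz]
  simp only [one_div]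

end NormalizedTrace

lemma differentiableOn_res {I J : Type*} [Fintype I] [Fintype J] [DecidableEq I]
    (X : Matrix I J ℂ) (p q : I) : DifferentiableOn ℂ (fun z => res X z p q) cutPlane := by
  have hH := Matrix.posSemidef_self_mul_conjTranspose X
  have h : ∀ z ∈ cutPlane, res X z p q = ∑ k, (hH.1.eigenvectorUnitary : Matrix I I ℂ) p k *
      ((hH.1.eigenvalues k : ℂ) - z)⁻¹ * star ((hH.1.eigenvectorUnitary : Matrix I I ℂ) q k) := by
    intro z hz
    rw [res, (inv_sub_smul_one_eq hH hz).2, Matrix.mul_apply]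
    simp only [Matrix.mul_diagonal, conjTranspose_apply]
  refine DifferentiableOn.congr (DifferentiableOn.fun_sum fun k _ => ?_) h
  exact ((differentiableOn_inv_sub (hH.eigenvalues_nonneg k)).const_mul _).mul_const _

lemma IsCircularGaussian.differentiableOn_meanRes {Ω : Type*} [MeasurableSpace Ω] {P : Measure Ω}
    {I J : Type} [Fintype I] [Fintype J] [DecidableEq I] [DecidableEq J] {G : Ω → Matrix I J ℂ}
    (hG : IsCircularGaussian P G) (p q : I) :
    DifferentiableOn ℂ (fun z => meanRes P G z p q) cutPlane := by
  have := hG.gaussian.isProbabilityMeasure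
  exact differentiableOn_integral isOpen_cutPlane
    (fun z hz => (hG.integrable_res hz p q).aestronglyMeasurable)
    (fun ω => differentiableOn_res (G ω) p q) continuousOn_inv_rayDist
    (fun z hz ω => (norm_entry_le _ _ _).trans (norm_res_le _ hz))

/-! ### Assembly for the block-Hankel model. -/

section Model

variable {Ω : Type*} [MeasurableSpace Ω] {P : Measure Ω} {S : ℕ → ℝ → ℝ} {b : ℝ}

/-- The abstract results applied to a factorization of the Hankel covariance, and stated so that the
factors no longer appear: only `b`, the dimensions and `z` remain in the error bound. -/
lemma IsGaussianModel.exists_isCanonicalSolution {M L N : ℕ} {w : Fin M → Fin (N + L - 1) → Ω → ℂ}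
    (hw : IsGaussianModel P (fun m => corr (S m)) M L N w)
    (hS : ∀ m, IntervalIntegrable (S m) volume 0 1)
    (hb : ∀ m, ∀ ν ∈ Set.Icc (0 : ℝ) 1, S m ν ≤ b) (hb0 : 0 ≤ b) (hN : 1 ≤ N) (hM : 1 ≤ M)
    (hL : 1 ≤ L) :
    ∃ T T', IsCanonicalSolution (fun m => corr (S m)) M L N T T' ∧
      (∀ U U', IsCanonicalSolution (fun m => corr (S m)) M L N U U' →
        Set.EqOn U T cutPlane ∧ Set.EqOn U' T' cutPlane) ∧
      (∀ z ∈ cutPlane, ‖T z‖ ≤ (rayDist z)⁻¹) ∧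
      ∀ z ∈ cutPlane, ‖z‖ * (rayDist z)⁻¹ ^ 2 * Real.sqrt (b * (b * (M * L / N))) ≤ 1 / 2 →
        frob (meanRes P (hankel w) z - T z) ^ 2 ≤ (4 * ‖z‖ * (rayDist z)⁻¹ ^ 2) ^ 2 *
          (Real.sqrt (concConst z) * (b * L / N) * (b * L / N * (b * (M * L)))) := by
  have hG := hw.isCircularGaussian
  obtain ⟨m, A, hA⟩ := hG.exists_kraus
  obtain ⟨T, T', hT, hT', hbd, hsol⟩ := exists_isStieltjes_isSolutionAt A
  have hiff := hw.isCanonicalSolution_iff hA hM hL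
  refine ⟨T, T', (hiff _ _).2 ⟨hT, hT', hsol⟩, fun U U' hU => ?_, fun z hz => (hbd z hz).1,
    fun z hz hsmall => ?_⟩
  · obtain ⟨h1, h2, h3⟩ := (hiff _ _).1 hU
    exact IsSolutionAt.eqOn hT hT' h1 h2 hsol h3
  · obtain ⟨hg, hg'⟩ := hw.frob_kraus_le hS hb hN hA
    have hv0 : 0 ≤ b * L / N := by positivity
    have h := hG.frob_meanRes_sub_le (hw.integral_norm_trace_sq_le hS hb) hv0 hA hg hg' hz hsmall
      (hsol z hz) (hbd z hz).1 (hbd z hz).2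
    have hc := covNormSq_nonneg A
    refine (pow_le_pow_left₀ (frob_nonneg _) h 2).trans ?_
    rw [mul_pow, Real.sq_sqrt (by positivity)]
    gcongr
    exact hw.covNormSq_le hS hb hb0 hN hA

lemma IsGaussianModel.integral_norm_ntr_pow_four_le {M L N : ℕ}
    {w : Fin M → Fin (N + L - 1) → Ω → ℂ}
    (hw : IsGaussianModel P (fun m => corr (S m)) M L N w)
    (hS : ∀ m, IntervalIntegrable (S m) volume 0 1)
    (hb : ∀ m, ∀ ν ∈ Set.Icc (0 : ℝ) 1, S m ν ≤ b) (hb0 : 0 ≤ b)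
    {z : ℂ} (hz : z ∈ cutPlane) {A : Matrix (Fin M × Fin L) (Fin M × Fin L) ℂ} {C : ℝ}
    (hA : ‖A‖ ≤ C) :
    ∫ ω, ‖ntr (A * (resolvent w z ω - meanResolvent P w z))‖ ^ 4 ∂P ≤
      concConst z * b ^ 2 * C ^ 4 / (N : ℝ) ^ 2 := by
  have hcc := concConst_nonneg z
  have hC : 0 ≤ C := (norm_nonneg _).trans hA
  have h1 := hw.isCircularGaussian.integral_norm_trace_sub_pow_four_le
    (hw.integral_norm_trace_sq_le hS hb) (by positivity) hz A
  have h2 : frob A ^ 4 ≤ ((M * L : ℝ) * C ^ 2) ^ 2 := by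
    rw [show frob A ^ 4 = (frob A ^ 2) ^ 2 by ring]
    refine pow_le_pow_left₀ (by positivity) ((frob_sq_le A).trans ?_) 2
    rw [Fintype.card_prod, Fintype.card_fin, Fintype.card_fin]
    push_cast
    gcongr
  have h3 : ∀ ω, ‖ntr (A * (resolvent w z ω - meanResolvent P w z))‖ ^ 4 = (1 / (M * L : ℝ)) ^ 4 *
      ‖(A * (res (hankel w ω) z - meanRes P (hankel w) z)).trace‖ ^ 4 := by
    intro ω
    rw [ntr, norm_mul, mul_pow, norm_div, norm_one, norm_mul, Complex.norm_natCast,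
      Complex.norm_natCast]
    rfl
  simp only [h3]
  rw [integral_const_mul]
  calc _ ≤ (1 / (M * L : ℝ)) ^ 4 * (concConst z * (b * L / N) ^ 2 * ((M * L : ℝ) * C ^ 2) ^ 2) := by
        gcongr
        refine h1.trans ?_
        gcongr
    _ ≤ _ := by
      -- If a dimension vanishes, the normalizing factor is `1/0 = 0` and nothing remains to be
      -- proved.
      rcases Nat.eq_zero_or_pos M with hM | hM
      · rw [show (1 / (M * L : ℝ)) ^ 4 = 0 by simp [hM], zero_mul]
        positivity
      rcases Nat.eq_zero_or_pos L with hL | hL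
      · rw [show (1 / (M * L : ℝ)) ^ 4 = 0 by simp [hL], zero_mul]
        positivity
      have hM1 : (1 : ℝ) ≤ M := by exact_mod_cast hM
      have hM0 : (M : ℝ) ≠ 0 := by positivity
      have hL0 : (L : ℝ) ≠ 0 := by positivity
      -- `L` cancels: `(L/N)² (ML)² / (ML)⁴ = 1/(MN)²`. The gain `1/M²` is then discarded, since
      -- `1/N²` is already summable.
      have h4 : (1 / (M * L : ℝ)) ^ 4 *
          (concConst z * (b * L / N) ^ 2 * ((M * L : ℝ) * C ^ 2) ^ 2) =
          (concConst z * b ^ 2 * C ^ 4 / (N : ℝ) ^ 2) * (1 / (M : ℝ) ^ 2) := by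
        field_simp
      rw [h4]
      refine mul_le_of_le_one_right (by positivity) ?_
      rw [div_le_one (by positivity)]
      exact one_le_pow₀ hM1

lemma IsGaussianModel.integrable_norm_ntr_pow_four {M L N : ℕ}
    {w : Fin M → Fin (N + L - 1) → Ω → ℂ} {r : ℕ → ℤ → ℂ} (hw : IsGaussianModel P r M L N w)
    {z : ℂ} (hz : z ∈ cutPlane) (A : Matrix (Fin M × Fin L) (Fin M × Fin L) ℂ) :
    Integrable (fun ω => ‖ntr (A * (resolvent w z ω - meanResolvent P w z))‖ ^ 4) P := by
  have hG := hw.isCircularGaussian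
  refine hG.integrable_norm_pow_of_bounded
    (F := fun X => ntr (A * (res X z - meanRes P (hankel w) z)))
    (C := ‖A‖ * ((rayDist z)⁻¹ + (rayDist z)⁻¹)) ?_ (fun X => ?_) 4
  · exact continuous_const.mul (continuous_const.matrix_mul
      ((continuous_res hz).sub continuous_const)).matrix_trace
  · refine (norm_ntr_mul_le _ _).trans ?_
    gcongr
    exact (norm_sub_le _ _).trans (add_le_add (norm_res_le X hz) (hG.norm_meanRes_le hz))

variable {M L : ℕ → ℕ} {c : ℝ} {w : ∀ N : ℕ, Fin (M N) → Fin (N + L N - 1) → Ω → ℂ}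

/-- The index is shifted by one because the model is only given for `N ≥ 1`; the fourth moments are
then at most a constant over `(n + 1)²`. -/
lemma ae_tendsto_ntr_resolvent_sub
    (hS : ∀ m, IntervalIntegrable (S m) volume 0 1)
    (hb : ∀ m, ∀ ν ∈ Set.Icc (0 : ℝ) 1, S m ν ≤ b) (hb0 : 0 ≤ b)
    (hw : ∀ N, 1 ≤ N → IsGaussianModel P (fun m => corr (S m)) (M N) (L N) N (w N))
    {A : ∀ N, Matrix (Fin (M N) × Fin (L N)) (Fin (M N) × Fin (L N)) ℂ} {C : ℝ}
    (hA : ∀ N, 1 ≤ N → ‖A N‖ ≤ C) {z : ℂ} (hz : z ∈ cutPlane) :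
    ∀ᵐ ω ∂P, Tendsto (fun N => ntr (A N * (resolvent (w N) z ω - meanResolvent P (w N) z)))
      atTop (𝓝 0) := by
  have h := ae_tendsto_zero_of_integral_norm_pow_four_le (P := P)
    (X := fun n ω => ntr (A (n + 1) * (resolvent (w (n + 1)) z ω - meanResolvent P (w (n + 1)) z)))
    (K := concConst z * b ^ 2 * C ^ 4)
    (fun n => (hw (n + 1) (by omega)).integrable_norm_ntr_pow_four hz _)
    (fun n => by
      refine ((hw (n + 1) (by omega)).integral_norm_ntr_pow_four_le hS hb hb0 hz
        (hA (n + 1) (by omega))).trans (le_of_eq ?_)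
      push_cast
      rfl)
  filter_upwards [h] with ω hω
  exact (tendsto_add_atTop_iff_nat 1).1 hω

/-- `L N = 0` would make the ratio vanish, whereas it tends to `c > 0`. -/
lemma eventually_dimensions (hc : 0 < c) (hM : Tendsto M atTop atTop)
    (hML : Tendsto (fun N : ℕ => (M N * L N : ℝ) / N) atTop (𝓝 c)) :
    ∀ᶠ N in atTop, 1 ≤ N ∧ 1 ≤ M N ∧ 1 ≤ L N ∧ (M N * L N : ℝ) / N ≤ c + 1 := by
  filter_upwards [eventually_ge_atTop 1, hM.eventually_ge_atTop 1, hML.eventually_const_lt hc,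
    hML.eventually_le_const (lt_add_one c)] with N h1 h2 h3 h4
  refine ⟨h1, h2, Nat.one_le_iff_ne_zero.2 fun h => ?_, h4⟩
  rw [h] at h3
  simp at h3

/-- `L/N = c_N/M`: it is the growth of `M` that makes the Hankel repetitions negligible. -/
lemma tendsto_blockSize_div (hM : Tendsto M atTop atTop)
    (hML : Tendsto (fun N : ℕ => (M N * L N : ℝ) / N) atTop (𝓝 c)) :
    Tendsto (fun N : ℕ => (L N : ℝ) / N) atTop (𝓝 0) := by
  refine (hML.div_atTop (tendsto_natCast_atTop_atTop.comp hM)).congr' ?_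
  filter_upwards [hM.eventually_ge_atTop 1] with N h
  have : (M N : ℝ) ≠ 0 := by exact_mod_cast (by omega : M N ≠ 0)
  simp only [Function.comp_apply]
  field_simp

/-- Once `c_N ≤ c + 1`, the constant `g` bounds all couplings, and on the fixed disc about `-(4g +
5)` the squared normalized trace is at most a constant times `(L/N)²`. The functions are holomorphic
and locally bounded uniformly in `N`, so Vitali extends the limit. The shift by `n₀` drops the
finitely many degenerate `N`. -/
lemma tendsto_ntr_meanResolvent_sub (hc : 0 < c) (hM : Tendsto M atTop atTop)
    (hML : Tendsto (fun N : ℕ => (M N * L N : ℝ) / N) atTop (𝓝 c)) (hb0 : 0 ≤ b)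
    (hw : ∀ N, 1 ≤ N → IsGaussianModel P (fun m => corr (S m)) (M N) (L N) N (w N))
    {T : ∀ N, ℂ → Matrix (Fin (M N) × Fin (L N)) (Fin (M N) × Fin (L N)) ℂ}
    (hT : ∀ N, 1 ≤ N → 1 ≤ M N → 1 ≤ L N → IsStieltjes (T N) ∧
      (∀ z ∈ cutPlane, ‖T N z‖ ≤ (rayDist z)⁻¹) ∧
      ∀ z ∈ cutPlane, ‖z‖ * (rayDist z)⁻¹ ^ 2 * Real.sqrt (b * (b * (M N * L N / N))) ≤ 1 / 2 →
        frob (meanRes P (hankel (w N)) z - T N z) ^ 2 ≤ (4 * ‖z‖ * (rayDist z)⁻¹ ^ 2) ^ 2 *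
          (Real.sqrt (concConst z) * (b * L N / N) * (b * L N / N * (b * (M N * L N)))))
    {A : ∀ N, Matrix (Fin (M N) × Fin (L N)) (Fin (M N) × Fin (L N)) ℂ} {C : ℝ}
    (hA : ∀ N, 1 ≤ N → ‖A N‖ ≤ C) {z : ℂ} (hz : z ∈ cutPlane) :
    Tendsto (fun N => ntr (A N * (meanResolvent P (w N) z - T N z))) atTop (𝓝 0) := by
  obtain ⟨n₀, hn₀⟩ := eventually_atTop.1 (eventually_dimensions hc hM hML)
  have hC : 0 ≤ C := (norm_nonneg _).trans (hA 1 le_rfl)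
  set g := Real.sqrt (b * (b * (c + 1))) with hg
  have hg0 : 0 ≤ g := Real.sqrt_nonneg _
  have hLN := tendsto_blockSize_div hM hML
  refine (tendsto_add_atTop_iff_nat n₀).1 ?_
  refine tendsto_zero_of_isPreconnected isOpen_cutPlane isPreconnected_cutPlane
    (f := fun n z => ntr (A (n + n₀) * (meanResolvent P (w (n + n₀)) z - T (n + n₀) z)))
    (B := fun z => C * ((rayDist z)⁻¹ + (rayDist z)⁻¹)) (fun n => ?_)
    (continuousOn_const.mul (continuousOn_inv_rayDist.add continuousOn_inv_rayDist))
    (fun n z hz => ?_) (neg_mem_cutPlane (t := 4 * g + 5) (by positivity)) ?_ z hz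
  · obtain ⟨h1, h2, h3, -⟩ := hn₀ (n + n₀) (by omega)
    exact differentiableOn_ntr_mul _ fun p q =>
      ((hw _ h1).isCircularGaussian.differentiableOn_meanRes p q).sub
        ((hT _ h1 h2 h3).1.differentiableOn p q)
  · obtain ⟨h1, h2, h3, -⟩ := hn₀ (n + n₀) (by omega)
    refine (norm_ntr_mul_le _ _).trans (mul_le_mul (hA _ h1) ?_ (norm_nonneg _) hC)
    exact (norm_sub_le _ _).trans (add_le_add ((hw _ h1).isCircularGaussian.norm_meanRes_le hz)
      ((hT _ h1 h2 h3).2.1 z hz))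
  · refine Filter.eventually_of_mem (Metric.ball_mem_nhds _ one_pos) fun z hz => ?_
    have hzc : z ∈ cutPlane := ball_neg_subset_cutPlane (by linarith) hz
    have hsmall := norm_mul_inv_rayDist_sq_le hg0 hz
    have hr : 0 ≤ (rayDist z)⁻¹ := inv_nonneg.2 (rayDist_pos hzc).le
    set K := C ^ 2 * ((4 * ‖z‖ * (rayDist z)⁻¹ ^ 2) ^ 2 * (Real.sqrt (concConst z) * b ^ 3)) with hK
    have hK0 : 0 ≤ K := by positivity
    have hlim := ((tendsto_add_atTop_iff_nat n₀).2 hLN).const_mul (Real.sqrt K)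
    rw [mul_zero] at hlim
    refine squeeze_zero_norm (fun n => ?_) hlim
    obtain ⟨h1, h2, h3, h4⟩ := hn₀ (n + n₀) (by omega)
    set N := n + n₀ with hN
    have hM0 : (M N : ℝ) ≠ 0 := by exact_mod_cast (by omega : M N ≠ 0)
    have hL0 : (L N : ℝ) ≠ 0 := by exact_mod_cast (by omega : L N ≠ 0)
    have h5 := (hT _ h1 h2 h3).2.2 z hzc ((mul_le_mul_of_nonneg_left (Real.sqrt_le_sqrt
      (by gcongr)) (by positivity)).trans hsmall)
    refine abs_le_of_sq_le_sq' ((norm_ntr_mul_sq_le _ _).trans ?_) (by positivity) |>.2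
    rw [mul_pow, Real.sq_sqrt hK0]
    calc _ ≤ C ^ 2 * ((4 * ‖z‖ * (rayDist z)⁻¹ ^ 2) ^ 2 * (Real.sqrt (concConst z) *
          (b * L N / N) * (b * L N / N * (b * (M N * L N))))) / (M N * L N) := by
          gcongr
          · exact hA _ h1
          · exact h5
      _ = K * ((L N : ℝ) / N) ^ 2 := by
        rw [hK]
        field_simp

end Model

end

end BlockHankel

end

/-! ### The deterministic equivalent. -/

theorem mainTheorem1 {Ω : Type*} [MeasurableSpace Ω] (P : Measure Ω) [IsProbabilityMeasure P]
    -- the dimensions `M = M(N)`, `L = L(N)`, with `M, N → ∞` and `ML/N → c > 0`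
    (M L : ℕ → ℕ) (c : ℝ) (hc : 0 < c)
    (hM : Tendsto M atTop atTop)
    (hML : Tendsto (fun N : ℕ => (M N * L N : ℝ) / N) atTop (𝓝 c))
    -- the spectral densities, bounded above and bounded away from `0`
    (S : ℕ → ℝ → ℝ)
    (hS : ∀ m, IntervalIntegrable (S m) volume 0 1)
    (hS_upper : ∃ b : ℝ, ∀ m, ∀ ν ∈ Set.Icc (0 : ℝ) 1, S m ν ≤ b)
    (hS_lower : ∃ a : ℝ, 0 < a ∧ ∀ m, ∀ ν ∈ Set.Icc (0 : ℝ) 1, a ≤ S m ν)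
    -- the summability condition on the correlation sequences
    (hr : ∃ C : ℝ, ∀ K : ℕ, 1 ≤ K →
      Summable (fun n : ℤ =>
        Real.sqrt ((1 / (K : ℝ)) * ∑ m ∈ Finset.range K, ‖BlockHankel.corr (S m) n‖ ^ 2)) ∧
      ∑' n : ℤ,
        Real.sqrt ((1 / (K : ℝ)) * ∑ m ∈ Finset.range K, ‖BlockHankel.corr (S m) n‖ ^ 2) ≤ C)
    -- the Gaussian entries of the block-Hankel matrices
    (w : ∀ N : ℕ, Fin (M N) → Fin (N + L N - 1) → Ω → ℂ)
    (hw : ∀ N, 1 ≤ N →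
      BlockHankel.IsGaussianModel P (fun m => BlockHankel.corr (S m)) (M N) (L N) N (w N)) :
    -- the expectation of the resolvent is well defined
    (∀ N, 1 ≤ N → ∀ z ∈ BlockHankel.cutPlane, ∀ p q,
      Integrable (fun ω => BlockHankel.resolvent (w N) z ω p q) P) ∧
    ∃ (T : ∀ N, ℂ → Matrix (Fin (M N) × Fin (L N)) (Fin (M N) × Fin (L N)) ℂ)
      (T' : ∀ N, ℂ → Matrix (Fin N) (Fin N) ℂ),
      -- `(T N, T' N)` is the unique solution of the canonical equation
      (∀ N, 1 ≤ N → 1 ≤ M N → 1 ≤ L N →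
        BlockHankel.IsCanonicalSolution (fun m => BlockHankel.corr (S m)) (M N) (L N) N
          (T N) (T' N) ∧
        ∀ U U', BlockHankel.IsCanonicalSolution (fun m => BlockHankel.corr (S m)) (M N) (L N) N
            U U' →
          Set.EqOn U (T N) BlockHankel.cutPlane ∧ Set.EqOn U' (T' N) BlockHankel.cutPlane) ∧
      -- convergence for uniformly bounded deterministic matrices (in spectral norm)
      (∀ A : ∀ N, Matrix (Fin (M N) × Fin (L N)) (Fin (M N) × Fin (L N)) ℂ,
        (∃ C : ℝ, ∀ N, 1 ≤ N → ‖Matrix.toEuclideanCLM (𝕜 := ℂ) (A N)‖ ≤ C) →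
        ∀ z ∈ BlockHankel.cutPlane,
          (∀ᵐ ω ∂P, Tendsto (fun N => BlockHankel.ntr
            (A N * (BlockHankel.resolvent (w N) z ω - BlockHankel.meanResolvent P (w N) z)))
            atTop (𝓝 0)) ∧
          Tendsto (fun N => BlockHankel.ntr
            (A N * (BlockHankel.meanResolvent P (w N) z - T N z))) atTop (𝓝 0) ∧
          (∀ᵐ ω ∂P, Tendsto (fun N => BlockHankel.ntr
            (A N * (BlockHankel.resolvent (w N) z ω - T N z))) atTop (𝓝 0))) ∧
      -- convergence of the Stieltjes transforms
      (∀ z ∈ BlockHankel.cutPlane, ∀ᵐ ω ∂P,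
        Tendsto (fun N => BlockHankel.empStieltjes (w N) z ω - BlockHankel.ntr (T N z))
          atTop (𝓝 0)) := by
  classical
  obtain ⟨b, hb⟩ := hS_upper
  obtain ⟨a, ha, hab⟩ := hS_lower
  -- Evaluate both bounds on the density at `m = 0`, `ν = 0`.
  have hb0 : 0 ≤ b := ha.le.trans ((hab 0 0 (by simp)).trans (hb 0 0 (by simp)))
  refine ⟨fun N hN z hz p q => (hw N hN).isCircularGaussian.integrable_res hz p q, ?_⟩
  have key : ∀ N, ∃ T T', ∀ (_ : 1 ≤ N) (_ : 1 ≤ M N) (_ : 1 ≤ L N), _ :=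
    fun N => by
      by_cases h : 1 ≤ N ∧ 1 ≤ M N ∧ 1 ≤ L N
      · obtain ⟨T, T', hT⟩ := (hw N h.1).exists_isCanonicalSolution hS hb hb0 h.1 h.2.1 h.2.2
        exact ⟨T, T', fun _ _ _ => hT⟩
      · exact ⟨0, 0, fun h1 h2 h3 => absurd ⟨h1, h2, h3⟩ h⟩
  choose T T' hT using key
  have hconv : ∀ A : ∀ N, Matrix (Fin (M N) × Fin (L N)) (Fin (M N) × Fin (L N)) ℂ,
      (∃ C : ℝ, ∀ N, 1 ≤ N → ‖Matrix.toEuclideanCLM (𝕜 := ℂ) (A N)‖ ≤ C) →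
      ∀ z ∈ BlockHankel.cutPlane,
        (∀ᵐ ω ∂P, Tendsto (fun N => BlockHankel.ntr
          (A N * (BlockHankel.resolvent (w N) z ω - BlockHankel.meanResolvent P (w N) z)))
          atTop (𝓝 0)) ∧
        Tendsto (fun N => BlockHankel.ntr
          (A N * (BlockHankel.meanResolvent P (w N) z - T N z))) atTop (𝓝 0) ∧
        (∀ᵐ ω ∂P, Tendsto (fun N => BlockHankel.ntr
          (A N * (BlockHankel.resolvent (w N) z ω - T N z))) atTop (𝓝 0)) := by
    rintro A ⟨C, hA⟩ z hz
    have h1 := BlockHankel.ae_tendsto_ntr_resolvent_sub hS hb hb0 hw hA hz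
    have h2 := BlockHankel.tendsto_ntr_meanResolvent_sub hc hM hML hb0 hw
      (fun N hN hMN hLN => ⟨(hT N hN hMN hLN).1.stieltjes, (hT N hN hMN hLN).2.2⟩) hA hz
    refine ⟨h1, h2, ?_⟩
    filter_upwards [h1] with ω hω
    have h3 := hω.add h2
    rw [add_zero] at h3
    refine h3.congr fun N => ?_
    rw [← BlockHankel.ntr_add, ← Matrix.mul_add, sub_add_sub_cancel]
  refine ⟨T, T', fun N hN hMN hLN => ⟨(hT N hN hMN hLN).1, (hT N hN hMN hLN).2.1⟩, hconv,
    fun z hz => ?_⟩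
  -- The Stieltjes transforms are the case `A = 1`; the norm in `hconv` is by definition the `L2`
  -- operator norm.
  have h := (hconv (fun _ => 1) ⟨1, fun N _ => BlockHankel.norm_one_matrix_le⟩ z hz).2.2
  filter_upwards [h] with ω hω
  refine hω.congr fun N => ?_
  rw [Matrix.one_mul, BlockHankel.empStieltjes_eq_ntr _ hz, sub_eq_add_neg,
    BlockHankel.ntr_add, BlockHankel.ntr, BlockHankel.ntr, BlockHankel.ntr, Matrix.trace_neg]
  ring
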